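/- **Proposition 5.1.** Let $\Sigma$ be a connected, orientable surface without boundary (Hausdorff, second countable), endowed with a smooth structure, which is nonspherical, i.e. contains a simple closed curve whose complement in $\Sigma$ is connected. (Equivalently, $\Sigma$ does not embed in the $2$-sphere.) Call a subset $a\subset\Sigma$ a *smooth nonseparating curve* if $a$ is the image of a smooth embedding $\mathbb{R}/\mathbb{Z}\to\Sigma$ and $\Sigma\smallsetminus a$ is connected. Two such curves $a,b$ are *transverse* if $T_pa+T_pb=T_p\Sigma$ for every $p\in a\cap b$. Let $\mathrm{Homeo}_{\infty\pitchfork}(\Sigma)$ be the group of bijections $h\colon\Sigma\to\Sigma$ that preserve smooth nonseparating curves and transversality, that is: - for every subset $a\subset\Sigma$, the set $h(a)$ is a smooth nonseparating curve if and only if $a$ is; - for all smooth nonseparating curves $a,b\subset\Sigma$, the curves $h(a)$ and $h(b)$ are transverse if and only if $a$ and $b$ are. Then every $h\in\mathrm{Homeo}_{\infty\pitchfork}(\Sigma)$ is a homeomorphism of $\Sigma$; that is, $\mathrm{Homeo}_{\infty\pitchfork}(\Sigma)$ is a subgroup of $\mathrm{Homeo}(\Sigma)$. -/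

import Mathlib

open scoped Manifold ContDiff

/-- `a` is a simple closed curve: the image of a continuous `1`-periodic map `ℝ → S` that is
injective on a period, that is, of an injective continuous map from the circle `ℝ / ℤ`. -/
def IsSimpleClosedCurve {S : Type*} [TopologicalSpace S] (a : Set S) : Prop :=
  ∃ γ : ℝ → S, Continuous γ ∧ Function.Periodic γ 1 ∧ Set.InjOn γ (Set.Ico 0 1) ∧
    Set.range γ = a

/-- `a` does not separate `S`: its complement is connected. -/
def IsNonseparating {S : Type*} [TopologicalSpace S] (a : Set S) : Prop :=
  IsConnected aᶜ

/-- `S` is nonspherical: it contains a nonseparating simple closed curve. -/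
def IsNonspherical (S : Type*) [TopologicalSpace S] : Prop :=
  ∃ a : Set S, IsSimpleClosedCurve a ∧ IsNonseparating a

section Surface

variable {S : Type*} [TopologicalSpace S] [ChartedSpace (EuclideanSpace ℝ (Fin 2)) S]

/-- `S` is orientable: it is covered by charts of its smooth structure whose changes of
coordinates all have positive Jacobian determinant. -/
def IsOrientableSurface (S : Type*) [TopologicalSpace S]
    [ChartedSpace (EuclideanSpace ℝ (Fin 2)) S] : Prop :=
  ∃ A ⊆ IsManifold.maximalAtlas (𝓡 2) ∞ S,
    (∀ x : S, ∃ e ∈ A, x ∈ e.source) ∧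
    ∀ e ∈ A, ∀ e' ∈ A, ∀ x ∈ e.source ∩ e'.source,
      0 < (fderiv ℝ (e' ∘ e.symm) (e x)).det

/-- `γ` parametrizes the smooth simple closed curve `a`: it is a smooth `1`-periodic immersion
`ℝ → S`, injective on a period, with image `a`. Equivalently, it induces a smooth embedding of
the circle `ℝ / ℤ` with image `a`. -/
structure IsSmoothParam (γ : ℝ → S) (a : Set S) : Prop where
  contMDiff : ContMDiff 𝓘(ℝ, ℝ) (𝓡 2) ∞ γ
  periodic : Function.Periodic γ 1
  injOn : Set.InjOn γ (Set.Ico 0 1)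
  immersion : ∀ t : ℝ, Function.Injective (mfderiv 𝓘(ℝ, ℝ) (𝓡 2) γ t)
  range_eq : Set.range γ = a

/-- `a` is a smooth nonseparating simple closed curve. -/
def IsSmoothNonsepCurve (a : Set S) : Prop :=
  (∃ γ : ℝ → S, IsSmoothParam γ a) ∧ IsNonseparating a

/-- The tangent line `T_p a ⊆ T_p S` of a smooth simple closed curve `a` at `p`: the span of the
velocities at `p` of the smooth parametrizations of `a`. -/
noncomputable def curveTangent (a : Set S) (p : S) : Submodule ℝ (TangentSpace (𝓡 2) p) :=
  Submodule.span ℝ {v | ∃ (γ : ℝ → S) (t : ℝ), IsSmoothParam γ a ∧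
    tangentMap 𝓘(ℝ, ℝ) (𝓡 2) γ ⟨t, (1 : ℝ)⟩ = ⟨p, v⟩}

/-- The curves `a` and `b` are transverse: `T_p a + T_p b = T_p S` at each common point `p`. -/
def AreTransverse (a b : Set S) : Prop :=
  ∀ p ∈ a ∩ b, curveTangent a p ⊔ curveTangent b p = ⊤

end Surface

/-- `Homeo(S)`, as a group of bijections of `S`. -/
def homeoGroup (S : Type*) [TopologicalSpace S] : Subgroup (Equiv.Perm S) where
  carrier := {h | Continuous h ∧ Continuous h.symm}
  mul_mem' := fun {_ _} hf hg => ⟨hf.1.comp hg.1, hg.2.comp hf.2⟩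
  one_mem' := ⟨continuous_id, continuous_id⟩
  inv_mem' := fun {_} hf => ⟨hf.2, hf.1⟩

/-- The group of bijections `h` of `S` such that `h` and `h⁻¹` preserve the family of smooth
nonseparating simple closed curves, and transversality between such curves. -/
def homeoSmoothTransverse (S : Type*) [TopologicalSpace S]
    [ChartedSpace (EuclideanSpace ℝ (Fin 2)) S] : Subgroup (Equiv.Perm S) where
  carrier := {h | (∀ a : Set S, IsSmoothNonsepCurve (h '' a) ↔ IsSmoothNonsepCurve a) ∧
    ∀ a b : Set S, IsSmoothNonsepCurve a → IsSmoothNonsepCurve b →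
      (AreTransverse (h '' a) (h '' b) ↔ AreTransverse a b)}
  mul_mem' := by
    intro f g hf hg
    have key : ∀ a : Set S, (f * g : Equiv.Perm S) '' a = f '' (g '' a) := fun a => by
      rw [← Set.image_comp]; rfl
    refine ⟨fun a => ?_, fun a b ha hb => ?_⟩
    · rw [key, hf.1, hg.1]
    · rw [key, key, hf.2 _ _ ((hg.1 a).2 ha) ((hg.1 b).2 hb), hg.2 a b ha hb]
  one_mem' := by
    have key : ∀ a : Set S, (1 : Equiv.Perm S) '' a = a := fun a => Set.image_id a
    exact ⟨fun a => by rw [key], fun a b _ _ => by rw [key, key]⟩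
  inv_mem' := by
    intro f hf
    have key : ∀ a : Set S, f '' ((f⁻¹ : Equiv.Perm S) '' a) = a := fun a =>
      f.image_symm_image a
    have h1 : ∀ a : Set S, IsSmoothNonsepCurve ((f⁻¹ : Equiv.Perm S) '' a) ↔
        IsSmoothNonsepCurve a := fun a => by rw [← hf.1, key]
    exact ⟨h1, fun a b ha hb => by rw [← hf.2 _ _ ((h1 a).2 ha) ((h1 b).2 hb), key, key]⟩

open Set Filter Topology

set_option linter.unusedSectionVars false

/-! The topology of the surface is recovered from its smooth nonseparating curves. They abound as
soon as one exists: diffeomorphisms supported in a connected open set act transitively on it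
(`exists_diffeo_map_eq`), so such a curve passes through every point and can be modified inside any
small disc.

Let `h` preserve these curves. It is continuous along each of them (`continuousOn_nonsepCurve`): a
diffeomorphism supported in a small disc about `h x` pushes the image curve off `h x`, and the
preimage of the pushed curve is a compact set missing `x`; points of the original curve close to `x`
avoid it, so their images lie in the disc. It follows that `h` maps connected open sets to connected
sets (`isPreconnected_image_of_isOpen`), because neighbouring points are joined by short arcs of
nonseparating curves. Finally, four nonseparating curves can enclose a point in an arbitrarily small
complementary component (`exists_nonsepCurves_surrounding`). The component of `h x` off the image
curves is an open set which `h⁻¹` sends into that small component, so `h` is open, and likewise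
`h⁻¹`.

What remains is to find one smooth nonseparating curve, given only a continuous one, which may be
wild. After a diffeomorphism, that curve has a chord `c` which is straight in a chart
(`exists_chord`); the ends of `c` cut it into arcs `A` and `B`. By the theta curve argument
(`exists_connected_sides`), the two sides of `c` are joined by a path off `X ∪ c` for `X = A` or `X
= B`. The far end of `c` can be dragged along `X` back to near its start without touching this path
or the first half of the chord. Closing up there (`exists_smoothParam_of_returning_arc`) and
rounding the corner (`exists_smoothParam_rounding`) gives a smooth loop whose two sides are still
joined by the path, so it does not separate (`IsSmoothParam.isNonseparating`). -/

/-- The Euclidean plane, on which surfaces are modelled. -/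
abbrev Plane := EuclideanSpace ℝ (Fin 2)

/-! ### Rotations and twists of the plane. -/

namespace Plane

theorem norm_sq (z : Plane) : ‖z‖ ^ 2 = z 0 ^ 2 + z 1 ^ 2 := by
  rw [EuclideanSpace.norm_sq_eq, Fin.sum_univ_two]; simp

theorem contDiff_mk {X : Type*} [NormedAddCommGroup X] [NormedSpace ℝ X] {f g : X → ℝ}
    (hf : ContDiff ℝ ∞ f) (hg : ContDiff ℝ ∞ g) :
    ContDiff ℝ ∞ (fun x => (!₂[f x, g x] : Plane)) := by
  rw [contDiff_euclidean]
  intro i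
  fin_cases i
  · simpa using hf
  · simpa using hg

theorem contDiff_coord (i : Fin 2) : ContDiff ℝ ∞ (fun z : Plane => z i) :=
  (EuclideanSpace.proj (𝕜 := ℝ) i : Plane →L[ℝ] ℝ).contDiff

/-- Rotation of the plane by the angle `θ`. -/
noncomputable def rot (θ : ℝ) (z : Plane) : Plane :=
  !₂[Real.cos θ * z 0 - Real.sin θ * z 1, Real.sin θ * z 0 + Real.cos θ * z 1]

@[simp] theorem rot_apply_zero (θ : ℝ) (z : Plane) :
    rot θ z 0 = Real.cos θ * z 0 - Real.sin θ * z 1 := rfl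

@[simp] theorem rot_apply_one (θ : ℝ) (z : Plane) :
    rot θ z 1 = Real.sin θ * z 0 + Real.cos θ * z 1 := rfl

theorem ext' {z w : Plane} (h0 : z 0 = w 0) (h1 : z 1 = w 1) : z = w := by
  ext i; fin_cases i
  · exact h0
  · exact h1

theorem rot_zero (z : Plane) : rot 0 z = z := by
  apply ext' <;> simp

theorem rot_neg_rot (θ : ℝ) (z : Plane) : rot (-θ) (rot θ z) = z := by
  have := Real.sin_sq_add_cos_sq θ
  apply ext'
  · simp; linear_combination z 0 * this
  · simp; linear_combination z 1 * this

theorem norm_rot (θ : ℝ) (z : Plane) : ‖rot θ z‖ = ‖z‖ := by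
  have h : ‖rot θ z‖ ^ 2 = ‖z‖ ^ 2 := by
    rw [norm_sq, norm_sq]; simp
    linear_combination (z 0 ^ 2 + z 1 ^ 2) * Real.sin_sq_add_cos_sq θ
  exact (sq_eq_sq₀ (norm_nonneg _) (norm_nonneg _)).1 h

/-- The twist about `c`: the rotation by `θ` on `ball c r`, damped to the identity
outside `ball c R`. -/
noncomputable def twist (c : Plane) (r R θ : ℝ) (z : Plane) : Plane :=
  c + rot (θ * Real.smoothTransition ((R ^ 2 - ‖z - c‖ ^ 2) / (R ^ 2 - r ^ 2))) (z - c)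

variable {c : Plane} {r R θ : ℝ}

theorem contDiff_twist : ContDiff ℝ ∞ (twist c r R θ) := by
  have h1 : ContDiff ℝ ∞ (fun z : Plane => z - c) := contDiff_id.sub contDiff_const
  have h2 : ContDiff ℝ ∞ (fun z : Plane =>
      θ * Real.smoothTransition ((R ^ 2 - ‖z - c‖ ^ 2) / (R ^ 2 - r ^ 2))) :=
    contDiff_const.mul (Real.smoothTransition.contDiff.comp
      ((contDiff_const.sub (h1.norm_sq ℝ)).div_const _))
  have h0 := (contDiff_coord 0).comp h1
  have h3 := (contDiff_coord 1).comp h1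
  exact contDiff_const.add (contDiff_mk ((h2.cos.mul h0).sub (h2.sin.mul h3))
    ((h2.sin.mul h0).add (h2.cos.mul h3)))

theorem twist_sub (z : Plane) : twist c r R θ z - c =
    rot (θ * Real.smoothTransition ((R ^ 2 - ‖z - c‖ ^ 2) / (R ^ 2 - r ^ 2))) (z - c) := by
  simp [twist]

/-- The angle of the twist at `z` depends only on `‖z - c‖`, so preserving this norm makes the
twists by `θ` and `-θ` mutually inverse. -/
theorem norm_twist_sub (z : Plane) : ‖twist c r R θ z - c‖ = ‖z - c‖ := by
  rw [twist_sub, norm_rot]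

theorem twist_neg_twist (z : Plane) : twist c r R (-θ) (twist c r R θ z) = z := by
  rw [twist, norm_twist_sub, twist_sub, neg_mul, rot_neg_rot]; abel

theorem twist_of_le (hr : 0 < r) (hR : r < R) {z : Plane} (hz : dist z c ≤ r) :
    twist c r R θ z = c + rot θ (z - c) := by
  rw [dist_eq_norm] at hz
  have hpos : 0 < R ^ 2 - r ^ 2 := by nlinarith
  rw [twist, Real.smoothTransition.one_of_one_le, mul_one]
  rw [le_div_iff₀ hpos]
  nlinarith [norm_nonneg (z - c)]

theorem twist_of_ge (hr : 0 < r) (hR : r < R) {z : Plane} (hz : R ≤ dist z c) :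
    twist c r R θ z = z := by
  rw [dist_eq_norm] at hz
  have hpos : 0 < R ^ 2 - r ^ 2 := by nlinarith
  rw [twist, Real.smoothTransition.zero_of_nonpos, mul_zero, rot_zero]
  · abel
  · apply div_nonpos_of_nonpos_of_nonneg _ hpos.le
    nlinarith [norm_nonneg (z - c)]

end Plane

/-! ### Diffeomorphisms supported in a chart. -/

section Surface

variable {S : Type*} [TopologicalSpace S] [ChartedSpace Plane S]

/-- The charts of the smooth structure of `S`. -/
abbrev smoothCharts (S : Type*) [TopologicalSpace S] [ChartedSpace Plane S] :
    Set (OpenPartialHomeomorph S Plane) :=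
  IsManifold.maximalAtlas (𝓡 2) ∞ S

/-- Self-diffeomorphisms of `S`. -/
abbrev SelfDiffeo (S : Type*) [TopologicalSpace S] [ChartedSpace Plane S] :=
  S ≃ₘ^∞⟮𝓡 2, 𝓡 2⟯ S

open Classical in
/-- A self-map of the plane, read in the chart `e` and extended by the identity. -/
noncomputable def extendById (e : OpenPartialHomeomorph S Plane) (T : Plane → Plane) (x : S) : S :=
  if x ∈ e.source then e.symm (T (e x)) else x

theorem extendById_of_mem {e : OpenPartialHomeomorph S Plane} {T : Plane → Plane} {x : S}
    (hx : x ∈ e.source) : extendById e T x = e.symm (T (e x)) := if_pos hx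

theorem extendById_of_notMem_source {e : OpenPartialHomeomorph S Plane} {T : Plane → Plane} {x : S}
    (hx : x ∉ e.source) : extendById e T x = x := if_neg hx

/-- If `T z` left the target it would lie outside `K`, where `T'` is the identity; then `z = T' (T
z) = T z` would be outside the target as well. -/
theorem mapsTo_target {e : OpenPartialHomeomorph S Plane} {T T' : Plane → Plane} {K : Set Plane}
    (hK : K ⊆ e.target) (hT : ∀ z, T' (T z) = z) (h' : ∀ z ∉ K, T' z = z)
    {z : Plane} (hz : z ∈ e.target) : T z ∈ e.target := by
  by_contra hn
  have h1 : T z ∉ K := fun hh => hn (hK hh)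
  have h2 := h' _ h1
  rw [hT] at h2
  exact hn (h2 ▸ hz)

theorem extendById_comp {e : OpenPartialHomeomorph S Plane} {T T' : Plane → Plane} {K : Set Plane}
    (hK : K ⊆ e.target) (hT : ∀ z, T' (T z) = z) (h' : ∀ z ∉ K, T' z = z)
    (x : S) : extendById e T' (extendById e T x) = x := by
  by_cases hx : x ∈ e.source
  · have h1 := mapsTo_target hK hT h' (e.map_source hx)
    rw [extendById_of_mem hx, extendById_of_mem (e.map_target h1), e.right_inv h1, hT,
      e.left_inv hx]
  · rw [extendById_of_notMem_source hx, extendById_of_notMem_source hx]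

theorem extendById_of_notMem {e : OpenPartialHomeomorph S Plane} {T : Plane → Plane}
    {K : Set Plane} (h : ∀ z ∉ K, T z = z) {x : S} (hx : x ∉ e.symm '' K) :
    extendById e T x = x := by
  by_cases hs : x ∈ e.source
  · have : e x ∉ K := fun hh => hx ⟨e x, hh, e.left_inv hs⟩
    rw [extendById_of_mem hs, h _ this, e.left_inv hs]
  · exact extendById_of_notMem_source hs

/-- At a point outside the chart domain the map is the identity on a whole neighbourhood, because
the image of the compact set `K` is closed in a Hausdorff space. -/
theorem contMDiff_extendById [T2Space S] {e : OpenPartialHomeomorph S Plane}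
    (he : e ∈ smoothCharts S) {T T' : Plane → Plane} {K : Set Plane} (hKc : IsCompact K)
    (hK : K ⊆ e.target) (hT : ∀ z, T' (T z) = z) (h : ∀ z ∉ K, T z = z) (h' : ∀ z ∉ K, T' z = z)
    (hs : ContDiff ℝ ∞ T) : ContMDiff (𝓡 2) (𝓡 2) ∞ (extendById e T) := by
  intro x
  by_cases hx : x ∈ e.source
  · have h1 := mapsTo_target hK hT h' (e.map_source hx)
    have h2 : ContMDiffAt (𝓡 2) (𝓡 2) ∞ (fun y => e.symm (T (e y))) x := by
      have a1 := contMDiffAt_of_mem_maximalAtlas he hx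
      have a2 : ContMDiffAt (𝓡 2) (𝓡 2) ∞ T (e x) := hs.contMDiff.contMDiffAt
      have a3 := contMDiffAt_symm_of_mem_maximalAtlas he h1
      exact (a3.comp x (a2.comp x a1))
    refine h2.congr_of_eventuallyEq ?_
    filter_upwards [e.open_source.mem_nhds hx] with y hy
    exact extendById_of_mem hy
  · have hcl : IsClosed (e.symm '' K) :=
      (hKc.image_of_continuousOn (e.continuousOn_symm.mono hK)).isClosed
    have hx' : x ∈ (e.symm '' K)ᶜ := by
      rintro ⟨z, hz, rfl⟩
      exact hx (e.map_target (hK hz))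
    refine contMDiffAt_id.congr_of_eventuallyEq ?_
    filter_upwards [hcl.isOpen_compl.mem_nhds hx'] with y hy
    exact extendById_of_notMem h hy

/-- A compactly supported diffeomorphism of a chart extends to the surface. -/
theorem exists_diffeo_extending [T2Space S] {e : OpenPartialHomeomorph S Plane}
    (he : e ∈ smoothCharts S) {T T' : Plane → Plane} {K : Set Plane} (hKc : IsCompact K)
    (hK : K ⊆ e.target) (hT : ∀ z, T' (T z) = z) (hT' : ∀ z, T (T' z) = z)
    (h : ∀ z ∉ K, T z = z) (h' : ∀ z ∉ K, T' z = z)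
    (hs : ContDiff ℝ ∞ T) (hs' : ContDiff ℝ ∞ T') :
    ∃ Φ : SelfDiffeo S, (∀ x ∈ e.source, Φ x = e.symm (T (e x))) ∧
      ∀ x, x ∉ e.symm '' K → Φ x = x := by
  refine ⟨⟨⟨extendById e T, extendById e T', extendById_comp hK hT h',
    extendById_comp hK hT' h⟩, contMDiff_extendById he hKc hK hT h h' hs,
    contMDiff_extendById he hKc hK hT' h' h hs'⟩, fun x hx => ?_, fun x hx => ?_⟩
  · change extendById e T x = _
    exact extendById_of_mem hx
  · exact extendById_of_notMem h hx

/-- Rotation of a small disc of a chart, extended to a diffeomorphism of the surface. -/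
theorem exists_diffeo_rot [T2Space S] {e : OpenPartialHomeomorph S Plane}
    (he : e ∈ smoothCharts S) {c : Plane} {r R : ℝ} (θ : ℝ) (hr : 0 < r) (hR : r < R)
    (hK : Metric.closedBall c R ⊆ e.target) :
    ∃ Φ : SelfDiffeo S,
      (∀ z, dist z c ≤ r → Φ (e.symm z) = e.symm (c + Plane.rot θ (z - c))) ∧
      ∀ x, x ∉ e.symm '' Metric.closedBall c R → Φ x = x := by
  have hout : ∀ θ : ℝ, ∀ z ∉ Metric.closedBall c R, Plane.twist c r R θ z = z := fun θ z hz =>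
    Plane.twist_of_ge hr hR (le_of_lt (by simpa using hz))
  obtain ⟨Φ, h1, h2⟩ := exists_diffeo_extending he (isCompact_closedBall c R) hK
    (T := Plane.twist c r R θ) (T' := Plane.twist c r R (-θ)) Plane.twist_neg_twist
    (fun z => by simpa using Plane.twist_neg_twist (c := c) (r := r) (R := R) (θ := -θ) z)
    (hout θ) (hout (-θ)) Plane.contDiff_twist Plane.contDiff_twist
  refine ⟨Φ, fun z hz => ?_, h2⟩
  have hz' : z ∈ e.target := hK (Metric.closedBall_subset_closedBall hR.le hz)
  rw [h1 _ (e.map_target hz'), e.right_inv hz', Plane.twist_of_le hr hR hz]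

end Surface

/-! ### Transitivity of diffeomorphisms on connected open sets. -/

theorem Plane.one_lt_rank : 1 < Module.rank ℝ Plane := by
  rw [rank_eq_card_basis (EuclideanSpace.basisFun (Fin 2) ℝ).toBasis]; norm_num

/-- The punctured disc is the image of the punctured plane, which is connected in dimension greater
than one, under a radial contraction. -/
theorem Plane.isPreconnected_ball_diff_center (c : Plane) {R : ℝ} (hR : 0 < R) :
    IsPreconnected (Metric.ball c R \ {c}) := by
  have h1 := (isConnected_compl_singleton_of_one_lt_rank Plane.one_lt_rank (0 : Plane)).isPreconnected
  have h2 : Continuous (fun x : Plane => c + (R / (1 + ‖x‖)) • x) := by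
    have : ∀ x : Plane, 1 + ‖x‖ ≠ 0 := fun x => by positivity
    fun_prop (disch := assumption)
  convert h1.image _ h2.continuousOn using 1
  ext y
  simp only [Set.mem_sdiff, Metric.mem_ball, mem_singleton_iff, mem_image, mem_compl_iff, dist_eq_norm]
  constructor
  · rintro ⟨hy, hne⟩
    have hpos : 0 < R - ‖y - c‖ := by linarith
    refine ⟨(R - ‖y - c‖)⁻¹ • (y - c), ?_, ?_⟩
    · simp [hpos.ne', sub_eq_zero, hne]
    · rw [norm_smul, Real.norm_of_nonneg (by positivity), smul_smul]
      have : R / (1 + (R - ‖y - c‖)⁻¹ * ‖y - c‖) * (R - ‖y - c‖)⁻¹ = 1 := by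
        field_simp
        ring
      rw [this, one_smul]; abel
  · rintro ⟨x, hx, rfl⟩
    have hx' : 0 < ‖x‖ := norm_pos_iff.2 hx
    constructor
    · rw [add_sub_cancel_left, norm_smul, Real.norm_of_nonneg (by positivity), div_mul_eq_mul_div,
        div_lt_iff₀ (by positivity)]
      nlinarith
    · have : R / (1 + ‖x‖) ≠ 0 := by positivity
      simp [this, hx]

section Surface

variable {S : Type*} [TopologicalSpace S] [ChartedSpace Plane S]

theorem exists_closedBall_subset {e : OpenPartialHomeomorph S Plane} {x : S} (hx : x ∈ e.source)
    {Q : Set S} (hQ : Q ∈ 𝓝 x) :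
    ∃ R > 0, Metric.closedBall (e x) R ⊆ e.target ∧
      ∀ z ∈ Metric.closedBall (e x) R, e.symm z ∈ Q := by
  have h1 : e.target ∩ e.symm ⁻¹' Q ∈ 𝓝 (e x) := by
    apply inter_mem (e.open_target.mem_nhds (e.map_source hx))
    apply (e.continuousAt_symm (e.map_source hx)).preimage_mem_nhds
    rwa [e.left_inv hx]
  obtain ⟨R, hR, h⟩ := Metric.nhds_basis_closedBall.mem_iff.1 h1
  exact ⟨R, hR, fun z hz => (h hz).1, fun z hz => (h hz).2⟩

theorem isOpen_image_symm {e : OpenPartialHomeomorph S Plane} {s : Set Plane} (hs : IsOpen s)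
    (h : s ⊆ e.target) : IsOpen (e.symm '' s) :=
  e.symm.isOpen_image_of_subset_source hs h

theorem isPreconnected_image_symm {e : OpenPartialHomeomorph S Plane} {s : Set Plane}
    (hs : IsPreconnected s) (h : s ⊆ e.target) : IsPreconnected (e.symm '' s) :=
  hs.image _ (e.continuousOn_symm.mono h)

/-- A point does not disconnect an open connected set of a surface. -/
theorem IsPreconnected.diff_point [T1Space S] {Q : Set S} (hQ : IsPreconnected Q) (hQo : IsOpen Q)
    (p : S) : IsPreconnected (Q \ {p}) := by
  by_cases hp : p ∈ Q
  swap
  · rwa [sdiff_singleton_eq_self hp]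
  obtain ⟨R, hR, ht, hsub⟩ := exists_closedBall_subset (mem_chart_source Plane p)
    (hQo.mem_nhds hp)
  set e := chartAt Plane p
  have hbt : Metric.ball (e p) R ⊆ e.target := Metric.ball_subset_closedBall.trans ht
  set N := e.symm '' Metric.ball (e p) R with hN
  have hNo : IsOpen N := isOpen_image_symm Metric.isOpen_ball hbt
  have hpN : p ∈ N := ⟨e p, Metric.mem_ball_self hR, e.left_inv (mem_chart_source Plane p)⟩
  have hNQ : N ⊆ Q := by
    rintro _ ⟨z, hz, rfl⟩
    exact hsub z (Metric.ball_subset_closedBall hz)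
  have hNd : N \ {p} = e.symm '' (Metric.ball (e p) R \ {e p}) := by
    ext x
    constructor
    · rintro ⟨⟨z, hz, rfl⟩, hne⟩
      refine ⟨z, ⟨hz, ?_⟩, rfl⟩
      rintro rfl
      exact hne (e.left_inv (mem_chart_source Plane p))
    · rintro ⟨z, ⟨hz, hne⟩, rfl⟩
      refine ⟨⟨z, hz, rfl⟩, fun h => hne ?_⟩
      rw [mem_singleton_iff] at h ⊢
      rw [← h, e.right_inv (hbt hz)]
  have hNc : IsPreconnected (N \ {p}) := by
    rw [hNd]
    exact isPreconnected_image_symm (Plane.isPreconnected_ball_diff_center _ hR)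
      (sdiff_subset.trans hbt)
  -- Once the punctured disc lies in `u`, the point `p` can be added to the side of `u`, which turns
  -- a separation of `Q \ {p}` into one of `Q`.
  have key : ∀ u v : Set S, IsOpen u → IsOpen v → Q \ {p} ⊆ u ∪ v → (Q \ {p}) ∩ (u ∩ v) = ∅ →
      N \ {p} ⊆ u → Q \ {p} ⊆ u := by
    intro u v hu hv hc hd hNu
    have hQp : IsOpen (Q \ {p}) := hQo.sdiff isClosed_singleton
    have h := isPreconnected_iff_subset_of_disjoint.1 hQ ((u ∩ (Q \ {p})) ∪ N) (v ∩ (Q \ {p}))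
      ((hu.inter hQp).union hNo) (hv.inter hQp) ?_ ?_
    · rcases h with h | h
      · intro x hx
        rcases h hx.1 with h | h
        · exact h.1
        · exact hNu ⟨h, hx.2⟩
      · exact absurd rfl (h hp).2.2
    · intro x hx
      by_cases hxp : x = p
      · exact Or.inl (Or.inr (hxp ▸ hpN))
      · rcases hc ⟨hx, hxp⟩ with h | h
        · exact Or.inl (Or.inl ⟨h, hx, hxp⟩)
        · exact Or.inr ⟨h, hx, hxp⟩
    · rw [eq_empty_iff_forall_notMem] at hd ⊢
      rintro x ⟨-, h1 | h1, h2⟩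
      · exact hd x ⟨h1.2, h1.1, h2.1⟩
      · exact hd x ⟨h2.2, hNu ⟨h1, h2.2.2⟩, h2.1⟩
  rw [isPreconnected_iff_subset_of_disjoint]
  intro u v hu hv hc hd
  have hNQ' : N \ {p} ⊆ Q \ {p} := sdiff_subset_sdiff_left hNQ
  rcases isPreconnected_iff_subset_of_disjoint.1 hNc u v hu hv (hNQ'.trans hc)
    (subset_eq_empty (inter_subset_inter_left _ hNQ') hd) with h | h
  · exact Or.inl (key u v hu hv hc hd h)
  · exact Or.inr (key v u hv hu (by rwa [union_comm]) (by rwa [inter_comm v u]) h)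

theorem Plane.rot_pi (z : Plane) : Plane.rot Real.pi z = -z := by
  apply Plane.ext' <;> simp

/-- Diffeomorphisms supported in an open connected set act transitively on it. -/
theorem exists_diffeo_map_eq [T2Space S] [IsManifold (𝓡 2) ∞ S] {Q : Set S}
    (hQ : IsPreconnected Q) (hQo : IsOpen Q) {p q : S} (hp : p ∈ Q) (hq : q ∈ Q) :
    ∃ Φ : SelfDiffeo S, Φ p = q ∧ ∀ x ∉ Q, Φ x = x := by
  -- Lying in the same orbit is an equivalence relation, so on a connected set only nearby points
  -- need care: a half turn about their midpoint in a chart carries one to the other.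
  refine hQ.induction₂ (fun p q => ∃ Φ : SelfDiffeo S, Φ p = q ∧ ∀ x ∉ Q, Φ x = x)
    ?_ ?_ ?_ hp hq
  · intro x hx
    obtain ⟨R, hR, ht, hsub⟩ := exists_closedBall_subset (mem_chart_source Plane x)
      (hQo.mem_nhds hx)
    set e := chartAt Plane x with he
    have hxs : x ∈ e.source := mem_chart_source Plane x
    have hev : ∀ᶠ y in 𝓝 x, y ∈ e.source ∧ dist (e y) (e x) < R / 4 :=
      (e.open_source.eventually_mem hxs).and
        ((e.continuousAt hxs).eventually (Metric.ball_mem_nhds _ (by positivity)))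
    refine eventually_nhdsWithin_of_eventually_nhds (hev.mono ?_)
    rintro y ⟨hys, hy⟩
    set c : Plane := (1 / 2 : ℝ) • (e x + e y) with hc
    have hxc : e x - c = (1 / 2 : ℝ) • (e x - e y) := by rw [hc]; module
    have hd : dist (e x) c ≤ R / 4 := by
      rw [dist_eq_norm, hxc, norm_smul, ← dist_eq_norm, dist_comm]
      norm_num; linarith [dist_nonneg (x := e y) (y := e x)]
    have hball : Metric.closedBall c (R / 2) ⊆ Metric.closedBall (e x) R := by
      apply Metric.closedBall_subset_closedBall'
      rw [dist_comm]; linarith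
    obtain ⟨Φ, h1, h2⟩ := exists_diffeo_rot (IsManifold.chart_mem_maximalAtlas x) (c := c)
      Real.pi (show 0 < R / 4 by positivity) (show R / 4 < R / 2 by linarith) (hball.trans ht)
    refine ⟨Φ, ?_, fun z hz => h2 z ?_⟩
    · have h3 := h1 (e x) hd
      rw [← he, e.left_inv hxs, Plane.rot_pi] at h3
      rw [h3, show c + -(e x - c) = e y by rw [hc]; module, e.left_inv hys]
    · rintro ⟨w, hw, rfl⟩
      exact hz (hsub w (hball hw))
  · rintro x y z - - - ⟨Φ, h1, h2⟩ ⟨Ψ, h3, h4⟩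
    refine ⟨Φ.trans Ψ, by simp [h1, h3], fun w hw => by simp [h2 w hw, h4 w hw]⟩
  · rintro x y - - ⟨Φ, h1, h2⟩
    refine ⟨Φ.symm, by simp [← h1], fun w hw => ?_⟩
    conv_lhs => rw [← h2 w hw]
    simp

/-! ### Transport of curves by diffeomorphisms. -/

theorem SelfDiffeo.mapsTo_of_eq_off (Φ : SelfDiffeo S) {Q : Set S} (h : ∀ x ∉ Q, Φ x = x) {x : S}
    (hx : x ∈ Q) : Φ x ∈ Q := by
  by_contra hn
  have := EquivLike.injective Φ (h _ hn)
  exact hn (by rw [this]; exact hx)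

theorem SelfDiffeo.mfderiv_injective (Φ : SelfDiffeo S) (x : S) :
    Function.Injective (mfderiv (𝓡 2) (𝓡 2) Φ x) := by
  have h1 : MDifferentiableAt (𝓡 2) (𝓡 2) Φ x := Φ.mdifferentiable (by simp) x
  have h2 : MDifferentiableAt (𝓡 2) (𝓡 2) Φ.symm (Φ x) := Φ.symm.mdifferentiable (by simp) _
  have h3 := mfderiv_comp x h2 h1
  have h4 : (Φ.symm ∘ Φ : S → S) = id := by ext y; simp
  rw [h4, mfderiv_id] at h3
  intro v w hvw
  have hv : mfderiv (𝓡 2) (𝓡 2) Φ.symm (Φ x) (mfderiv (𝓡 2) (𝓡 2) Φ x v) = v :=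
    (DFunLike.congr_fun h3 v).symm
  have hw : mfderiv (𝓡 2) (𝓡 2) Φ.symm (Φ x) (mfderiv (𝓡 2) (𝓡 2) Φ x w) = w :=
    (DFunLike.congr_fun h3 w).symm
  rw [← hv, ← hw, hvw]

theorem IsSmoothParam.diffeo_image {γ : ℝ → S} {a : Set S} (h : IsSmoothParam γ a)
    (Φ : SelfDiffeo S) : IsSmoothParam (Φ ∘ γ) (Φ '' a) where
  contMDiff := Φ.contMDiff.comp h.contMDiff
  periodic := h.periodic.comp Φ
  injOn := (EquivLike.injective Φ).comp_injOn h.injOn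
  immersion t := by
    rw [mfderiv_comp t (Φ.mdifferentiable (by simp) _)
      (h.contMDiff.mdifferentiable (by simp) t)]
    exact (SelfDiffeo.mfderiv_injective Φ _).comp (h.immersion t)
  range_eq := by rw [range_comp, h.range_eq]

theorem IsNonseparating.diffeo_image {a : Set S} (h : IsNonseparating a) (Φ : SelfDiffeo S) :
    IsNonseparating (Φ '' a) := by
  unfold IsNonseparating
  rw [← image_compl_eq (EquivLike.bijective Φ)]
  exact h.image _ Φ.continuous.continuousOn

theorem IsSmoothNonsepCurve.diffeo_image {a : Set S} (h : IsSmoothNonsepCurve a)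
    (Φ : SelfDiffeo S) : IsSmoothNonsepCurve (Φ '' a) := by
  obtain ⟨⟨γ, hγ⟩, hn⟩ := h
  exact ⟨⟨_, hγ.diffeo_image Φ⟩, hn.diffeo_image Φ⟩

theorem IsSimpleClosedCurve.diffeo_image {a : Set S} (h : IsSimpleClosedCurve a)
    (Φ : SelfDiffeo S) : IsSimpleClosedCurve (Φ '' a) := by
  obtain ⟨γ, h1, h2, h3, h4⟩ := h
  exact ⟨Φ ∘ γ, Φ.continuous.comp h1, h2.comp Φ, (EquivLike.injective Φ).comp_injOn h3, by
    rw [range_comp, h4]⟩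

theorem IsSimpleClosedCurve.isCompact {a : Set S} (h : IsSimpleClosedCurve a) : IsCompact a := by
  obtain ⟨γ, h1, h2, -, rfl⟩ := h
  rw [← h2.image_Icc one_pos 0]
  exact isCompact_Icc.image h1

theorem IsSmoothParam.isSimpleClosedCurve {γ : ℝ → S} {a : Set S} (h : IsSmoothParam γ a) :
    IsSimpleClosedCurve a :=
  ⟨γ, h.contMDiff.continuous, h.periodic, h.injOn, h.range_eq⟩

theorem IsSmoothNonsepCurve.isCompact {a : Set S} (h : IsSmoothNonsepCurve a) : IsCompact a := by
  obtain ⟨⟨γ, hγ⟩, -⟩ := h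
  exact hγ.isSimpleClosedCurve.isCompact

end Surface

/-! ### Charts adapted to smooth arcs and curves. -/

/-- Inverse function theorem in the plane, with a smooth local inverse on the whole target. -/
theorem Plane.exists_smooth_localHomeo {F : Plane → Plane} {U : Set Plane} {a : Plane}
    (hU : U ∈ 𝓝 a) (hF : ∀ z ∈ U, ContDiffAt ℝ ∞ F z) {A : Plane ≃L[ℝ] Plane}
    (hA : HasFDerivAt F (A : Plane →L[ℝ] Plane) a) :
    ∃ G : OpenPartialHomeomorph Plane Plane, a ∈ G.source ∧ G.source ⊆ U ∧ (∀ z, G z = F z) ∧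
      ContDiffOn ℝ ∞ G G.source ∧ ContDiffOn ℝ ∞ G.symm G.target := by
  have hFa := hF a (mem_of_mem_nhds hU)
  -- Invertible linear maps form an open set, so the derivative is invertible at all points near
  -- `a`; restricting to these makes the inverse smooth on its whole domain and not only at the
  -- image of `a`.
  have hV : U ∩ fderiv ℝ F ⁻¹' range ((↑) : (Plane ≃L[ℝ] Plane) → Plane →L[ℝ] Plane) ∈
      𝓝 a := by
    have hc : ContinuousAt (fderiv ℝ F) a :=
      (hFa.fderiv_right (m := 0) (by simp)).continuousAt
    refine inter_mem hU (hc.preimage_mem_nhds ?_)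
    rw [hA.fderiv]
    exact ContinuousLinearEquiv.nhds A
  obtain ⟨W, hWV, hWo, haW⟩ := mem_nhds_iff.1 hV
  set G₀ := hFa.toOpenPartialHomeomorph F hA (by simp) with hG₀
  have hco : ∀ z, G₀ z = F z := fun z => rfl
  refine ⟨G₀.restrOpen W hWo, ?_, ?_, fun z => rfl, ?_, ?_⟩
  · exact ⟨hFa.mem_toOpenPartialHomeomorph_source hA (by simp), haW⟩
  · rintro z ⟨-, hz⟩
    exact (hWV hz).1
  · rintro z ⟨-, hz⟩
    exact (hF z (hWV hz).1).contDiffWithinAt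
  · intro w hw
    have hz := (G₀.restrOpen W hWo).map_target hw
    set z := (G₀.restrOpen W hWo).symm w with hzdef
    obtain ⟨B, hB⟩ := (hWV hz.2).2
    have h1 := hF z (hWV hz.2).1
    have h2 : HasFDerivAt F (B : Plane →L[ℝ] Plane) z := by
      rw [hB]; exact (h1.differentiableAt (by simp)).hasFDerivAt
    exact ((G₀.restrOpen W hWo).contDiffAt_symm hw h2 h1).contDiffWithinAt

/-- The determinant of a pair of vectors of the plane. -/
def Plane.det (v w : Plane) : ℝ := v 0 * w 1 - v 1 * w 0

theorem Plane.exists_linearEquiv {v w : Plane} (h : Plane.det v w ≠ 0) :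
    ∃ A : Plane ≃L[ℝ] Plane, ∀ z, A z = z 0 • v + z 1 • w := by
  let L : Plane →ₗ[ℝ] Plane :=
    { toFun := fun z => z 0 • v + z 1 • w
      map_add' := fun x y => by simp only [PiLp.add_apply]; module
      map_smul' := fun c x => by simp only [PiLp.smul_apply, smul_eq_mul, RingHom.id_apply]; module }
  have hL : Function.Injective L := by
    rw [← LinearMap.ker_eq_bot, LinearMap.ker_eq_bot']
    intro z hz
    have h0 : z 0 * v 0 + z 1 * w 0 = 0 := by simpa [L] using congrArg (fun y : Plane => y 0) hz
    have h1 : z 0 * v 1 + z 1 * w 1 = 0 := by simpa [L] using congrArg (fun y : Plane => y 1) hz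
    unfold Plane.det at h
    apply Plane.ext'
    · refine (mul_eq_zero.1 ?_).resolve_right h
      linear_combination w 1 * h0 - w 0 * h1
    · refine (mul_eq_zero.1 ?_).resolve_right h
      linear_combination v 0 * h1 - v 1 * h0
  exact ⟨(LinearEquiv.ofInjectiveEndo L hL).toContinuousLinearEquiv, fun z => rfl⟩

section Surface

variable {S : Type*} [TopologicalSpace S] [ChartedSpace Plane S] [IsManifold (𝓡 2) ∞ S]

theorem trans_mem_smoothCharts {e : OpenPartialHomeomorph S Plane} (he : e ∈ smoothCharts S)
    {G : OpenPartialHomeomorph Plane Plane} (h : ContDiffOn ℝ ∞ G G.source)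
    (h' : ContDiffOn ℝ ∞ G.symm G.target) : e.trans G ∈ smoothCharts S := by
  apply OpenPartialHomeomorph.mem_maximalAtlas_of_contMDiffOn
  · exact h.contMDiffOn.comp ((contMDiffOn_of_mem_maximalAtlas he).mono fun x hx => hx.1)
      fun x hx => hx.2
  · exact (contMDiffOn_symm_of_mem_maximalAtlas he).comp (h'.contMDiffOn.mono fun x hx => hx.1)
      fun x hx => hx.2

theorem contDiffAt_chart_comp {e : OpenPartialHomeomorph S Plane} (he : e ∈ smoothCharts S)
    {g : ℝ → S} {t : ℝ} (hg : ContMDiffAt 𝓘(ℝ, ℝ) (𝓡 2) ∞ g t) (ht : g t ∈ e.source) :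
    ContDiffAt ℝ ∞ (fun s => e (g s)) t :=
  ((contMDiffAt_of_mem_maximalAtlas he ht).comp t hg).contDiffAt

theorem contMDiffAt_symm_comp {e : OpenPartialHomeomorph S Plane} (he : e ∈ smoothCharts S)
    {g : ℝ → Plane} {t : ℝ} (hg : ContDiffAt ℝ ∞ g t) (ht : g t ∈ e.target) :
    ContMDiffAt 𝓘(ℝ, ℝ) (𝓡 2) ∞ (fun s => e.symm (g s)) t :=
  (contMDiffAt_symm_of_mem_maximalAtlas he ht).comp t hg.contMDiffAt

theorem mdifferentiable_smoothChart {e : OpenPartialHomeomorph S Plane} (he : e ∈ smoothCharts S) :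
    e.MDifferentiable (𝓡 2) (𝓡 2) :=
  ⟨(contMDiffOn_of_mem_maximalAtlas he).mdifferentiableOn (by simp),
    (contMDiffOn_symm_of_mem_maximalAtlas he).mdifferentiableOn (by simp)⟩

theorem fderiv_injective_iff {f : ℝ → Plane} {t : ℝ} :
    Function.Injective (fderiv ℝ f t) ↔ deriv f t ≠ 0 := by
  have hx : ∀ x : ℝ, fderiv ℝ f t x = x • deriv f t := fun x => by rw [fderiv_eq_smul_deriv]
  constructor
  · intro h h0
    exact one_ne_zero (h (show fderiv ℝ f t 1 = fderiv ℝ f t 0 by simp [hx, h0]))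
  · intro h x y hxy
    rw [hx, hx] at hxy
    exact smul_left_injective ℝ h hxy

/-- Turns the immersion condition into a nonzero velocity in a chart, where ordinary derivatives are
available. -/
theorem mfderiv_injective_iff {e : OpenPartialHomeomorph S Plane} (he : e ∈ smoothCharts S)
    {g : ℝ → S} {t : ℝ} (hg : ContMDiffAt 𝓘(ℝ, ℝ) (𝓡 2) ∞ g t) (ht : g t ∈ e.source) :
    Function.Injective (mfderiv 𝓘(ℝ, ℝ) (𝓡 2) g t) ↔ deriv (fun s => e (g s)) t ≠ 0 := by
  have h1 := mfderiv_comp t ((mdifferentiable_smoothChart he).mdifferentiableAt ht)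
    (hg.mdifferentiableAt (by simp))
  have hinj := (mdifferentiable_smoothChart he).mfderiv_injective ht
  have h2 : mfderiv 𝓘(ℝ, ℝ) (𝓡 2) (e ∘ g) t = fderiv ℝ (fun s => e (g s)) t := mfderiv_eq_fderiv
  have h3 : Function.Injective (mfderiv 𝓘(ℝ, ℝ) (𝓡 2) g t) ↔
      Function.Injective (mfderiv 𝓘(ℝ, ℝ) (𝓡 2) (e ∘ g) t) := by
    rw [h1]
    exact (hinj.of_comp_iff _).symm
  rw [h3, h2]
  exact fderiv_injective_iff

/-- Two transverse smooth arcs crossing at `p` are the coordinate axes of a chart. -/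
theorem exists_chart_straightening {e : OpenPartialHomeomorph S Plane} (he : e ∈ smoothCharts S)
    {p : S} (hp : p ∈ e.source) {g₁ g₂ : ℝ → S}
    (h₁ : ∀ᶠ t in 𝓝 (0 : ℝ), ContMDiffAt 𝓘(ℝ, ℝ) (𝓡 2) ∞ g₁ t)
    (h₂ : ∀ᶠ t in 𝓝 (0 : ℝ), ContMDiffAt 𝓘(ℝ, ℝ) (𝓡 2) ∞ g₂ t)
    (hp₁ : g₁ 0 = p) (hp₂ : g₂ 0 = p)
    (hdet : Plane.det (deriv (fun s => e (g₁ s)) 0) (deriv (fun s => e (g₂ s)) 0) ≠ 0) :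
    ∃ f ∈ smoothCharts S, ∃ δ > 0, p ∈ f.source ∧ f p = 0 ∧ Metric.ball 0 δ ⊆ f.target ∧
      ∀ s, |s| < δ → f.symm !₂[s, 0] = g₁ s ∧ f.symm !₂[0, s] = g₂ s := by
  have key : ∀ g : ℝ → S, (∀ᶠ t in 𝓝 (0 : ℝ), ContMDiffAt 𝓘(ℝ, ℝ) (𝓡 2) ∞ g t) → g 0 = p →
      ∀ᶠ t in 𝓝 (0 : ℝ), ContDiffAt ℝ ∞ (fun s => e (g s)) t ∧ g t ∈ e.source := by
    intro g hg hgp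
    have hc : ContinuousAt g 0 := hg.self_of_nhds.continuousAt
    filter_upwards [hg, hc (e.open_source.mem_nhds (by rwa [hgp]))] with t h1 h2
    exact ⟨contDiffAt_chart_comp he h1 h2, h2⟩
  have k₁ := key g₁ h₁ hp₁
  have k₂ := key g₂ h₂ hp₂
  obtain ⟨ε, hε, hball⟩ := Metric.eventually_nhds_iff.1 (k₁.and k₂)
  -- `F` sends the two axes to the two arcs read in `e`, and its derivative at the origin has their
  -- velocities as columns. Composing `e` with its local inverse straightens both arcs.
  set F : Plane → Plane := fun z => e (g₁ (z 0)) + e (g₂ (z 1)) - e p with hFdef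
  set v₁ := deriv (fun s => e (g₁ s)) 0 with hv₁
  set v₂ := deriv (fun s => e (g₂ s)) 0 with hv₂
  have hlt : ∀ z : Plane, ∀ i, |z i| ≤ ‖z‖ := fun z i => PiLp.norm_apply_le z i
  have hFU : ∀ z ∈ Metric.ball (0 : Plane) ε, ContDiffAt ℝ ∞ F z := by
    intro z hz
    rw [mem_ball_zero_iff] at hz
    have b : ∀ i, dist (z i) 0 < ε := fun i => by
      rw [Real.dist_0_eq_abs]; exact (hlt z i).trans_lt hz
    have c1 := (hball (b 0)).1.1
    have c2 := (hball (b 1)).2.1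
    exact ((c1.comp z (Plane.contDiff_coord 0).contDiffAt).add
      (c2.comp z (Plane.contDiff_coord 1).contDiffAt)).sub contDiffAt_const
  obtain ⟨A, hA⟩ := Plane.exists_linearEquiv hdet
  have hFA : HasFDerivAt F (A : Plane →L[ℝ] Plane) 0 := by
    have d1 : HasDerivAt (fun s => e (g₁ s)) v₁ ((0 : Plane) 0) :=
      (k₁.self_of_nhds.1.differentiableAt (by simp)).hasDerivAt
    have d2 : HasDerivAt (fun s => e (g₂ s)) v₂ ((0 : Plane) 1) :=
      (k₂.self_of_nhds.1.differentiableAt (by simp)).hasDerivAt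
    have p0 : HasFDerivAt (fun z : Plane => z 0)
        (EuclideanSpace.proj (𝕜 := ℝ) (0 : Fin 2) : Plane →L[ℝ] ℝ) 0 :=
      (EuclideanSpace.proj (𝕜 := ℝ) (0 : Fin 2) : Plane →L[ℝ] ℝ).hasFDerivAt
    have p1 : HasFDerivAt (fun z : Plane => z 1)
        (EuclideanSpace.proj (𝕜 := ℝ) (1 : Fin 2) : Plane →L[ℝ] ℝ) 0 :=
      (EuclideanSpace.proj (𝕜 := ℝ) (1 : Fin 2) : Plane →L[ℝ] ℝ).hasFDerivAt
    have := ((d1.hasFDerivAt.comp (0 : Plane) p0).add (d2.hasFDerivAt.comp (0 : Plane) p1)).sub_const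
      (e p)
    refine this.congr_fderiv ?_
    ext1 z
    rw [ContinuousLinearEquiv.coe_coe, hA]
    simp
  obtain ⟨G, h0G, hGU, hGF, hG, hG'⟩ := Plane.exists_smooth_localHomeo
    (Metric.ball_mem_nhds _ hε) hFU hFA
  have hf : e.trans G.symm ∈ smoothCharts S := trans_mem_smoothCharts he hG' (by simpa using hG)
  have hF0 : F 0 = e p := by simp [hFdef, hp₁, hp₂]
  have hGp : G.symm (e p) = 0 := by rw [← hF0, ← hGF, G.left_inv h0G]
  have hpt : e p ∈ G.target := by
    rw [← hF0, ← hGF]; exact G.map_source h0G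
  have hps : p ∈ (e.trans G.symm).source := by
    simp [hp, hpt]
  have ht0 : (0 : Plane) ∈ (e.trans G.symm).target := by
    have := (e.trans G.symm).map_source hps
    simpa [hGp] using this
  obtain ⟨δ, hδ, hδt⟩ := Metric.isOpen_iff.1 (e.trans G.symm).open_target 0 ht0
  refine ⟨e.trans G.symm, hf, min δ ε, lt_min hδ hε, hps, by simp [hGp],
    (Metric.ball_subset_ball (min_le_left _ _)).trans hδt, fun s hs => ?_⟩
  have hs' : dist s 0 < ε := by rw [Real.dist_0_eq_abs]; exact hs.trans_le (min_le_right _ _)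
  constructor
  · simp only [OpenPartialHomeomorph.coe_trans_symm, OpenPartialHomeomorph.symm_symm,
      Function.comp_apply, hGF, hFdef]
    simp [hp₂, e.left_inv (hball hs').1.2]
  · simp only [OpenPartialHomeomorph.coe_trans_symm, OpenPartialHomeomorph.symm_symm,
      Function.comp_apply, hGF, hFdef]
    simp [hp₁, e.left_inv (hball hs').2.2]

theorem Function.Periodic.eq_add_int_of_eq {X : Type*} {γ : ℝ → X} (hp : Function.Periodic γ 1)
    (hi : InjOn γ (Ico 0 1)) {s t : ℝ} (h : γ s = γ t) : ∃ n : ℤ, s = t + n := by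
  have h1 : ∀ x, γ (Int.fract x) = γ x := fun x => by
    have := hp.sub_int_mul_eq (x := x) ⌊x⌋
    rw [mul_one] at this
    exact this
  have h2 : Int.fract s = Int.fract t := by
    apply hi ⟨Int.fract_nonneg _, Int.fract_lt_one _⟩ ⟨Int.fract_nonneg _, Int.fract_lt_one _⟩
    rw [h1, h1, h]
  obtain ⟨n, hn⟩ := Int.fract_eq_fract.1 h2
  exact ⟨n, by linarith⟩

/-- Near each of its points, a smooth simple closed curve is the first axis of a chart. -/
theorem IsSmoothParam.exists_flat_chart [T2Space S] {γ : ℝ → S} {a : Set S}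
    (hγ : IsSmoothParam γ a) {p : S} (hp : p ∈ a) :
    ∃ f ∈ smoothCharts S, ∃ r > 0, p ∈ f.source ∧ f p = 0 ∧ Metric.ball 0 r ⊆ f.target ∧
      ∀ z ∈ Metric.ball (0 : Plane) r, f.symm z ∈ a ↔ z 1 = 0 := by
  obtain ⟨t₀, rfl⟩ : p ∈ range γ := by rwa [hγ.range_eq]
  set p := γ t₀ with hpdef
  set e := chartAt Plane p with he
  have hem : e ∈ smoothCharts S := IsManifold.chart_mem_maximalAtlas p
  have hps : p ∈ e.source := mem_chart_source Plane p
  set g₁ : ℝ → S := fun s => γ (t₀ + s) with hg₁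
  have sm₁ : ∀ t, ContMDiffAt 𝓘(ℝ, ℝ) (𝓡 2) ∞ g₁ t := fun t =>
    hγ.contMDiff.contMDiffAt.comp t
      ((contDiff_const.add contDiff_id).contDiffAt (x := t)).contMDiffAt
  have hg0 : g₁ 0 = p := by simp [hg₁, hpdef]
  set v := deriv (fun s => e (g₁ s)) 0 with hv
  have hv0 : v ≠ 0 := by
    have h1 := (mfderiv_injective_iff hem hγ.contMDiff.contMDiffAt hps).1 (hγ.immersion t₀)
    have h2 := deriv_comp_const_add (f := fun s => e (γ s)) t₀ 0
    rw [hv, hg₁, h2, add_zero]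
    exact h1
  -- The velocity turned by a right angle: a segment in this direction serves as the transverse
  -- second arc.
  set w : Plane := !₂[-v 1, v 0] with hw
  have hdet : Plane.det v w ≠ 0 := by
    have : Plane.det v w = v 0 ^ 2 + v 1 ^ 2 := by simp [Plane.det, hw]; ring
    rw [this, ← Plane.norm_sq]
    positivity
  set g₂ : ℝ → S := fun s => e.symm (e p + s • w) with hg₂
  have hl : ContDiff ℝ ∞ (fun s : ℝ => e p + s • w) := contDiff_const.add
    (contDiff_id.smul contDiff_const)
  have hev : ∀ᶠ s in 𝓝 (0 : ℝ), e p + s • w ∈ e.target := by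
    apply hl.continuous.continuousAt.eventually_mem
    simpa using e.open_target.mem_nhds (e.map_source hps)
  have sm₂ : ∀ᶠ t in 𝓝 (0 : ℝ), ContMDiffAt 𝓘(ℝ, ℝ) (𝓡 2) ∞ g₂ t :=
    hev.mono fun t ht => contMDiffAt_symm_comp hem hl.contDiffAt ht
  have hd₂ : deriv (fun s => e (g₂ s)) 0 = w := by
    have h1 : (fun s => e (g₂ s)) =ᶠ[𝓝 0] fun s => e p + s • w :=
      hev.mono fun t ht => e.right_inv ht
    rw [h1.deriv_eq]
    have : HasDerivAt (fun s : ℝ => e p + s • w) ((1 : ℝ) • w) 0 :=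
      ((hasDerivAt_id (0 : ℝ)).smul_const w).const_add _
    rw [this.deriv, one_smul]
  obtain ⟨f, hf, δ, hδ, hpf, hfp, hball, haxes⟩ := exists_chart_straightening hem hps
    (Eventually.of_forall sm₁) sm₂ hg0 (by simp [hg₂, e.left_inv hps])
    (show Plane.det v _ ≠ 0 by rwa [hd₂])
  set δ' := min δ 1 / 2 with hδ'
  have hδ'0 : 0 < δ' := by positivity
  have hδ'1 : δ' < δ := by
    have := min_le_left δ 1; rw [hδ']; linarith [lt_min hδ one_pos]
  have hδ'2 : δ' ≤ 1 / 2 := by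
    have := min_le_right δ 1; rw [hδ']; linarith
  -- The part of the curve not covered by the straightened arc is compact and misses `p`, so a small
  -- enough disc avoids it.
  have hcomp : IsCompact (γ '' Icc (t₀ + δ') (t₀ + 1 - δ')) :=
    isCompact_Icc.image hγ.contMDiff.continuous
  have hpn : p ∉ γ '' Icc (t₀ + δ') (t₀ + 1 - δ') := by
    rintro ⟨t, ht, htp⟩
    obtain ⟨n, hn⟩ := hγ.periodic.eq_add_int_of_eq hγ.injOn htp
    have h1 : (0 : ℝ) < n := by linarith [ht.1]
    have h2 : (n : ℝ) < 1 := by linarith [ht.2]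
    have h3 : (0 : ℤ) < n := by exact_mod_cast h1
    have h4 : n < (1 : ℤ) := by exact_mod_cast h2
    omega
  obtain ⟨R, hR, hRt, hRs⟩ := exists_closedBall_subset hpf
    (hcomp.isClosed.isOpen_compl.mem_nhds hpn)
  rw [hfp] at hRt hRs
  have hsub : Metric.ball (0 : Plane) (min R δ') ⊆ Metric.ball 0 δ :=
    Metric.ball_subset_ball ((min_le_right _ _).trans hδ'1.le)
  refine ⟨f, hf, min R δ', lt_min hR hδ'0, hpf, hfp, hsub.trans hball, fun z hz => ⟨fun h => ?_,
    fun h => ?_⟩⟩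
  · rw [← hγ.range_eq] at h
    obtain ⟨t', ht'⟩ := h
    obtain ⟨t, ht, htt'⟩ := hγ.periodic.exists_mem_Ico one_pos t' (t₀ - δ')
    have htz : γ t = f.symm z := by rw [← htt', ht']
    have hz' : z ∈ Metric.closedBall (0 : Plane) R :=
      Metric.ball_subset_closedBall (Metric.ball_subset_ball (min_le_left _ _) hz)
    have hlt : t < t₀ + δ' := by
      by_contra hge
      exact hRs z hz' ⟨t, ⟨not_lt.1 hge, by linarith [ht.2]⟩, htz⟩
    have hs : |t - t₀| < δ := by
      rw [abs_lt]; constructor <;> linarith [ht.1]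
    have h1 := (haxes (t - t₀) hs).1
    have h2 : g₁ (t - t₀) = f.symm z := by rw [← htz, hg₁]; simp
    rw [h2] at h1
    have h3 : (!₂[t - t₀, 0] : Plane) ∈ f.target := by
      apply hball
      rw [mem_ball_zero_iff]
      have : ‖(!₂[t - t₀, 0] : Plane)‖ ^ 2 = |t - t₀| ^ 2 := by rw [Plane.norm_sq]; simp
      rwa [(sq_eq_sq₀ (norm_nonneg _) (abs_nonneg _)).1 this]
    have h4 := f.symm.injOn h3 (hball (hsub hz)) h1
    rw [← h4]; simp
  · have hz0 : |z 0| < δ := by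
      have := hsub hz
      rw [mem_ball_zero_iff] at this
      exact (PiLp.norm_apply_le z 0).trans_lt this
    have h1 := (haxes (z 0) hz0).1
    have h2 : (!₂[z 0, 0] : Plane) = z := by
      apply Plane.ext' <;> simp [h]
    rw [h2] at h1
    rw [h1, ← hγ.range_eq]
    exact mem_range_self _

end Surface

/-! ### Bijections preserving nonseparating curves are homeomorphisms. -/

section Surface

variable {S : Type*} [TopologicalSpace S] [ChartedSpace Plane S] [IsManifold (𝓡 2) ∞ S] [T2Space S]

theorem IsSmoothNonsepCurve.nonempty {a : Set S} (h : IsSmoothNonsepCurve a) : a.Nonempty := by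
  obtain ⟨⟨γ, hγ⟩, -⟩ := h
  rw [← hγ.range_eq]
  exact range_nonempty γ

/-- If there is a smooth nonseparating curve, there is one through every point. -/
theorem exists_nonsepCurve_through [ConnectedSpace S] (hex : ∃ a : Set S, IsSmoothNonsepCurve a)
    (x : S) : ∃ a : Set S, IsSmoothNonsepCurve a ∧ x ∈ a := by
  obtain ⟨a, ha⟩ := hex
  obtain ⟨p, hp⟩ := ha.nonempty
  obtain ⟨Φ, h1, -⟩ := exists_diffeo_map_eq (isPreconnected_univ (α := S)) isOpen_univ
    (mem_univ p) (mem_univ x)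
  exact ⟨Φ '' a, ha.diffeo_image Φ, p, hp, h1⟩

/-- A bijection preserving smooth nonseparating curves is continuous along each of them. -/
theorem continuousOn_nonsepCurve {h : Equiv.Perm S}
    (hh : ∀ a : Set S, IsSmoothNonsepCurve (h '' a) ↔ IsSmoothNonsepCurve a) {a : Set S}
    (ha : IsSmoothNonsepCurve a) : ContinuousOn h a := by
  intro x hx
  rw [ContinuousWithinAt, tendsto_def]
  intro N hN
  have ha' : IsSmoothNonsepCurve (h '' a) := (hh a).2 ha
  obtain ⟨γ, hγ⟩ := ha'.1
  have hxa' : h x ∈ h '' a := mem_image_of_mem h hx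
  obtain ⟨f, hf, r, hr, hps, hp0, hball, hflat⟩ := hγ.exists_flat_chart hxa'
  obtain ⟨R, hR, hRt, hRN⟩ := exists_closedBall_subset hps hN
  rw [hp0] at hRt hRN
  set ρ := min r R with hρ
  have hρ0 : 0 < ρ := lt_min hr hR
  have hρr : Metric.ball (0 : Plane) ρ ⊆ Metric.ball 0 r := Metric.ball_subset_ball (min_le_left _ _)
  have hρR : Metric.ball (0 : Plane) ρ ⊆ Metric.closedBall 0 R :=
    (Metric.ball_subset_ball (min_le_right _ _)).trans Metric.ball_subset_closedBall
  set Q := f.symm '' Metric.ball (0 : Plane) ρ with hQ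
  have hQo : IsOpen Q := isOpen_image_symm Metric.isOpen_ball (hρr.trans hball)
  have hQc : IsPreconnected Q :=
    isPreconnected_image_symm Metric.isPreconnected_ball (hρr.trans hball)
  have hhx : f.symm 0 = h x := by rw [← hp0, f.left_inv hps]
  have hxQ : h x ∈ Q := ⟨0, Metric.mem_ball_self hρ0, hhx⟩
  set q : Plane := !₂[0, ρ / 2] with hq
  have hqb : q ∈ Metric.ball (0 : Plane) ρ := by
    rw [mem_ball_zero_iff]
    have : ‖q‖ ^ 2 = (ρ / 2) ^ 2 := by rw [Plane.norm_sq]; simp [hq]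
    rw [(sq_eq_sq₀ (norm_nonneg _) (by positivity)).1 this]
    linarith
  have hqa : f.symm q ∉ h '' a := by
    rw [hflat q (hρr hqb)]
    simp [hq, hρ0.ne']
  -- Since `f.symm q` is off the curve, `Φ '' (h '' a)` misses `h x`, while it agrees with `h '' a`
  -- off `Q`. Hence a point of `a` outside the closed preimage of the pushed curve must have its
  -- image in `Q`.
  obtain ⟨Φ, hΦ, hΦQ⟩ := exists_diffeo_map_eq hQc hQo (mem_image_of_mem _ hqb) hxQ
  have hb' := ha'.diffeo_image Φ
  have hb : IsSmoothNonsepCurve (h ⁻¹' (Φ '' (h '' a))) := by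
    rw [← hh, image_preimage_eq _ h.surjective]; exact hb'
  have hxb : x ∈ (h ⁻¹' (Φ '' (h '' a)))ᶜ := by
    rintro ⟨y, hy, hyx⟩
    rw [← hΦ] at hyx
    exact hqa (EquivLike.injective Φ hyx ▸ hy)
  filter_upwards [self_mem_nhdsWithin,
    mem_nhdsWithin_of_mem_nhds (hb.isCompact.isClosed.isOpen_compl.mem_nhds hxb)] with y hy hyb
  by_contra hn
  have hyQ : h y ∉ Q := by
    rintro ⟨z, hz, hzy⟩
    apply hn
    rw [mem_preimage, ← hzy]
    exact hRN z (hρR hz)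
  exact hyb ⟨h y, mem_image_of_mem h hy, hΦQ _ hyQ⟩

theorem exists_connected_nhd {W : Set S} {x : S} (hW : W ∈ 𝓝 x) :
    ∃ B : Set S, IsOpen B ∧ IsPreconnected B ∧ x ∈ B ∧ B ⊆ W := by
  obtain ⟨R, hR, ht, hsub⟩ := exists_closedBall_subset (mem_chart_source Plane x) hW
  have hbt := Metric.ball_subset_closedBall.trans ht
  refine ⟨(chartAt Plane x).symm '' Metric.ball (chartAt Plane x x) R,
    isOpen_image_symm Metric.isOpen_ball hbt,
    isPreconnected_image_symm Metric.isPreconnected_ball hbt,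
    ⟨_, Metric.mem_ball_self hR, (chartAt Plane x).left_inv (mem_chart_source Plane x)⟩, ?_⟩
  rintro _ ⟨z, hz, rfl⟩
  exact hsub z (Metric.ball_subset_closedBall hz)

/-- A bijection preserving smooth nonseparating curves maps open connected sets to
connected sets. -/
theorem isPreconnected_image_of_isOpen [ConnectedSpace S]
    (hex : ∃ a : Set S, IsSmoothNonsepCurve a) {h : Equiv.Perm S}
    (hh : ∀ a : Set S, IsSmoothNonsepCurve (h '' a) ↔ IsSmoothNonsepCurve a) {W : Set S}
    (hWo : IsOpen W) (hW : IsPreconnected W) : IsPreconnected (h '' W) := by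
  apply isPreconnected_of_forall_pair
  rintro _ ⟨x, hx, rfl⟩ _ ⟨y, hy, rfl⟩
  -- Lying in a common connected subset of the image is an equivalence relation, so it suffices to
  -- link `h x` with `h y` for `y` near `x`.
  refine hW.induction₂ (fun x y => ∃ t ⊆ h '' W, h x ∈ t ∧ h y ∈ t ∧ IsPreconnected t)
    ?_ ?_ ?_ hx hy
  · intro x hx
    obtain ⟨B, hBo, hBc, hxB, hBW⟩ := exists_connected_nhd (hWo.mem_nhds hx)
    obtain ⟨a, ha, hxa⟩ := exists_nonsepCurve_through hex x
    obtain ⟨γ, hγ⟩ := ha.1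
    obtain ⟨t₀, rfl⟩ : x ∈ range γ := by rwa [hγ.range_eq]
    obtain ⟨δ, hδ, hδB⟩ := Metric.mem_nhds_iff.1 (hγ.contMDiff.continuous.continuousAt.preimage_mem_nhds
        (hBo.mem_nhds hxB))
    set s := min δ 1 / 2 with hs
    have hs0 : 0 < s := by positivity
    have hsδ : s < δ := by
      have := min_le_left δ 1; rw [hs]; linarith [lt_min hδ one_pos]
    have hs1 : s ≤ 1 / 2 := by
      have := min_le_right δ 1; rw [hs]; linarith
    have hJB : γ '' Icc t₀ (t₀ + s) ⊆ B := by
      rintro _ ⟨t, ht, rfl⟩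
      apply hδB
      rw [Metric.mem_ball, Real.dist_eq, abs_lt]
      constructor <;> linarith [ht.1, ht.2]
    have hne : γ (t₀ + s) ≠ γ t₀ := by
      intro heq
      obtain ⟨n, hn⟩ := hγ.periodic.eq_add_int_of_eq hγ.injOn heq
      have h1 : (0 : ℝ) < n := by linarith
      have h2 : (n : ℝ) < 1 := by linarith
      have h3 : (0 : ℤ) < n := by exact_mod_cast h1
      have h4 : n < (1 : ℤ) := by exact_mod_cast h2
      omega
    refine eventually_nhdsWithin_of_eventually_nhds ((hBo.eventually_mem hxB).mono fun y hy => ?_)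
    by_cases hyx : y = γ t₀
    · subst hyx
      exact ⟨{h (γ t₀)}, by simpa using hx, rfl, rfl, isPreconnected_singleton⟩
    -- The end of a short arc starting at `γ t₀` is moved to `y` while its start stays fixed. The
    -- moved arc lies on a nonseparating curve, along which `h` is continuous.
    obtain ⟨Φ, h1, h2⟩ := exists_diffeo_map_eq (hBc.diff_point hBo (γ t₀))
      (hBo.sdiff isClosed_singleton)
      (⟨hJB ⟨t₀ + s, ⟨by linarith, le_rfl⟩, rfl⟩, hne⟩ : γ (t₀ + s) ∈ B \ {γ t₀})
      (⟨hy, hyx⟩ : y ∈ B \ {γ t₀})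
    have hcont := continuousOn_nonsepCurve hh (ha.diffeo_image Φ)
    have hJ : (Φ ∘ γ) '' Icc t₀ (t₀ + s) ⊆ Φ '' a := by
      rintro _ ⟨t, -, rfl⟩
      exact ⟨γ t, by rw [← hγ.range_eq]; exact mem_range_self t, rfl⟩
    refine ⟨h '' ((Φ ∘ γ) '' Icc t₀ (t₀ + s)), ?_, ?_, ?_, ?_⟩
    · apply image_mono
      rintro _ ⟨t, ht, rfl⟩
      apply hBW
      apply SelfDiffeo.mapsTo_of_eq_off Φ (fun x hx => h2 x fun hx' => hx hx'.1)
      exact hJB ⟨t, ht, rfl⟩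
    · refine mem_image_of_mem h ⟨t₀, ⟨le_rfl, by linarith⟩, ?_⟩
      exact h2 _ fun hx => hx.2 rfl
    · exact mem_image_of_mem h ⟨t₀ + s, ⟨by linarith, le_rfl⟩, h1⟩
    · refine IsPreconnected.image ?_ h (hcont.mono hJ)
      exact isPreconnected_Icc.image _ (Φ.continuous.comp hγ.contMDiff.continuous).continuousOn
  · rintro x y z - - - ⟨t, ht, h1, h2, h3⟩ ⟨t', ht', h1', h2', h3'⟩
    exact ⟨t ∪ t', union_subset ht ht', Or.inl h1, Or.inr h2', h3.union (h y) h2 h1' h3'⟩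
  · rintro x y - - ⟨t, ht, h1, h2, h3⟩
    exact ⟨t, ht, h2, h1, h3⟩

/-- The rotations by these angles carry the bottom side of a centred square to its four sides. -/
noncomputable def quarterTurns : Fin 4 → ℝ := ![0, Real.pi / 2, Real.pi, -(Real.pi / 2)]

/-- Reduces all sides of the square to the bottom one, which is the side placed on the curve. -/
theorem exists_quarterTurn {d : ℝ} {y : Plane} (hy0 : |y 0| ≤ d) (hy : |y 0| = d ∨ |y 1| = d) :
    ∃ i, Plane.rot (-quarterTurns i) y 1 = -d := by
  have hd : 0 ≤ d := (abs_nonneg _).trans hy0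
  rcases hy with hy | hy <;> rcases (abs_eq hd).1 hy with hy | hy
  · exact ⟨1, by simp [quarterTurns, hy]⟩
  · exact ⟨3, by simp [quarterTurns, hy]⟩
  · exact ⟨2, by simp [quarterTurns, hy]⟩
  · exact ⟨0, by simp [quarterTurns, hy]⟩

theorem Plane.rot_rot_neg (θ : ℝ) (z : Plane) : Plane.rot θ (Plane.rot (-θ) z) = z := by
  simpa using Plane.rot_neg_rot (-θ) z

/-- The complements of finite unions of smooth nonseparating curves have arbitrarily small
components around every point. -/
theorem exists_nonsepCurves_surrounding [ConnectedSpace S]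
    (hex : ∃ a : Set S, IsSmoothNonsepCurve a) {x : S} {V : Set S} (hV : V ∈ 𝓝 x) :
    ∃ c : Fin 4 → Set S, (∀ i, IsSmoothNonsepCurve (c i)) ∧ x ∉ ⋃ i, c i ∧
      connectedComponentIn (⋃ i, c i)ᶜ x ⊆ V := by
  obtain ⟨a, ha, hxa⟩ := exists_nonsepCurve_through hex x
  obtain ⟨γ, hγ⟩ := ha.1
  obtain ⟨f, hf, r, hr, hps, hp0, hball, hflat⟩ := hγ.exists_flat_chart hxa
  obtain ⟨R, hR, hRt, hRN⟩ := exists_closedBall_subset hps hV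
  rw [hp0] at hRt hRN
  set ρ := min r R with hρ
  have hρ0 : 0 < ρ := lt_min hr hR
  have hρr : Metric.ball (0 : Plane) ρ ⊆ Metric.ball 0 r := Metric.ball_subset_ball (min_le_left _ _)
  have hρt := hρr.trans hball
  have hρR : Metric.ball (0 : Plane) ρ ⊆ Metric.closedBall 0 R :=
    (Metric.ball_subset_ball (min_le_right _ _)).trans Metric.ball_subset_closedBall
  set Q := f.symm '' Metric.ball (0 : Plane) ρ with hQ
  have hQo : IsOpen Q := isOpen_image_symm Metric.isOpen_ball hρt
  have hQc : IsPreconnected Q := isPreconnected_image_symm Metric.isPreconnected_ball hρt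
  have hx0 : f.symm 0 = x := by rw [← hp0, f.left_inv hps]
  have hxQ : x ∈ Q := ⟨0, Metric.mem_ball_self hρ0, hx0⟩
  -- The square of half side `d` about `k = (0, d)` has its bottom side on the first axis, hence on
  -- `a`. It lies in the disc of radius `2 * d` about `k`, on which the rotations are rigid; their
  -- supports, of radius `3 * d`, stay in the ball of radius `ρ = 10 * d`.
  set d := ρ / 10 with hd
  have hd0 : 0 < d := by positivity
  set k : Plane := !₂[0, d] with hk
  have hk0 : k 0 = 0 := rfl
  have hk1 : k 1 = d := rfl
  have hkn : ‖k‖ = d := by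
    have : ‖k‖ ^ 2 = d ^ 2 := by rw [Plane.norm_sq, hk0, hk1]; ring
    exact (sq_eq_sq₀ (norm_nonneg _) hd0.le).1 this
  have hkb : Metric.closedBall k (3 * d) ⊆ Metric.ball 0 ρ := by
    intro z hz
    rw [mem_closedBall_iff_norm] at hz
    rw [mem_ball_zero_iff]
    have := norm_add_le (z - k) k
    rw [sub_add_cancel] at this
    linarith
  have hkk : k ∈ Metric.closedBall k (3 * d) := Metric.mem_closedBall_self (by positivity)
  choose Φ hΦ hΦ' using fun i : Fin 4 => exists_diffeo_rot hf (quarterTurns i)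
    (show 0 < 2 * d by positivity) (show 2 * d < 3 * d by linarith) (hkb.trans hρt)
  -- The four rotated copies of `a` contain the sides of the square, but not its centre, which every
  -- rotation fixes. `Ψ` puts that centre at `x`.
  obtain ⟨Ψ, hΨ, hΨQ⟩ := exists_diffeo_map_eq hQc hQo (mem_image_of_mem _ (hkb hkk)) hxQ
  set T : Set Plane := {z | |z 0| < d ∧ |(z - k) 1| < d} with hT
  set T' : Set Plane := {z | |z 0| ≤ d ∧ |(z - k) 1| ≤ d} with hT'
  have hnorm : ∀ z ∈ T', ‖z - k‖ ≤ 2 * d := by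
    rintro z ⟨h0, h1⟩
    have : ‖z - k‖ ^ 2 = z 0 ^ 2 + (z - k) 1 ^ 2 := by rw [Plane.norm_sq]; simp [hk0]
    have h2 := sq_le_sq' (abs_le.1 h0).1 (abs_le.1 h0).2
    have h3 := sq_le_sq' (abs_le.1 h1).1 (abs_le.1 h1).2
    apply le_of_sq_le_sq _ (by positivity)
    nlinarith
  have hT'b : T' ⊆ Metric.ball 0 ρ := fun z hz => hkb (by
    rw [mem_closedBall_iff_norm]; linarith [hnorm z hz])
  have hTT' : T ⊆ T' := fun z hz => ⟨hz.1.le, hz.2.le⟩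
  have c0 : Continuous fun z : Plane => |z 0| := (Plane.contDiff_coord 0).continuous.abs
  have c1 : Continuous fun z : Plane => |(z - k) 1| :=
    ((Plane.contDiff_coord 1).continuous.comp (continuous_id.sub continuous_const)).abs
  have hTo : IsOpen T := (isOpen_lt c0 continuous_const).inter (isOpen_lt c1 continuous_const)
  have hT'c : IsCompact T' := by
    refine Metric.isCompact_of_isClosed_isBounded
      ((isClosed_le c0 continuous_const).inter (isClosed_le c1 continuous_const))
      (Metric.isBounded_ball.subset hT'b)
  have hT'cl : IsClosed (f.symm '' T') :=
    (hT'c.image_of_continuousOn (f.continuousOn_symm.mono (hT'b.trans hρt))).isClosed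
  have hΨinj : Function.Injective Ψ := EquivLike.injective Ψ
  refine ⟨fun i => Ψ '' (Φ i '' a), fun i => (ha.diffeo_image _).diffeo_image _, ?_, ?_⟩
  · rw [mem_iUnion]
    rintro ⟨i, _, ⟨y, hy, rfl⟩, hyx⟩
    have h1 : Φ i y = f.symm k := hΨinj (by rw [hyx, hΨ])
    have h2 := hΦ i k (by rw [dist_self]; positivity)
    rw [sub_self, show Plane.rot (quarterTurns i) 0 = 0 by apply Plane.ext' <;> simp, add_zero]
      at h2
    have h3 : f.symm k = y := EquivLike.injective (Φ i) (h2.trans h1.symm)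
    rw [← h3, hflat k (hρr (hkb hkk)), hk1] at hy
    exact hd0.ne' hy
  · have hsub : connectedComponentIn (⋃ i, Ψ '' (Φ i '' a))ᶜ x ⊆ Ψ '' (f.symm '' T) := by
      by_cases hxc : x ∈ (⋃ i, Ψ '' (Φ i '' a))ᶜ
      swap
      · rw [connectedComponentIn_eq_empty hxc]; exact empty_subset _
      -- Off the four curves there is no boundary point of the square, so the open square and the
      -- exterior of the closed one cover the component.
      refine isPreconnected_connectedComponentIn.subset_left_of_subset_union
        (v := (Ψ '' (f.symm '' T'))ᶜ) ?_ ?_ ?_ ?_ ⟨x, mem_connectedComponentIn hxc, f.symm k,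
          mem_image_of_mem _ ⟨by simpa [hk0] using hd0, by simpa using hd0⟩, hΨ⟩
      · exact Ψ.toHomeomorph.isOpenMap _ (isOpen_image_symm hTo ((hTT'.trans hT'b).trans hρt))
      · exact (Ψ.toHomeomorph.isClosedMap _ hT'cl).isOpen_compl
      · exact disjoint_compl_right_iff_subset.2 (image_mono (image_mono hTT'))
      · intro y hy
        by_contra hn
        rw [mem_union, not_or, mem_compl_iff, not_not] at hn
        obtain ⟨hn, _, ⟨z, hz, rfl⟩, rfl⟩ := hn
        have hzT : z ∉ T := fun h => hn (mem_image_of_mem _ (mem_image_of_mem _ h))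
        have hside : |(z - k) 0| = d ∨ |(z - k) 1| = d := by
          have h00 : (z - k) 0 = z 0 := by simp [hk0]
          rw [h00]
          by_contra hcon
          rw [not_or] at hcon
          exact hzT ⟨lt_of_le_of_ne hz.1 hcon.1, lt_of_le_of_ne hz.2 hcon.2⟩
        obtain ⟨i, hi⟩ := exists_quarterTurn (by simpa [hk0] using hz.1) hside
        set w := k + Plane.rot (-quarterTurns i) (z - k) with hw
        have hwk : w - k = Plane.rot (-quarterTurns i) (z - k) := by rw [hw]; abel
        have hwn : ‖w - k‖ ≤ 2 * d := by rw [hwk, Plane.norm_rot]; exact hnorm z hz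
        have hwb : w ∈ Metric.ball 0 ρ := hkb (by rw [mem_closedBall_iff_norm]; linarith)
        have hwa : f.symm w ∈ a := by
          rw [hflat w (hρr hwb), hw, PiLp.add_apply, hi, hk1]; ring
        have h1 := hΦ i w (by rwa [dist_eq_norm])
        rw [hwk, Plane.rot_rot_neg, add_sub_cancel] at h1
        apply connectedComponentIn_subset _ _ hy
        rw [mem_iUnion]
        exact ⟨i, _, ⟨_, hwa, h1⟩, rfl⟩
    refine hsub.trans ?_
    rintro _ ⟨_, ⟨z, hz, rfl⟩, rfl⟩
    obtain ⟨w, hw, hwz⟩ := SelfDiffeo.mapsTo_of_eq_off Ψ hΨQ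
      (mem_image_of_mem f.symm (hT'b (hTT' hz)))
    rw [← hwz]
    exact hRN w (hρR hw)

/-- A bijection preserving smooth nonseparating curves is an open map. -/
theorem isOpenMap_of_preserves_nonsepCurves [ConnectedSpace S]
    (hex : ∃ a : Set S, IsSmoothNonsepCurve a) {h : Equiv.Perm S}
    (hh : ∀ a : Set S, IsSmoothNonsepCurve (h '' a) ↔ IsSmoothNonsepCurve a) :
    IsOpenMap h := by
  have : LocallyConnectedSpace S := ChartedSpace.locallyConnectedSpace Plane S
  rw [isOpenMap_iff_nhds_le]
  intro x
  rw [le_map_iff]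
  intro V hV
  obtain ⟨c, hc, hxc, hcV⟩ := exists_nonsepCurves_surrounding hex hV
  have hhs : ∀ a : Set S, IsSmoothNonsepCurve (h.symm '' a) ↔ IsSmoothNonsepCurve a := by
    intro a
    rw [← hh, h.image_symm_image]
  have hopen : ∀ c : Fin 4 → Set S, (∀ i, IsSmoothNonsepCurve (c i)) → IsOpen (⋃ i, c i)ᶜ :=
    fun c hc => (isClosed_iUnion_of_finite fun i => (hc i).isCompact.isClosed).isOpen_compl
  -- `h.symm` maps this open component to a connected set avoiding every `c i`, hence into the
  -- component of `x`, which lies in `V`. Thus `h '' V` contains `W'`.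
  set W' := connectedComponentIn (⋃ i, h '' c i)ᶜ (h x) with hW'
  have hhxc : h x ∈ (⋃ i, h '' c i)ᶜ := by
    rw [← image_iUnion]
    exact fun ⟨y, hy, hyx⟩ => hxc (h.injective hyx ▸ hy)
  have hW'o : IsOpen W' := (hopen _ fun i => (hh _).2 (hc i)).connectedComponentIn
  have hsub : h.symm '' W' ⊆ connectedComponentIn (⋃ i, c i)ᶜ x := by
    apply IsPreconnected.subset_connectedComponentIn
    · exact isPreconnected_image_of_isOpen hex hhs hW'o isPreconnected_connectedComponentIn
    · exact ⟨h x, mem_connectedComponentIn hhxc, h.symm_apply_apply x⟩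
    · rintro _ ⟨y, hy, rfl⟩
      have hy' := connectedComponentIn_subset _ _ hy
      rw [← image_iUnion] at hy'
      exact fun hmem => hy' ⟨_, hmem, h.apply_symm_apply y⟩
  refine mem_of_superset (hW'o.mem_nhds (mem_connectedComponentIn hhxc)) fun y hy => ?_
  exact ⟨h.symm y, hcV (hsub (mem_image_of_mem _ hy)), h.apply_symm_apply y⟩

/-- Openness of `h` is continuity of `h.symm`; as the bijections form a group, the same applied to
`h⁻¹` gives continuity of `h`. -/
theorem homeoSmoothTransverse_le_homeoGroup [ConnectedSpace S]
    (hex : ∃ a : Set S, IsSmoothNonsepCurve a) : homeoSmoothTransverse S ≤ homeoGroup S := by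
  have key : ∀ h ∈ homeoSmoothTransverse S, Continuous (h : Equiv.Perm S).symm := by
    intro h hh
    have ho := isOpenMap_of_preserves_nonsepCurves hex hh.1
    refine ⟨fun s hs => ?_⟩
    rw [← Equiv.image_eq_preimage_symm]
    exact ho s hs
  intro h hh
  exact ⟨key h⁻¹ (inv_mem hh), key h hh⟩

end Surface

/-! ### A criterion for nonseparation, and closing of overlapping arcs. -/

section Surface

variable {S : Type*} [TopologicalSpace S] [ChartedSpace Plane S] [IsManifold (𝓡 2) ∞ S] [T2Space S]

/-- A smooth simple closed curve is nonseparating if its two sides at some point lie in a common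
connected subset of its complement. -/
theorem IsSmoothParam.isNonseparating [ConnectedSpace S] {γ : ℝ → S} {a : Set S}
    (hγ : IsSmoothParam γ a) {p : S} (hp : p ∈ a) {N K : Set S} (hN : N ∈ 𝓝 p)
    (hK : IsPreconnected K) (hKa : K ⊆ aᶜ) (hNK : N \ a ⊆ K) : IsNonseparating a := by
  have hacl : IsClosed a := hγ.isSimpleClosedCurve.isCompact.isClosed
  have hγc : Continuous γ := hγ.contMDiff.continuous
  have hmem : ∀ t, γ t ∈ a := fun t => hγ.range_eq ▸ mem_range_self t
  have hint : ∀ q ∈ a, ∀ W ∈ 𝓝 q, (W \ a).Nonempty := by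
    intro q hq W hW
    obtain ⟨f, hf, r, hr, hps, hp0, hball, hflat⟩ := hγ.exists_flat_chart hq
    obtain ⟨R, hR, hRt, hRN⟩ := exists_closedBall_subset hps hW
    rw [hp0] at hRt hRN
    set s := min r R / 2 with hs
    have hm := lt_min hr hR
    have hs0 : 0 < s := by positivity
    have hn : ‖(!₂[0, s] : Plane)‖ = s := by
      have : ‖(!₂[0, s] : Plane)‖ ^ 2 = s ^ 2 := by rw [Plane.norm_sq]; simp
      exact (sq_eq_sq₀ (norm_nonneg _) hs0.le).1 this
    refine ⟨f.symm !₂[0, s], hRN _ ?_, ?_⟩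
    · rw [mem_closedBall_zero_iff, hn]; linarith [min_le_right r R]
    · rw [hflat _ (by rw [mem_ball_zero_iff, hn]; linarith [min_le_left r R])]
      simpa using hs0.ne'
  have key : ∀ u v : Set S, IsOpen u → IsOpen v → aᶜ ⊆ u ∪ v → aᶜ ∩ (u ∩ v) = ∅ → K ⊆ u →
      aᶜ ⊆ u := by
    intro u v hu hv hc hd hKu
    have hside : ∀ C : Set S, IsPreconnected C → C ⊆ aᶜ → (C ∩ u).Nonempty → C ⊆ u := by
      intro C hC hCa hCu
      rcases isPreconnected_iff_subset_of_disjoint.1 hC u v hu hv (hCa.trans hc)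
        (subset_eq_empty (inter_subset_inter_left _ hCa) hd) with h | h
      · exact h
      · obtain ⟨z, hz, hzu⟩ := hCu
        exact absurd (show z ∈ aᶜ ∩ (u ∩ v) from ⟨hCa hz, hzu, h hz⟩) (by rw [hd]; simp)
    -- `O` collects the points near which everything off the curve is in `u`. Its trace on the curve
    -- is closed as well as open: in a flat chart each open half-disc is connected and off the
    -- curve, so it lies in `u` as soon as it meets `u`. Hence one point `p` suffices.
    set O : Set S := {q | ∀ᶠ z in 𝓝 q, z ∉ a → z ∈ u} with hO
    have hOo : IsOpen O := isOpen_iff_mem_nhds.2 fun q hq => eventually_eventually_nhds.2 hq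
    have hpO : p ∈ O := mem_of_superset hN fun z hz hza => hKu (hNK ⟨hz, hza⟩)
    have hclopen : IsClopen (γ ⁻¹' O) := by
      refine ⟨isClosed_of_closure_subset fun t ht => ?_, hOo.preimage hγc⟩
      obtain ⟨f, hf, r, hr, hps, hp0, hball, hflat⟩ := hγ.exists_flat_chart (hmem t)
      set B := f.symm '' Metric.ball (0 : Plane) r with hB
      have hBo : IsOpen B := isOpen_image_symm Metric.isOpen_ball hball
      have hq0 : f.symm 0 = γ t := by rw [← hp0, f.left_inv hps]
      have hqB : γ t ∈ B := ⟨0, Metric.mem_ball_self hr, hq0⟩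
      obtain ⟨t', ht'B, ht'O⟩ := mem_closure_iff_nhds.1 ht (γ ⁻¹' B)
        (hγc.continuousAt.preimage_mem_nhds (hBo.mem_nhds hqB))
      obtain ⟨z, hz, hzt⟩ := ht'B
      have hz1 : z 1 = 0 := (hflat z hz).1 (hzt ▸ hmem t')
      have hev : ∀ᶠ w in 𝓝 z, f.symm w ∈ a ∨ f.symm w ∈ u := by
        have h1 : ContinuousAt f.symm z := f.continuousAt_symm (hball hz)
        have h2 : ∀ᶠ x in 𝓝 (f.symm z), x ∉ a → x ∈ u := by rw [hzt]; exact ht'O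
        filter_upwards [h1.eventually h2] with w hw
        by_contra hcon
        rw [not_or] at hcon
        exact hcon.2 (hw hcon.1)
      have hline : ∀ σ : ℝ, σ ≠ 0 → ∃ s > (0 : ℝ), z + s • !₂[0, σ] ∈ Metric.ball (0 : Plane) r ∧
          f.symm (z + s • !₂[0, σ]) ∈ u := by
        intro σ hσ
        have hcont : Continuous fun s : ℝ => z + s • (!₂[0, σ] : Plane) := by fun_prop
        have h0 : Tendsto (fun s : ℝ => z + s • (!₂[0, σ] : Plane)) (𝓝[>] 0) (𝓝 z) := by
          have := hcont.tendsto 0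
          rw [zero_smul, add_zero] at this
          exact this.mono_left nhdsWithin_le_nhds
        obtain ⟨s, ⟨h1, h2⟩, h3⟩ := ((h0.eventually (hev.and (Metric.isOpen_ball.mem_nhds hz))).and
          self_mem_nhdsWithin).exists
        refine ⟨s, h3, h2, h1.resolve_left ?_⟩
        rw [hflat _ h2]
        have : (s : ℝ) ≠ 0 := ne_of_gt h3
        simp [hz1, this, hσ]
      have hhalf : ∀ σ : ℝ, σ ≠ 0 → f.symm '' (Metric.ball (0 : Plane) r ∩ {w | 0 < σ * w 1}) ⊆ u := by
        intro σ hσ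
        apply hside
        · apply isPreconnected_image_symm _ (inter_subset_left.trans hball)
          apply Convex.isPreconnected
          apply (convex_ball _ _).inter
          exact convex_halfSpace_gt (f := fun w : Plane => σ * w 1)
            ⟨fun x y => by simp [mul_add], fun c x => by simp; ring⟩ 0
        · rintro _ ⟨w, ⟨hw, hw1⟩, rfl⟩ hwa
          rw [hflat w hw] at hwa
          simp [hwa] at hw1
        · obtain ⟨s, hs, h1, h2⟩ := hline σ hσ
          refine ⟨_, mem_image_of_mem _ ⟨h1, ?_⟩, h2⟩
          have : 0 < s * (σ * σ) := mul_pos hs (mul_self_pos.2 hσ)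
          simp [hz1]; linarith
      refine mem_of_superset (hBo.mem_nhds hqB) ?_
      rintro _ ⟨w, hw, rfl⟩ hwa
      rw [hflat w hw] at hwa
      rcases lt_or_gt_of_ne hwa with h | h
      · exact hhalf (-1) (by norm_num) ⟨w, ⟨hw, by simpa using h⟩, rfl⟩
      · exact hhalf 1 (by norm_num) ⟨w, ⟨hw, by simpa using h⟩, rfl⟩
    have huniv : γ ⁻¹' O = univ := by
      apply hclopen.eq_univ
      rw [← hγ.range_eq] at hp
      obtain ⟨t, rfl⟩ := hp
      exact ⟨t, hpO⟩
    have haO : a ⊆ O := by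
      rw [← hγ.range_eq]
      rintro _ ⟨t, rfl⟩
      exact (eq_univ_iff_forall.1 huniv t : _)
    -- With `a ⊆ O`, the set `a ∪ u` is a neighbourhood of each point of `a`, hence open; its
    -- complement `v ∩ aᶜ` is open too.
    have hE : IsClopen {z | z ∈ a ∨ z ∈ u} := by
      constructor
      · have : {z | z ∈ a ∨ z ∈ u} = (v ∩ aᶜ)ᶜ := by
          ext z
          simp only [mem_ofPred_eq, mem_compl_iff, mem_inter_iff, not_and, not_not]
          constructor
          · rintro (h | h) hzv
            · exact h
            · by_contra hza
              exact absurd (show z ∈ aᶜ ∩ (u ∩ v) from ⟨hza, h, hzv⟩) (by rw [hd]; simp)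
          · intro h
            by_contra hcon
            rw [not_or] at hcon
            exact hcon.1 (h ((hc hcon.1).resolve_left hcon.2))
        rw [this]
        exact (hv.inter hacl.isOpen_compl).isClosed_compl
      · rw [isOpen_iff_mem_nhds]
        rintro z (hz | hz)
        · filter_upwards [haO hz] with w hw
          by_cases hwa : w ∈ a
          · exact Or.inl hwa
          · exact Or.inr (hw hwa)
        · exact mem_of_superset (hu.mem_nhds hz) fun w hw => Or.inr hw
    have := hE.eq_univ ⟨p, Or.inl hp⟩
    intro z hz
    have hz' : z ∈ {z | z ∈ a ∨ z ∈ u} := this ▸ mem_univ z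
    exact hz'.resolve_left hz
  obtain ⟨z, hz, hza⟩ := hint p hp N hN
  refine ⟨⟨z, hza⟩, isPreconnected_iff_subset_of_disjoint.2 fun u v hu hv hc hd => ?_⟩
  rcases isPreconnected_iff_subset_of_disjoint.1 hK u v hu hv (hKa.trans hc)
    (subset_eq_empty (inter_subset_inter_left _ hKa) hd) with h | h
  · exact Or.inl (key u v hu hv hc hd h)
  · exact Or.inr (key v u hv hu (by rwa [union_comm]) (by rwa [inter_comm v u]) h)

/-- A smooth injective immersed loop, given over one period with overlapping ends, is a smooth
simple closed curve. -/
theorem exists_smoothParam_of_overlap {H : ℝ → S} {P α β c : ℝ} (hP : 0 < P) (hα : α < c)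
    (hβ : c + P < β) (hsm : ∀ t ∈ Ioo α β, ContMDiffAt 𝓘(ℝ, ℝ) (𝓡 2) ∞ H t)
    (hper : ∀ t ∈ Ioo α (β - P), H (t + P) = H t)
    (himm : ∀ t ∈ Ico c (c + P), Function.Injective (mfderiv 𝓘(ℝ, ℝ) (𝓡 2) H t))
    (hinj : InjOn H (Ico c (c + P))) :
    ∃ γ : ℝ → S, IsSmoothParam γ (H '' Ico c (c + P)) := by
  -- The periodic extension of `H` over one period. Near every `t` it is a translate of `H`, even at
  -- the seam `c`, because there `hper` identifies the two overlapping ends.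
  set G : ℝ → S := fun t => H (toIcoMod hP c t) with hG
  have hGper : ∀ t, G (t + P) = G t := fun t => by simp [hG]
  have hloc : ∀ t, G =ᶠ[𝓝 t] fun s => H (s + (toIcoMod hP c t - t)) := by
    intro t
    have hmem := toIcoMod_mem_Ico hP c t
    have hU : Ioo (max α (c - P) - (toIcoMod hP c t - t)) (c + P - (toIcoMod hP c t - t)) ∈ 𝓝 t := by
      apply Ioo_mem_nhds
      · have : max α (c - P) < c := max_lt hα (by linarith)
        linarith [hmem.1]
      · linarith [hmem.2]
    filter_upwards [hU] with s hs
    obtain ⟨n, hn⟩ : ∃ n : ℤ, toIcoMod hP c t - t = -(n • P) :=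
      ⟨toIcoDiv hP c t, by rw [toIcoMod]; ring⟩
    have h1 : α < s + (toIcoMod hP c t - t) := by linarith [hs.1, le_max_left α (c - P)]
    have h2 : c - P < s + (toIcoMod hP c t - t) := by linarith [hs.1, le_max_right α (c - P)]
    have h3 : s + (toIcoMod hP c t - t) < c + P := by linarith [hs.2]
    change H (toIcoMod hP c s) = _
    by_cases hc : c ≤ s + (toIcoMod hP c t - t)
    · congr 1
      rw [toIcoMod_eq_iff]
      exact ⟨⟨hc, h3⟩, n, by rw [hn]; simp⟩
    · rw [not_le] at hc
      rw [← hper _ ⟨h1, by linarith⟩]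
      congr 1
      rw [toIcoMod_eq_iff]
      refine ⟨⟨by linarith, by linarith⟩, n - 1, ?_⟩
      rw [hn, sub_smul]; simp
  have hsmG : ∀ t, ContMDiffAt 𝓘(ℝ, ℝ) (𝓡 2) ∞ G t := by
    intro t
    refine ContMDiffAt.congr_of_eventuallyEq ?_ (hloc t)
    have hmem := toIcoMod_mem_Ico hP c t
    have h1 : ContMDiffAt 𝓘(ℝ, ℝ) (𝓡 2) ∞ H (t + (toIcoMod hP c t - t)) := by
      apply hsm
      rw [add_sub_cancel]
      exact ⟨by linarith [hmem.1], by linarith [hmem.2]⟩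
    exact h1.comp (x := t) (f := fun s => s + (toIcoMod hP c t - t))
      ((contDiff_id.add contDiff_const).contDiffAt (x := t)).contMDiffAt
  have himmG : ∀ t, Function.Injective (mfderiv 𝓘(ℝ, ℝ) (𝓡 2) G t) := by
    intro t
    have hmem := toIcoMod_mem_Ico hP c t
    set q := H (toIcoMod hP c t) with hq
    have hm : chartAt Plane q ∈ smoothCharts S := IsManifold.chart_mem_maximalAtlas q
    have hqs : q ∈ (chartAt Plane q).source := mem_chart_source Plane q
    rw [mfderiv_injective_iff hm (hsmG t) hqs]
    have h1 := (mfderiv_injective_iff hm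
      (hsm (toIcoMod hP c t) ⟨by linarith [hmem.1], by linarith [hmem.2]⟩) hqs).1 (himm _ hmem)
    have h2 : (fun s => chartAt Plane q (G s)) =ᶠ[𝓝 t]
        fun s => (fun r => chartAt Plane q (H r)) (s + (toIcoMod hP c t - t)) :=
      (hloc t).fun_comp (chartAt Plane q)
    rw [h2.deriv_eq, deriv_comp_add_const (f := fun r => chartAt Plane q (H r)), add_sub_cancel]
    exact h1
  have hsmγ : ContMDiff 𝓘(ℝ, ℝ) (𝓡 2) ∞ fun t : ℝ => G (P * t) := fun t =>
    (hsmG (P * t)).comp (x := t) (f := fun s => P * s)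
      ((contDiff_const.mul contDiff_id).contDiffAt (x := t)).contMDiffAt
  refine ⟨fun t => G (P * t), hsmγ, fun t => ?_, ?_, fun t => ?_, ?_⟩
  · rw [mul_add, mul_one, hGper]
  · intro s hs t ht hst
    have h1 := hinj (toIcoMod_mem_Ico hP c _) (toIcoMod_mem_Ico hP c _) hst
    obtain ⟨n, hn⟩ := (toIcoMod_inj hP).1 h1 |> AddCommGroup.modEq_iff_zsmul.1
    rw [zsmul_eq_mul] at hn
    have h2 : t - s = n := by
      have : P * (t - s - n) = 0 := by linarith
      linarith [(mul_eq_zero.1 this).resolve_left hP.ne']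
    have h3 : (n : ℝ) < 1 := by linarith [hs.1, ht.2]
    have h4 : (-1 : ℝ) < n := by linarith [hs.2, ht.1]
    have h5 : n < 1 := by exact_mod_cast h3
    have h6 : -1 < n := by exact_mod_cast h4
    have h7 : n = 0 := by omega
    rw [h7] at h2
    push_cast at h2
    linarith
  · set q := G (P * t) with hq
    have hm : chartAt Plane q ∈ smoothCharts S := IsManifold.chart_mem_maximalAtlas q
    have hqs : q ∈ (chartAt Plane q).source := mem_chart_source Plane q
    rw [mfderiv_injective_iff hm (hsmγ t) hqs]
    have h1 := (mfderiv_injective_iff hm (hsmG (P * t)) hqs).1 (himmG _)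
    have h2 := deriv_comp_mul_left P (fun r => chartAt Plane q (G r)) t
    rw [h2]
    exact smul_ne_zero hP.ne' h1
  · ext x
    constructor
    · rintro ⟨t, rfl⟩
      exact ⟨_, toIcoMod_mem_Ico hP c _, rfl⟩
    · rintro ⟨t, ht, rfl⟩
      refine ⟨t / P, ?_⟩
      change H (toIcoMod hP c (P * (t / P))) = _
      rw [mul_div_cancel₀ _ hP.ne', (toIcoMod_eq_self hP).2 ht]

end Surface

/-! ### Rounding a transverse corner. -/

/-- A smooth function vanishing for `t ≤ -η`, equal to `t + η` for `t ≥ η`, and increasing for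
`t ≥ -η`. -/
noncomputable def cornerRamp (η t : ℝ) : ℝ := (t + η) * Real.smoothTransition ((t + η) / (2 * η))

section cornerRamp

variable {η : ℝ}

theorem contDiff_cornerRamp : ContDiff ℝ ∞ (cornerRamp η) :=
  (contDiff_id.add contDiff_const).mul
    (Real.smoothTransition.contDiff.comp ((contDiff_id.add contDiff_const).div_const _))

theorem cornerRamp_of_le (hη : 0 < η) {t : ℝ} (ht : t ≤ -η) : cornerRamp η t = 0 := by
  rw [cornerRamp, Real.smoothTransition.zero_of_nonpos, mul_zero]
  exact div_nonpos_of_nonpos_of_nonneg (by linarith) (by linarith)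

theorem cornerRamp_of_ge (hη : 0 < η) {t : ℝ} (ht : η ≤ t) : cornerRamp η t = t + η := by
  rw [cornerRamp, Real.smoothTransition.one_of_one_le, mul_one]
  rw [le_div_iff₀ (by linarith)]; linarith

theorem cornerRamp_pos (hη : 0 < η) {t : ℝ} (ht : -η < t) : 0 < cornerRamp η t :=
  mul_pos (by linarith) (Real.smoothTransition.pos_of_pos (div_pos (by linarith) (by linarith)))

theorem cornerRamp_nonneg (hη : 0 < η) (t : ℝ) : 0 ≤ cornerRamp η t := by
  rcases le_or_gt t (-η) with h | h
  · exact (cornerRamp_of_le hη h).ge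
  · exact (cornerRamp_pos hη h).le

theorem cornerRamp_le (hη : 0 < η) {t : ℝ} (ht : |t| < 2 * η) : cornerRamp η t ≤ 3 * η := by
  rcases le_or_gt t (-η) with h | h
  · rw [cornerRamp_of_le hη h]; linarith
  · rw [cornerRamp]
    have := Real.smoothTransition.le_one ((t + η) / (2 * η))
    have h2 := (abs_lt.1 ht).2
    nlinarith

theorem cornerRamp_lt (hη : 0 < η) {s t : ℝ} (hs : -η < s) (hst : s < t) :
    cornerRamp η s < cornerRamp η t := by
  unfold cornerRamp
  have h1 : (s + η) / (2 * η) ≤ (t + η) / (2 * η) := by gcongr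
  have h2 := Real.smoothTransition.monotone h1
  have h3 : 0 < Real.smoothTransition ((s + η) / (2 * η)) :=
    Real.smoothTransition.pos_of_pos (div_pos (by linarith) (by linarith))
  nlinarith

theorem monotone_cornerRamp (hη : 0 < η) : Monotone (cornerRamp η) := by
  intro s t hst
  rcases le_or_gt s (-η) with h | h
  · rw [cornerRamp_of_le hη h]
    exact cornerRamp_nonneg hη t
  · rcases hst.eq_or_lt with rfl | h'
    · exact le_rfl
    · exact (cornerRamp_lt hη h h').le

theorem deriv_cornerRamp_pos (hη : 0 < η) {t : ℝ} (ht : -η < t) : 0 < deriv (cornerRamp η) t := by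
  have h1 : HasDerivAt (fun t : ℝ => t + η) 1 t := (hasDerivAt_id t).add_const η
  have hm : Monotone fun t : ℝ => Real.smoothTransition ((t + η) / (2 * η)) :=
    Real.smoothTransition.monotone.comp fun a b hab => by gcongr
  have hd : ContDiff ℝ ∞ fun t : ℝ => Real.smoothTransition ((t + η) / (2 * η)) :=
    Real.smoothTransition.contDiff.comp ((contDiff_id.add contDiff_const).div_const _)
  have h2 := (hd.differentiable (by simp) t).hasDerivAt
  have h3 : 0 ≤ deriv (fun t : ℝ => Real.smoothTransition ((t + η) / (2 * η))) t :=
    hm.deriv_nonneg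
  have h4 : HasDerivAt (cornerRamp η) _ t := h1.mul h2
  rw [h4.deriv]
  have h5 : 0 < Real.smoothTransition ((t + η) / (2 * η)) :=
    Real.smoothTransition.pos_of_pos (div_pos (by linarith) (by linarith))
  nlinarith

/-- A smooth arc running in along the negative first axis and out along the positive second one. -/
noncomputable def roundedCorner (η t : ℝ) : Plane := !₂[-cornerRamp η (-t), cornerRamp η t]

theorem contDiff_roundedCorner : ContDiff ℝ ∞ (roundedCorner η) :=
  Plane.contDiff_mk (contDiff_cornerRamp.comp contDiff_neg).neg contDiff_cornerRamp

theorem roundedCorner_of_ge (hη : 0 < η) {t : ℝ} (ht : η ≤ t) :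
    roundedCorner η t = !₂[0, t + η] := by
  rw [roundedCorner, cornerRamp_of_ge hη ht, cornerRamp_of_le hη (by linarith), neg_zero]

theorem roundedCorner_of_le (hη : 0 < η) {t : ℝ} (ht : t ≤ -η) :
    roundedCorner η t = !₂[t - η, 0] := by
  rw [roundedCorner, cornerRamp_of_le hη ht, cornerRamp_of_ge hη (by linarith)]
  congr 2
  ring

theorem norm_roundedCorner_lt (hη : 0 < η) {t : ℝ} (ht : |t| < 2 * η) :
    ‖roundedCorner η t‖ < 6 * η := by
  have h1 := cornerRamp_le hη ht
  have h2 := cornerRamp_le hη (t := -t) (by rwa [abs_neg])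
  have h3 := cornerRamp_nonneg hη t
  have h4 := cornerRamp_nonneg hη (-t)
  have h5 : ‖roundedCorner η t‖ ^ 2 = cornerRamp η (-t) ^ 2 + cornerRamp η t ^ 2 := by
    rw [Plane.norm_sq]; simp [roundedCorner]
  apply lt_of_pow_lt_pow_left₀ 2 (by positivity)
  nlinarith

/-- At each time one coordinate moves: the second one when `-η < t`, the first one otherwise. -/
theorem deriv_roundedCorner_ne_zero (hη : 0 < η) (t : ℝ) : deriv (roundedCorner η) t ≠ 0 := by
  intro h0
  have hd : HasDerivAt (roundedCorner η) (deriv (roundedCorner η) t) t :=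
    (contDiff_roundedCorner.differentiable (by simp) t).hasDerivAt
  rw [h0] at hd
  have hc : ∀ i, HasDerivAt (fun s => roundedCorner η s i) 0 t := fun i => by
    have := ((EuclideanSpace.proj (𝕜 := ℝ) i : Plane →L[ℝ] ℝ).hasFDerivAt).comp_hasDerivAt t hd
    rw [map_zero] at this
    exact this
  have hr : Differentiable ℝ (cornerRamp η) := contDiff_cornerRamp.differentiable (by simp)
  rcases lt_or_ge (-η) t with h | h
  · have h1 : deriv (cornerRamp η) t = 0 := (hc 1).deriv
    exact (deriv_cornerRamp_pos hη h).ne' h1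
  · have h1 : HasDerivAt (fun s => -cornerRamp η (-s)) 0 t := hc 0
    have h2 : HasDerivAt (fun s => -cornerRamp η (-s)) (-(deriv (cornerRamp η) (-t) * -1)) t :=
      ((hr (-t)).hasDerivAt.comp t (hasDerivAt_neg t)).neg
    have h3 := h1.unique h2
    have h4 := deriv_cornerRamp_pos hη (t := -t) (by linarith)
    linarith

end cornerRamp

section Surface

variable {S : Type*} [TopologicalSpace S] [ChartedSpace Plane S] [IsManifold (𝓡 2) ∞ S] [T2Space S]

theorem Plane.norm_mk_zero (s : ℝ) : ‖(!₂[s, 0] : Plane)‖ = |s| := by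
  have : ‖(!₂[s, 0] : Plane)‖ ^ 2 = |s| ^ 2 := by rw [Plane.norm_sq]; simp
  exact (sq_eq_sq₀ (norm_nonneg _) (abs_nonneg _)).1 this

theorem Plane.norm_zero_mk (s : ℝ) : ‖(!₂[0, s] : Plane)‖ = |s| := by
  have : ‖(!₂[0, s] : Plane)‖ ^ 2 = |s| ^ 2 := by rw [Plane.norm_sq]; simp
  exact (sq_eq_sq₀ (norm_nonneg _) (abs_nonneg _)).1 this

theorem contMDiffAt_comp_const_add {g : ℝ → S} {c t : ℝ}
    (h : ContMDiffAt 𝓘(ℝ, ℝ) (𝓡 2) ∞ g (c + t)) :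
    ContMDiffAt 𝓘(ℝ, ℝ) (𝓡 2) ∞ (fun s => g (c + s)) t :=
  h.comp (x := t) (f := fun s => c + s) ((contDiff_const.add contDiff_id).contDiffAt
    (x := t)).contMDiffAt

theorem mfderiv_injective_comp_const_add {g : ℝ → S} {c t : ℝ}
    (h : ContMDiffAt 𝓘(ℝ, ℝ) (𝓡 2) ∞ g (c + t))
    (hi : Function.Injective (mfderiv 𝓘(ℝ, ℝ) (𝓡 2) g (c + t))) :
    Function.Injective (mfderiv 𝓘(ℝ, ℝ) (𝓡 2) (fun s => g (c + s)) t) := by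
  have hm : chartAt Plane (g (c + t)) ∈ smoothCharts S := IsManifold.chart_mem_maximalAtlas _
  have hs := mem_chart_source Plane (g (c + t))
  rw [mfderiv_injective_iff hm (contMDiffAt_comp_const_add h) hs,
    deriv_comp_const_add (f := fun s => chartAt Plane (g (c + t)) (g s))]
  exact (mfderiv_injective_iff hm h hs).1 hi

/-- A simple loop, smooth except for one transverse corner, can be rounded near its corner. -/
theorem exists_smoothParam_rounding {g : ℝ → S} {a b : ℝ} (hab : a < b) {p : S}
    {e : OpenPartialHomeomorph S Plane} (he : e ∈ smoothCharts S) (hp : p ∈ e.source)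
    (hsm : ∀ t ∈ Icc a b, ∀ᶠ s in 𝓝 t, ContMDiffAt 𝓘(ℝ, ℝ) (𝓡 2) ∞ g s)
    (himm : ∀ t ∈ Ioo a b, Function.Injective (mfderiv 𝓘(ℝ, ℝ) (𝓡 2) g t))
    (hga : g a = p) (hgb : g b = p) (hinj : InjOn g (Ico a b))
    (hdet : Plane.det (deriv (fun s => e (g s)) b) (deriv (fun s => e (g s)) a) ≠ 0)
    {V : Set S} (hV : V ∈ 𝓝 p) :
    ∃ (γ : ℝ → S) (y : Set S), IsSmoothParam γ y ∧ y \ V = g '' Icc a b \ V := by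
  have hcont : ContinuousOn g (Icc a b) := fun t ht =>
    (hsm t ht).self_of_nhds.continuousAt.continuousWithinAt
  have hshift : ∀ c ∈ Icc a b,
      ∀ᶠ t in 𝓝 (0 : ℝ), ContMDiffAt 𝓘(ℝ, ℝ) (𝓡 2) ∞ (fun s => g (c + s)) t := by
    intro c hc
    have h1 : Tendsto (fun s : ℝ => c + s) (𝓝 0) (𝓝 c) := by
      have : Continuous fun s : ℝ => c + s := by fun_prop
      simpa using this.tendsto 0
    exact (h1.eventually (hsm c hc)).mono fun t ht => contMDiffAt_comp_const_add ht
  -- In this chart the loop arrives along the negative first axis and leaves along the positive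
  -- second one, exactly as `roundedCorner` does away from the bend.
  obtain ⟨f, hf, δ, hδ, hps, hp0, hball, haxes⟩ := exists_chart_straightening he hp
    (g₁ := fun s => g (b + s)) (g₂ := fun s => g (a + s))
    (hshift b ⟨hab.le, le_rfl⟩) (hshift a ⟨le_rfl, hab.le⟩) (by simpa using hgb)
    (by simpa using hga)
    (by
      rw [deriv_comp_const_add (f := fun s => e (g s)), deriv_comp_const_add (f := fun s => e (g s)),
        add_zero, add_zero]
      exact hdet)
  set δ₀ := min δ ((b - a) / 4) with hδ₀
  have hδ₀0 : 0 < δ₀ := lt_min hδ (by linarith)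
  have hδ₀δ : δ₀ ≤ δ := min_le_left _ _
  have hδ₀b : δ₀ ≤ (b - a) / 4 := min_le_right _ _
  have hK : IsCompact (g '' Icc (a + δ₀ / 2) (b - δ₀ / 2)) :=
    isCompact_Icc.image_of_continuousOn
      (hcont.mono (Icc_subset_Icc (by linarith) (by linarith)))
  have hpK : p ∉ g '' Icc (a + δ₀ / 2) (b - δ₀ / 2) := by
    rintro ⟨t, ht, htp⟩
    have := hinj (x₁ := t) (x₂ := a) ⟨by linarith [ht.1], by linarith [ht.2]⟩ ⟨le_rfl, hab⟩
      (htp.trans hga.symm)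
    linarith [ht.1]
  obtain ⟨R, hR, hRt, hRs⟩ := exists_closedBall_subset hps
    (inter_mem hV (hK.isClosed.isOpen_compl.mem_nhds hpK))
  rw [hp0] at hRt hRs
  -- The modification takes place in the ball of radius `6 * η`; the factor `20` keeps it well
  -- inside the range where the axes describe the loop and where the chart maps into `V`.
  set η := min δ₀ R / 20 with hη
  have hm := lt_min hδ₀0 hR
  have hη0 : 0 < η := by positivity
  have hηδ : 20 * η ≤ δ₀ := by rw [hη]; linarith [min_le_left δ₀ R]
  have hηR : 20 * η ≤ R := by rw [hη]; linarith [min_le_right δ₀ R]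
  have hballδ : Metric.ball (0 : Plane) (6 * η) ⊆ Metric.ball 0 δ :=
    Metric.ball_subset_ball (by linarith)
  have hballR : Metric.ball (0 : Plane) (6 * η) ⊆ Metric.closedBall 0 R :=
    (Metric.ball_subset_ball (by linarith)).trans Metric.ball_subset_closedBall
  -- the old loop meets the small ball only along the axes
  have hoff : ∀ z ∈ Metric.ball (0 : Plane) (6 * η), z 0 ≠ 0 → z 1 ≠ 0 →
      f.symm z ∉ g '' Icc a b := by
    rintro z hz h0 h1 ⟨t, ht, htz⟩
    have h2 := (hRs z (hballR hz)).2
    have hmem : ∀ s, |s| < δ → (!₂[s, 0] : Plane) ∈ f.target ∧ (!₂[0, s] : Plane) ∈ f.target :=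
      fun s hs => ⟨hball (by rwa [mem_ball_zero_iff, Plane.norm_mk_zero]),
        hball (by rwa [mem_ball_zero_iff, Plane.norm_zero_mk])⟩
    rcases lt_or_ge t (a + δ₀ / 2) with h | h
    · have hs : |t - a| < δ := by rw [abs_lt]; constructor <;> linarith [ht.1]
      have h3 := (haxes _ hs).2
      simp only [add_sub_cancel] at h3
      have h4 := f.symm.injOn (hmem _ hs).2 (hball (hballδ hz)) (h3.trans htz)
      exact h0 (by rw [← h4]; simp)
    · rcases lt_or_ge (b - δ₀ / 2) t with h' | h'
      · have hs : |t - b| < δ := by rw [abs_lt]; constructor <;> linarith [ht.2]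
        have h3 := (haxes _ hs).1
        simp only [add_sub_cancel] at h3
        have h4 := f.symm.injOn (hmem _ hs).1 (hball (hballδ hz)) (h3.trans htz)
        exact h1 (by rw [← h4]; simp)
      · exact h2 ⟨t, ⟨h, h'⟩, htz⟩
  set Q : ℝ → S := fun t => f.symm (roundedCorner η t) with hQ
  have hQb : ∀ t, |t| < 2 * η → roundedCorner η t ∈ Metric.ball (0 : Plane) (6 * η) :=
    fun t ht => by rw [mem_ball_zero_iff]; exact norm_roundedCorner_lt hη0 ht
  have hQt : ∀ t, |t| < 2 * η → roundedCorner η t ∈ f.target :=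
    fun t ht => hball (hballδ (hQb t ht))
  have hQsm : ∀ t, |t| < 2 * η → ContMDiffAt 𝓘(ℝ, ℝ) (𝓡 2) ∞ Q t := fun t ht =>
    contMDiffAt_symm_comp hf contDiff_roundedCorner.contDiffAt (hQt t ht)
  have hQimm : ∀ t, |t| < 2 * η → Function.Injective (mfderiv 𝓘(ℝ, ℝ) (𝓡 2) Q t) := by
    intro t ht
    rw [mfderiv_injective_iff hf (hQsm t ht) (f.map_target (hQt t ht))]
    have h1 : (fun s => f (Q s)) =ᶠ[𝓝 t] roundedCorner η := by
      have hopen : ∀ᶠ s in 𝓝 t, |s| < 2 * η := (continuous_abs.tendsto t).eventually_lt_const ht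
      exact hopen.mono fun s hs => f.right_inv (hQt s hs)
    rw [h1.deriv_eq]
    exact deriv_roundedCorner_ne_zero hη0 t
  have hQge : ∀ t, η ≤ t → t < 2 * η → Q t = g (a + η + t) := by
    intro t h1 h2
    simp only [hQ]
    rw [roundedCorner_of_ge hη0 h1, (haxes (t + η) (by rw [abs_lt]; constructor <;> linarith)).2]
    congr 1; ring
  have hQle : ∀ t, -(2 * η) < t → t ≤ -η → Q t = g (b - η + t) := by
    intro t h1 h2
    simp only [hQ]
    rw [roundedCorner_of_le hη0 h2, (haxes (t - η) (by rw [abs_lt]; constructor <;> linarith)).1]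
    congr 1; ring
  -- During the bend both coordinates are nonzero, while near the corner the old loop stays on the
  -- axes.
  have hQoff : ∀ t, |t| < η → Q t ∉ g '' Icc a b := by
    intro t ht
    have h1 := cornerRamp_pos hη0 (abs_lt.1 ht).1
    have h2 := cornerRamp_pos hη0 (t := -t) (by linarith [(abs_lt.1 ht).2])
    apply hoff _ (hQb t (by linarith))
    · simpa [roundedCorner] using h2.ne'
    · simpa [roundedCorner] using h1.ne'
  have hQinj : ∀ s t, |s| < η → |t| < η → Q s = Q t → s = t := by
    intro s t hs ht hst
    have h1 := f.symm.injOn (hQt s (by linarith)) (hQt t (by linarith)) hst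
    have h2 : cornerRamp η s = cornerRamp η t := congrArg (fun z : Plane => z 1) h1
    rcases lt_trichotomy s t with h | h | h
    · exact absurd h2 (cornerRamp_lt hη0 (abs_lt.1 hs).1 h).ne
    · exact h
    · exact absurd h2 (cornerRamp_lt hη0 (abs_lt.1 ht).1 h).ne'
  -- The bend at time `t` matches `g (a + η + t)` for `η ≤ t` and `g (b - η + t)` for `t ≤ -η`, so
  -- the period drops by `2 * η`. The seam `c` is put inside `(-2η, -η)`, where the bend and the old
  -- loop already agree.
  set P := b - a - 2 * η with hP
  have hP0 : 0 < P := by rw [hP]; linarith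
  set c := -(3 / 2 * η) with hc
  set H : ℝ → S := fun t => if t < 3 / 2 * η then Q t else g (a + η + t) with hH
  have hHQ : ∀ t, t < 2 * η → H t = Q t := by
    intro t ht
    by_cases h : t < 3 / 2 * η
    · simp only [hH, if_pos h]
    · simp only [hH, if_neg h]
      exact (hQge t (by linarith) ht).symm
  have hHg : ∀ t, η ≤ t → H t = g (a + η + t) := by
    intro t ht
    by_cases h : t < 3 / 2 * η
    · simp only [hH, if_pos h]
      exact hQge t ht (by linarith)
    · simp only [hH, if_neg h]
  have hHg' : ∀ t, -(2 * η) < t → t ≤ -η → H t = g (b - η + t) := fun t h1 h2 => by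
    rw [hHQ t (by linarith), hQle t h1 h2]
  have hloc : ∀ t ∈ Ioo (-(2 * η)) (P - η), ContMDiffAt 𝓘(ℝ, ℝ) (𝓡 2) ∞ H t ∧
      Function.Injective (mfderiv 𝓘(ℝ, ℝ) (𝓡 2) H t) := by
    intro t ht
    rcases lt_or_ge t (2 * η) with h | h
    · have habs : |t| < 2 * η := abs_lt.2 ⟨ht.1, h⟩
      have hev : H =ᶠ[𝓝 t] Q := (eventually_lt_nhds h).mono fun s hs => hHQ s hs
      refine ⟨(hQsm t habs).congr_of_eventuallyEq hev, ?_⟩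
      rw [hev.mfderiv_eq]
      exact hQimm t habs
    · have hev : H =ᶠ[𝓝 t] fun s => g (a + η + s) :=
        (eventually_gt_nhds (show η < t by linarith)).mono fun s hs => hHg s (le_of_lt hs)
      have hmem : a + η + t ∈ Ioo a b := ⟨by linarith, by linarith [ht.2]⟩
      have h1 := (hsm _ (Ioo_subset_Icc_self hmem)).self_of_nhds
      refine ⟨(contMDiffAt_comp_const_add h1).congr_of_eventuallyEq hev, ?_⟩
      rw [hev.mfderiv_eq]
      exact mfderiv_injective_comp_const_add h1 (himm _ hmem)
  -- off the corner, the new loop is a reparametrized arc of the old one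
  have hcase : ∀ t ∈ Ico c (c + P), |t| < η ∨
      ∃ u ∈ Ioo a b, H t = g u ∧ ((t ≤ -η ∧ u = b - η + t) ∨ (η ≤ t ∧ u = a + η + t)) := by
    intro t ht
    rcases lt_or_ge (-η) t with h | h
    · rcases lt_or_ge t η with h' | h'
      · exact Or.inl (abs_lt.2 ⟨h, h'⟩)
      · exact Or.inr ⟨a + η + t, ⟨by linarith, by linarith [ht.2]⟩, hHg t h', Or.inr ⟨h', rfl⟩⟩
    · exact Or.inr ⟨b - η + t, ⟨by linarith [ht.1], by linarith⟩,
        hHg' t (by linarith [ht.1]) h, Or.inl ⟨h, rfl⟩⟩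
  obtain ⟨γ, hγ⟩ := exists_smoothParam_of_overlap (H := H) hP0 (α := -(2 * η)) (β := P - η) (c := c)
    (by linarith) (by linarith) (fun t ht => (hloc t ht).1)
    (fun t ht => by
      have h2 : t < -η := by linarith [ht.2]
      rw [hHg' t ht.1 h2.le, hHg _ (by linarith [ht.1])]
      congr 1; rw [hP]; ring)
    (fun t ht => (hloc t ⟨by linarith [ht.1], by linarith [ht.2]⟩).2)
    (by
      intro s hs t ht hst
      rcases hcase s hs with h1 | ⟨u, hu, hsu, hu'⟩ <;> rcases hcase t ht with h2 | ⟨v, hv, htv, hv'⟩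
      · rw [hHQ s (by linarith [(abs_lt.1 h1).2]), hHQ t (by linarith [(abs_lt.1 h2).2])] at hst
        exact hQinj s t h1 h2 hst
      · rw [hHQ s (by linarith [(abs_lt.1 h1).2]), htv] at hst
        exact absurd ⟨v, Ioo_subset_Icc_self hv, hst.symm⟩ (hQoff s h1)
      · rw [hHQ t (by linarith [(abs_lt.1 h2).2]), hsu] at hst
        exact absurd ⟨u, Ioo_subset_Icc_self hu, hst⟩ (hQoff t h2)
      · rw [hsu, htv] at hst
        have huv := hinj (Ioo_subset_Ico_self hu) (Ioo_subset_Ico_self hv) hst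
        rcases hu' with ⟨hu1, hu2⟩ | ⟨hu1, hu2⟩ <;> rcases hv' with ⟨hv1, hv2⟩ | ⟨hv1, hv2⟩ <;>
          linarith [hs.1, hs.2, ht.1, ht.2])
  have hQV : ∀ t, |t| < 2 * η → Q t ∈ V := fun t ht => (hRs _ (hballR (hQb t ht))).1
  refine ⟨γ, _, hγ, ?_⟩
  ext x
  constructor
  · rintro ⟨⟨t, ht, rfl⟩, hx⟩
    rcases hcase t ht with h | ⟨u, hu, htu, -⟩
    · rw [hHQ t (by linarith [(abs_lt.1 h).2])] at hx
      exact absurd (hQV t (by linarith)) hx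
    · exact ⟨⟨u, Ioo_subset_Icc_self hu, htu.symm⟩, hx⟩
  · rintro ⟨⟨u, hu, rfl⟩, hx⟩
    refine ⟨?_, hx⟩
    have hsmall : ∀ s, |s| < 6 * η → g (b + s) ∈ V ∧ g (a + s) ∈ V := by
      intro s hs
      obtain ⟨h1, h2⟩ := haxes s (by linarith)
      rw [← h1, ← h2]
      exact ⟨(hRs _ (hballR (by rwa [mem_ball_zero_iff, Plane.norm_mk_zero]))).1,
        (hRs _ (hballR (by rwa [mem_ball_zero_iff, Plane.norm_zero_mk]))).1⟩
    have hua : a + 3 * η ≤ u := by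
      by_contra hlt
      have := (hsmall (u - a) (by rw [abs_lt]; constructor <;> linarith [hu.1])).2
      rw [add_sub_cancel] at this
      exact hx this
    have hub : u ≤ b - 3 * η := by
      by_contra hlt
      have := (hsmall (u - b) (by rw [abs_lt]; constructor <;> linarith [hu.2])).1
      rw [add_sub_cancel] at this
      exact hx this
    refine ⟨u - a - η, ⟨by linarith, by linarith⟩, ?_⟩
    rw [hHg _ (by linarith)]
    congr 1; ring

end Surface

/-! ### Chords of a continuous curve and the theta curve argument. -/

/-- The affine chart change sending `(0, 0)` to `k` and `(1, 0)` to `k + v`. -/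
theorem Plane.exists_affine (k : Plane) {v : Plane} (hv : v ≠ 0) :
    ∃ G : OpenPartialHomeomorph Plane Plane, G.source = univ ∧ G.target = univ ∧
      ContDiff ℝ ∞ G ∧ ContDiff ℝ ∞ G.symm ∧ ∀ x : ℝ, G !₂[x, 0] = k + x • v := by
  have hdet : Plane.det v !₂[-v 1, v 0] ≠ 0 := by
    have : Plane.det v !₂[-v 1, v 0] = v 0 ^ 2 + v 1 ^ 2 := by simp [Plane.det]; ring
    rw [this, ← Plane.norm_sq]
    positivity
  obtain ⟨A, hA⟩ := Plane.exists_linearEquiv hdet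
  refine ⟨(A.toHomeomorph.trans (Homeomorph.addLeft k)).toOpenPartialHomeomorph, rfl, rfl, ?_, ?_,
    fun x => ?_⟩
  · exact contDiff_const.add A.contDiff
  · exact A.symm.contDiff.comp (contDiff_const.add contDiff_id)
  · change k + A !₂[x, 0] = _
    rw [hA]; simp

/-- An open planar set containing the open segment from `(0, 0)` to `(1, 0)` contains connected
collars of the segment on both sides. -/
theorem Plane.exists_collars {O : Set Plane} (hO : IsOpen O) (hne : Oᶜ.Nonempty)
    (hseg : ∀ x ∈ Ioo (0 : ℝ) 1, (!₂[x, 0] : Plane) ∈ O) :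
    ∃ T : ℝ → Set Plane, ∀ σ : ℝ, |σ| = 1 → T σ ⊆ O ∧ (∀ z ∈ T σ, 0 < σ * z 1) ∧
      IsPreconnected (T σ) ∧
      ∀ x ∈ Ioo (0 : ℝ) 1, ∀ᶠ z in 𝓝 (!₂[x, 0] : Plane), 0 < σ * z 1 → z ∈ T σ := by
  have hmk : Continuous fun x : ℝ => (!₂[x, 0] : Plane) :=
    (Plane.contDiff_mk contDiff_id contDiff_const).continuous
  -- The height of the collar over `x` is the distance to the complement of `O`. That complement has
  -- to be nonempty, as `infDist` to the empty set is `0`.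
  set ρ : ℝ → ℝ := fun x => Metric.infDist (!₂[x, 0] : Plane) Oᶜ with hρ
  have hρc : Continuous ρ := (Metric.continuous_infDist_pt _).comp hmk
  have hρ0 : ∀ x ∈ Ioo (0 : ℝ) 1, 0 < ρ x := fun x hx =>
    (hO.isClosed_compl.notMem_iff_infDist_pos hne).1 (fun h => h (hseg x hx))
  have hmem : ∀ x s : ℝ, |s| < ρ x → (!₂[x, s] : Plane) ∈ O := by
    intro x s hs
    by_contra hn
    have h1 : ρ x ≤ dist (!₂[x, 0] : Plane) !₂[x, s] := Metric.infDist_le_dist_of_mem hn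
    have h2 : dist (!₂[x, 0] : Plane) !₂[x, s] = |s| := by
      rw [dist_comm, dist_eq_norm, ← Plane.norm_zero_mk]
      congr 1
      apply Plane.ext' <;> simp
    linarith
  refine ⟨fun σ => (fun q : ℝ × ℝ => (!₂[q.1, σ * (q.2 * ρ q.1)] : Plane)) '' Ioo 0 1 ×ˢ Ioo 0 1,
    fun σ hσ => ⟨?_, ?_, ?_, fun x hx => ?_⟩⟩
  · rintro _ ⟨⟨x, s⟩, ⟨hx, hs⟩, rfl⟩
    apply hmem
    have := hρ0 x hx
    rw [abs_mul, hσ, one_mul, abs_of_pos (mul_pos hs.1 this)]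
    exact mul_lt_of_lt_one_left this hs.2
  · rintro _ ⟨⟨x, s⟩, ⟨hx, hs⟩, rfl⟩
    have h1 : σ * σ = 1 := by rw [← abs_mul_abs_self, hσ, one_mul]
    change 0 < σ * (σ * (s * ρ x))
    rw [← mul_assoc, h1, one_mul]
    exact mul_pos hs.1 (hρ0 x hx)
  · apply (isPreconnected_Ioo.prod isPreconnected_Ioo).image
    apply Continuous.continuousOn
    have h1 : Continuous fun q : ℝ × ℝ => σ * (q.2 * ρ q.1) := by fun_prop
    exact (PiLp.continuous_toLp 2 _).comp (continuous_pi fun i => by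
      fin_cases i
      · exact continuous_fst
      · exact h1)
  · have h1 : ∀ᶠ z in 𝓝 (!₂[x, 0] : Plane), z 0 ∈ Ioo (0 : ℝ) 1 :=
      (Plane.contDiff_coord 0).continuous.continuousAt.eventually_mem (Ioo_mem_nhds hx.1 hx.2)
    have h2 : ∀ᶠ z in 𝓝 (!₂[x, 0] : Plane), |z 1| < ρ (z 0) := by
      apply ContinuousAt.eventually_lt
      · exact (Plane.contDiff_coord 1).continuous.abs.continuousAt
      · exact (hρc.comp (Plane.contDiff_coord 0).continuous).continuousAt
      · simpa using hρ0 x hx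
    filter_upwards [h1, h2] with z hz0 hz1 hz
    have hp := hρ0 _ hz0
    have hσσ : σ * σ = 1 := by rw [← abs_mul_abs_self, hσ, one_mul]
    refine ⟨(z 0, σ * z 1 / ρ (z 0)), ⟨hz0, div_pos hz hp, ?_⟩, ?_⟩
    · rw [div_lt_one hp]
      calc σ * z 1 ≤ |σ * z 1| := le_abs_self _
        _ = |z 1| := by rw [abs_mul, hσ, one_mul]
        _ < _ := hz1
    · apply Plane.ext'
      · rfl
      · change σ * (σ * z 1 / ρ (z 0) * ρ (z 0)) = z 1
        rw [div_mul_cancel₀ _ hp.ne', ← mul_assoc, hσσ, one_mul]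

/-- A disc slit along a radius is connected. -/
theorem Plane.isPreconnected_slit_ball (k : Plane) {r : ℝ} (hr : 0 < r) :
    IsPreconnected {z ∈ Metric.ball k r | ¬(z 1 = k 1 ∧ z 0 ≤ k 0)} := by
  have l0 : IsLinearMap ℝ fun z : Plane => z 0 := ⟨fun _ _ => rfl, fun _ _ => rfl⟩
  have l1 : IsLinearMap ℝ fun z : Plane => z 1 := ⟨fun _ _ => rfl, fun _ _ => rfl⟩
  -- The slit disc is the union of the convex right, upper and lower half-discs, and the first meets
  -- each of the other two.
  have c0 := ((convex_ball k r).inter (convex_halfSpace_gt l0 (k 0))).isPreconnected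
  have c1 := ((convex_ball k r).inter (convex_halfSpace_gt l1 (k 1))).isPreconnected
  have c2 := ((convex_ball k r).inter (convex_halfSpace_lt l1 (k 1))).isPreconnected
  have hpt : ∀ s : ℝ, |s| ≤ r / 4 → k + !₂[r / 4, s] ∈ Metric.ball k r := by
    intro s hs
    rw [mem_ball_iff_norm, add_sub_cancel_left]
    apply lt_of_pow_lt_pow_left₀ 2 hr.le
    rw [Plane.norm_sq]
    have := sq_le_sq' (abs_le.1 hs).1 (abs_le.1 hs).2
    simp only [Matrix.cons_val_zero, Matrix.cons_val_one]
    nlinarith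
  have h01 := c0.union (k + !₂[r / 4, r / 4])
    (show _ ∈ Metric.ball k r ∩ {w : Plane | k 0 < w 0} from
      ⟨hpt _ (by rw [abs_of_pos]; positivity), by simpa using hr⟩)
    (show _ ∈ Metric.ball k r ∩ {w : Plane | k 1 < w 1} from
      ⟨hpt _ (by rw [abs_of_pos]; positivity), by simpa using hr⟩) c1
  have h012 := h01.union (k + !₂[r / 4, -(r / 4)])
    (Or.inl (show _ ∈ Metric.ball k r ∩ {w : Plane | k 0 < w 0} from
      ⟨hpt _ (by rw [abs_neg, abs_of_pos]; positivity), by simpa using hr⟩))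
    (show _ ∈ Metric.ball k r ∩ {w : Plane | w 1 < k 1} from
      ⟨hpt _ (by rw [abs_neg, abs_of_pos]; positivity), by simpa using hr⟩) c2
  convert h012 using 1
  ext z
  simp only [mem_ofPred_eq, mem_union, mem_inter_iff]
  constructor
  · rintro ⟨hz, h⟩
    rcases lt_trichotomy (z 1) (k 1) with h1 | h1 | h1
    · exact Or.inr ⟨hz, h1⟩
    · exact Or.inl (Or.inl ⟨hz, not_le.1 fun h0 => h ⟨h1, h0⟩⟩)
    · exact Or.inl (Or.inr ⟨hz, h1⟩)
  · rintro ((⟨hz, h⟩ | ⟨hz, h⟩) | ⟨hz, h⟩)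
    · exact ⟨hz, fun h' => not_lt.2 h'.2 h⟩
    · exact ⟨hz, fun h' => h.ne' h'.1⟩
    · exact ⟨hz, fun h' => h.ne h'.1⟩

section Surface

variable {S : Type*} [TopologicalSpace S] [ChartedSpace Plane S] [IsManifold (𝓡 2) ∞ S] [T2Space S]

/-- Up to a diffeomorphism, a nonseparating simple closed curve has a chord that is a coordinate
segment. -/
theorem exists_chord [ConnectedSpace S] {a : Set S} (ha : IsSimpleClosedCurve a)
    (hn : IsNonseparating a) :
    ∃ a' : Set S, IsSimpleClosedCurve a' ∧ IsNonseparating a' ∧ ∃ e ∈ smoothCharts S,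
      (∀ x ∈ Icc (0 : ℝ) 1, (!₂[x, 0] : Plane) ∈ e.target) ∧
      e.symm !₂[0, 0] ∈ a' ∧ e.symm !₂[1, 0] ∈ a' ∧
      ∀ x ∈ Ioo (0 : ℝ) 1, e.symm !₂[x, 0] ∉ a' := by
  have hacl : IsClosed a := ha.isCompact.isClosed
  obtain ⟨γ, hγc, hγp, hγi, hγr⟩ := id ha
  have hane : a.Nonempty := hγr ▸ range_nonempty γ
  obtain ⟨p, hpf⟩ : (frontier a).Nonempty := by
    rw [nonempty_frontier_iff]
    refine ⟨hane, fun h => ?_⟩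
    obtain ⟨z, hz⟩ := hn.nonempty
    exact hz (h ▸ mem_univ z)
  have hpa : p ∈ a := hacl.frontier_subset hpf
  have hpc : p ∈ closure aᶜ := (frontier_eq_closure_inter_closure (s := a) ▸ hpf).2
  set e₀ := chartAt Plane p with he₀
  have hem : e₀ ∈ smoothCharts S := IsManifold.chart_mem_maximalAtlas p
  have hps : p ∈ e₀.source := mem_chart_source Plane p
  obtain ⟨R, hR, hRt, -⟩ := exists_closedBall_subset hps univ_mem
  have hbt := Metric.ball_subset_closedBall.trans hRt
  set U := e₀.symm '' Metric.ball (e₀ p) R with hU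
  have hUo : IsOpen U := isOpen_image_symm Metric.isOpen_ball hbt
  have hUc : IsPreconnected U := isPreconnected_image_symm Metric.isPreconnected_ball hbt
  have hpU : p ∈ U := ⟨e₀ p, Metric.mem_ball_self hR, e₀.left_inv hps⟩
  obtain ⟨o, hoU, hoa⟩ := mem_closure_iff_nhds.1 hpc U (hUo.mem_nhds hpU)
  obtain ⟨q, hqU, hqa, hqp⟩ : ∃ q ∈ U, q ∈ a ∧ q ≠ p := by
    obtain ⟨t₀, rfl⟩ : p ∈ range γ := hγr ▸ hpa
    obtain ⟨δ, hδ, hδB⟩ := Metric.mem_nhds_iff.1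
      (hγc.continuousAt.preimage_mem_nhds (hUo.mem_nhds hpU))
    have hm := lt_min hδ one_pos
    refine ⟨γ (t₀ + min δ 1 / 2), hδB ?_, hγr ▸ mem_range_self _, fun heq => ?_⟩
    · rw [Metric.mem_ball, Real.dist_eq, add_sub_cancel_left, abs_of_pos (by positivity)]
      linarith [min_le_left δ 1]
    · obtain ⟨n, hn⟩ := hγp.eq_add_int_of_eq hγi heq
      have h1 : (0 : ℝ) < n := by linarith
      have h2 : (n : ℝ) < 1 := by linarith [min_le_right δ 1]
      have h3 : (0 : ℤ) < n := by exact_mod_cast h1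
      have h4 : n < (1 : ℤ) := by exact_mod_cast h2
      omega
  obtain ⟨w, hw, rfl⟩ := hqU
  have hwp : w - e₀ p ≠ 0 := by
    intro h
    exact hqp (by rw [sub_eq_zero.1 h, e₀.left_inv hps])
  set σ : ℝ → Plane := fun x => e₀ p + x • (w - e₀ p) with hσ
  have hσc : Continuous σ := by fun_prop
  have hσ0 : σ 0 = e₀ p := by simp [hσ]
  have hσ1 : σ 1 = w := by simp [hσ]
  have hσb : ∀ x ∈ Icc (0 : ℝ) 1, σ x ∈ Metric.ball (e₀ p) R := by
    intro x hx
    rw [mem_ball_iff_norm] at hw ⊢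
    simp only [hσ, add_sub_cancel_left, norm_smul, Real.norm_of_nonneg hx.1]
    exact (mul_le_of_le_one_left (norm_nonneg _) hx.2).trans_lt hw
  have hσinj : Function.Injective σ := fun x y hxy => by
    simp only [hσ, add_right_inj] at hxy
    exact smul_left_injective ℝ hwp hxy
  have hσinj' : ∀ x ∈ Icc (0 : ℝ) 1, ∀ y ∈ Icc (0 : ℝ) 1, e₀.symm (σ x) = e₀.symm (σ y) → x = y :=
    fun x hx y hy h => hσinj (e₀.symm.injOn (hbt (hσb x hx)) (hbt (hσb y hy)) h)
  have m0 : (0 : ℝ) ∈ Icc (0 : ℝ) 1 := by norm_num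
  have m1 : (1 : ℝ) ∈ Icc (0 : ℝ) 1 := by norm_num
  have mh : (1 / 2 : ℝ) ∈ Icc (0 : ℝ) 1 := by norm_num
  have hp' : e₀.symm (σ 0) = p := by rw [hσ0, e₀.left_inv hps]
  have hq' : e₀.symm (σ 1) = e₀.symm w := by rw [hσ1]
  have hmem : ∀ x ∈ U, x ≠ p → x ≠ e₀.symm w → x ∈ (U \ {p}) \ {e₀.symm w} :=
    fun x h1 h2 h3 => ⟨⟨h1, h2⟩, h3⟩
  -- The straight segment between the two points of the curve might run inside the curve. Moving the
  -- point `o` off the curve to the midpoint, with both ends fixed, makes the new curve miss the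
  -- midpoint.
  obtain ⟨Φ, hΦ, hΦid⟩ := exists_diffeo_map_eq
    ((hUc.diff_point hUo p).diff_point (hUo.sdiff isClosed_singleton) (e₀.symm w))
    ((hUo.sdiff isClosed_singleton).sdiff isClosed_singleton)
    (hmem o hoU (fun h => hoa (h ▸ hpa)) (fun h => hoa (h ▸ hqa)))
    (hmem (e₀.symm (σ (1 / 2))) (mem_image_of_mem _ (hσb _ mh))
      (fun h => by rw [← hp'] at h; have := hσinj' _ mh _ m0 h; norm_num at this)
      (fun h => by rw [← hq'] at h; have := hσinj' _ mh _ m1 h; norm_num at this))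
  have hp2 : p ∈ Φ '' a := ⟨p, hpa, hΦid p fun h => h.1.2 rfl⟩
  have hq2 : e₀.symm w ∈ Φ '' a := ⟨_, hqa, hΦid _ fun h => h.2 rfl⟩
  have hm2 : e₀.symm (σ (1 / 2)) ∉ Φ '' a := by
    rintro ⟨z, hz, hzm⟩
    rw [← hΦ] at hzm
    exact hoa (EquivLike.injective Φ hzm ▸ hz)
  have ha' := ha.diffeo_image Φ
  set a' := Φ '' a with ha'def
  have hcl : ∀ s ⊆ Icc (0 : ℝ) 1, IsCompact s → IsCompact (s ∩ (fun x => e₀.symm (σ x)) ⁻¹' a') := by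
    intro s hs hsc
    have hc : ContinuousOn (fun x => e₀.symm (σ x)) s :=
      e₀.continuousOn_symm.comp hσc.continuousOn fun x hx => hbt (hσb x (hs hx))
    exact hsc.of_isClosed_subset
      (hc.preimage_isClosed_of_isClosed hsc.isClosed ha'.isCompact.isClosed) inter_subset_left
  -- The chord is the largest open subsegment about the midpoint that misses the curve; it is
  -- rescaled to `[0, 1]` below.
  obtain ⟨x₀, ⟨hx₀, hx₀a⟩, hx₀m⟩ := (hcl (Icc 0 (1 / 2)) (Icc_subset_Icc le_rfl (by norm_num))
    isCompact_Icc).exists_isGreatest ⟨0, by norm_num, by rwa [mem_preimage, hp']⟩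
  obtain ⟨x₁, ⟨hx₁, hx₁a⟩, hx₁m⟩ := (hcl (Icc (1 / 2) 1) (Icc_subset_Icc (by norm_num) le_rfl)
    isCompact_Icc).exists_isLeast ⟨1, by norm_num, by rwa [mem_preimage, hq']⟩
  have hlt0 : x₀ < 1 / 2 := lt_of_le_of_ne hx₀.2 fun h => hm2 (h ▸ hx₀a)
  have hlt1 : 1 / 2 < x₁ := lt_of_le_of_ne hx₁.1 fun h => hm2 (h ▸ hx₁a)
  obtain ⟨G, hGs, hGt, hG, hG', hGx⟩ := Plane.exists_affine (σ x₀)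
    (show (x₁ - x₀) • (w - e₀ p) ≠ 0 from smul_ne_zero (by linarith) hwp)
  have hGσ : ∀ x : ℝ, G !₂[x, 0] = σ (x₀ + x * (x₁ - x₀)) := fun x => by
    rw [hGx]; simp only [hσ]; module
  have hsy : ∀ x : ℝ, (e₀.trans G.symm).symm !₂[x, 0] = e₀.symm (σ (x₀ + x * (x₁ - x₀))) :=
    fun x => by rw [← hGσ]; rfl
  refine ⟨a', ha', hn.diffeo_image Φ, e₀.trans G.symm, ?_, ?_, ?_, ?_, ?_⟩
  · exact trans_mem_smoothCharts hem hG'.contDiffOn (by simpa using hG.contDiffOn)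
  · intro x hx
    have h1 : σ (x₀ + x * (x₁ - x₀)) ∈ e₀.target := by
      apply hbt (hσb _ ⟨?_, ?_⟩)
      · have := mul_nonneg hx.1 (show 0 ≤ x₁ - x₀ by linarith)
        linarith [hx₀.1]
      · have := mul_le_of_le_one_left (show 0 ≤ x₁ - x₀ by linarith) hx.2
        linarith [hx₁.2]
    rw [OpenPartialHomeomorph.trans_target]
    refine ⟨by simp [hGs], ?_⟩
    rw [mem_preimage, OpenPartialHomeomorph.symm_symm, hGσ]
    exact h1
  · rw [hsy, zero_mul, add_zero]; exact hx₀a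
  · rw [hsy, one_mul, add_sub_cancel]; exact hx₁a
  · intro x hx hmem
    rw [hsy] at hmem
    have hpos : 0 < x₁ - x₀ := by linarith
    have h1 : x₀ < x₀ + x * (x₁ - x₀) := by linarith [mul_pos hx.1 hpos]
    have h2 : x₀ + x * (x₁ - x₀) < x₁ := by linarith [mul_lt_of_lt_one_left hpos hx.2]
    rcases le_total (x₀ + x * (x₁ - x₀)) (1 / 2) with h | h
    · exact absurd (hx₀m ⟨⟨by linarith [hx₀.1], h⟩, hmem⟩) (not_le.2 h1)
    · exact absurd (hx₁m ⟨⟨h, by linarith [hx₁.2]⟩, hmem⟩) (not_le.2 h2)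

/-- What is left is a union of other components, all open by local connectedness. -/
theorem isOpen_diff_connectedComponentIn {U : Set S} (hU : IsOpen U) (x : S) :
    IsOpen (U \ connectedComponentIn U x) := by
  have : LocallyConnectedSpace S := ChartedSpace.locallyConnectedSpace Plane S
  rw [isOpen_iff_mem_nhds]
  rintro z ⟨hz, hzx⟩
  refine mem_of_superset (hU.connectedComponentIn.mem_nhds (mem_connectedComponentIn hz))
    fun y hy => ⟨connectedComponentIn_subset _ _ hy, fun hyx => hzx ?_⟩
  rw [connectedComponentIn_eq hyx, ← connectedComponentIn_eq hy]
  exact mem_connectedComponentIn hz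

/-- The theta curve argument: if the union `A ∪ B` of two arcs does not separate and `c` is a chord
with the same ends as `A` and `B`, then the two sides of `c` lie in the same component of the
complement of `A ∪ c` or of `B ∪ c`. -/
theorem exists_connected_sides {A B : Set S} (hA : IsClosed A) (hB : IsClosed B)
    (hAB : IsPreconnected (A ∪ B)ᶜ) {e : OpenPartialHomeomorph S Plane}
    (ht : ∀ x ∈ Icc (0 : ℝ) 1, (!₂[x, 0] : Plane) ∈ e.target)
    (hoff : ∀ x ∈ Ioo (0 : ℝ) 1, e.symm !₂[x, 0] ∉ A ∪ B) (h0A : e.symm !₂[0, 0] ∈ A ∪ B)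
    (h1A : e.symm !₂[1, 0] ∈ A ∪ B) {c : Set S}
    (hc : c = (fun x : ℝ => e.symm !₂[x, 0]) '' Icc 0 1) (hABc : A ∩ B ⊆ c) :
    ∃ X, (X = A ∨ X = B) ∧ ∃ W : Set S, IsOpen W ∧ IsPreconnected W ∧ W ⊆ (X ∪ c)ᶜ ∧
      ∀ᶠ z in 𝓝 (!₂[1 / 2, 0] : Plane), z 1 ≠ 0 → e.symm z ∈ W := by
  have : LocallyConnectedSpace S := ChartedSpace.locallyConnectedSpace Plane S
  have hmk : Continuous fun x : ℝ => (!₂[x, 0] : Plane) :=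
    (Plane.contDiff_mk contDiff_id contDiff_const).continuous
  have hcc : IsClosed c := by
    rw [hc]
    exact (isCompact_Icc.image_of_continuousOn
      (e.continuousOn_symm.comp hmk.continuousOn fun x hx => ht x hx)).isClosed
  have hmemc : ∀ z ∈ e.target, e.symm z ∈ c → z 1 = 0 ∧ z 0 ≤ 1 := by
    intro z hz hzc
    rw [hc] at hzc
    obtain ⟨x, hx, hxz⟩ := hzc
    rw [← e.symm.injOn (ht x hx) hz hxz]
    exact ⟨by simp, by simpa using hx.2⟩
  set O : Set Plane := e.target ∩ e.symm ⁻¹' (A ∪ B)ᶜ with hO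
  have hOo : IsOpen O := e.isOpen_inter_preimage_symm (hA.union hB).isOpen_compl
  obtain ⟨T, hT⟩ := Plane.exists_collars hOo ⟨!₂[1, 0], fun h => h.2 h1A⟩
    fun x hx => ⟨ht x (Ioo_subset_Icc_self hx), hoff x hx⟩
  obtain ⟨hpO, hpp, hpc, hpn⟩ := hT 1 (by simp)
  obtain ⟨hmO, hmm, hmc, hmn⟩ := hT (-1) (by simp)
  have hhalf : (1 / 2 : ℝ) ∈ Ioo (0 : ℝ) 1 := by norm_num
  -- points of both collars close to the chord
  have hpts : ∀ σ : ℝ, |σ| = 1 → ∀ x ∈ Ioo (0 : ℝ) 1, ∀ N ∈ 𝓝 (!₂[x, 0] : Plane),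
      (T σ ∩ N).Nonempty := by
    intro σ hσ x hx N hN
    have hcont : Continuous fun s : ℝ => (!₂[x, σ * s] : Plane) :=
      (Plane.contDiff_mk contDiff_const (contDiff_const.mul contDiff_id)).continuous
    have h0 : Tendsto (fun s : ℝ => (!₂[x, σ * s] : Plane)) (𝓝[>] 0) (𝓝 !₂[x, 0]) := by
      have := hcont.tendsto 0
      rw [mul_zero] at this
      exact this.mono_left nhdsWithin_le_nhds
    obtain ⟨s, ⟨hs1, hs2⟩, hs3⟩ := ((h0.eventually (((hT σ hσ).2.2.2 x hx).and hN)).and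
      self_mem_nhdsWithin).exists
    refine ⟨_, hs1 ?_, hs2⟩
    have : σ * σ = 1 := by rw [← abs_mul_abs_self, hσ, one_mul]
    change 0 < σ * (σ * s)
    rw [← mul_assoc, this, one_mul]
    exact hs3
  obtain ⟨zp, hzp, -⟩ := hpts 1 (by simp) _ hhalf univ univ_mem
  have hside : ∀ X ⊆ A ∪ B, ∀ σ : ℝ, |σ| = 1 → e.symm '' T σ ⊆ (X ∪ c)ᶜ := by
    rintro X hX σ hσ _ ⟨z, hz, rfl⟩ (h | h)
    · exact ((hT σ hσ).1 hz).2 (hX h)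
    · have h1 := (hT σ hσ).2.1 z hz
      rw [(hmemc z ((hT σ hσ).1 hz).1 h).1, mul_zero] at h1
      exact lt_irrefl _ h1
  have hTc : ∀ σ : ℝ, |σ| = 1 → IsPreconnected (e.symm '' T σ) := fun σ hσ =>
    isPreconnected_image_symm (hT σ hσ).2.2.1 ((hT σ hσ).1.trans inter_subset_left)
  have hcomp : ∀ X ⊆ A ∪ B,
      e.symm '' T 1 ⊆ connectedComponentIn (X ∪ c)ᶜ (e.symm zp) := fun X hX =>
    (hTc 1 (by simp)).subset_connectedComponentIn (mem_image_of_mem _ hzp)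
      (hside X hX 1 (by simp))
  have hdone : ∀ X, (X = A ∨ X = B) → IsClosed X → X ⊆ A ∪ B →
      (e.symm '' T (-1) ∩ connectedComponentIn (X ∪ c)ᶜ (e.symm zp)).Nonempty →
      ∃ X, (X = A ∨ X = B) ∧ ∃ W : Set S, IsOpen W ∧ IsPreconnected W ∧ W ⊆ (X ∪ c)ᶜ ∧
        ∀ᶠ z in 𝓝 (!₂[1 / 2, 0] : Plane), z 1 ≠ 0 → e.symm z ∈ W := by
    rintro X hX hXcl hXAB ⟨y, hyT, hyW⟩
    refine ⟨X, hX, connectedComponentIn (X ∪ c)ᶜ (e.symm zp),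
      (hXcl.union hcc).isOpen_compl.connectedComponentIn, isPreconnected_connectedComponentIn,
      connectedComponentIn_subset _ _, ?_⟩
    have hTm : e.symm '' T (-1) ⊆ connectedComponentIn (X ∪ c)ᶜ (e.symm zp) := by
      rw [connectedComponentIn_eq hyW]
      exact (hTc (-1) (by simp)).subset_connectedComponentIn hyT (hside X hXAB _ (by simp))
    filter_upwards [hpn _ hhalf, hmn _ hhalf] with z h1 h2 hz
    rcases lt_or_gt_of_ne hz with h | h
    · exact hTm (mem_image_of_mem _ (h2 (by linarith)))
    · exact hcomp X hXAB (mem_image_of_mem _ (h1 (by linarith)))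
  by_cases hdA : (e.symm '' T (-1) ∩ connectedComponentIn (A ∪ c)ᶜ (e.symm zp)).Nonempty
  · exact hdone A (Or.inl rfl) hA subset_union_left hdA
  by_cases hdB : (e.symm '' T (-1) ∩ connectedComponentIn (B ∪ c)ᶜ (e.symm zp)).Nonempty
  · exact hdone B (Or.inr rfl) hB subset_union_right hdB
  -- Otherwise the component of `(A ∪ c)ᶜ` and that of `(B ∪ c)ᶜ` containing the upper collar both
  -- miss the lower one. They agree near the interior of `c`, hence on the connected set `(A ∪ B)ᶜ`.
  -- Their union is then open and closed off `c`, which is impossible: past the end of the chord, a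
  -- slit disc off `c` connects the two collars.
  exfalso
  rw [not_nonempty_iff_eq_empty] at hdA hdB
  have hUA : IsOpen (A ∪ c)ᶜ := (hA.union hcc).isOpen_compl
  have hUB : IsOpen (B ∪ c)ᶜ := (hB.union hcc).isOpen_compl
  have oA : IsOpen (connectedComponentIn (A ∪ c)ᶜ (e.symm zp)) := hUA.connectedComponentIn
  have oB : IsOpen (connectedComponentIn (B ∪ c)ᶜ (e.symm zp)) := hUB.connectedComponentIn
  have oA' := isOpen_diff_connectedComponentIn hUA (e.symm zp)
  have oB' := isOpen_diff_connectedComponentIn hUB (e.symm zp)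
  have sA : connectedComponentIn (A ∪ c)ᶜ (e.symm zp) ⊆ (A ∪ c)ᶜ := connectedComponentIn_subset _ _
  have sB : connectedComponentIn (B ∪ c)ᶜ (e.symm zp) ⊆ (B ∪ c)ᶜ := connectedComponentIn_subset _ _
  have cA := hcomp A subset_union_left
  have cB := hcomp B subset_union_right
  set WA := connectedComponentIn (A ∪ c)ᶜ (e.symm zp) with hWA
  set WB := connectedComponentIn (B ∪ c)ᶜ (e.symm zp) with hWB
  have dA : ∀ z ∈ T (-1), e.symm z ∉ WA := fun z hz h =>
    absurd (show e.symm z ∈ e.symm '' T (-1) ∩ WA from ⟨mem_image_of_mem _ hz, h⟩) (by rw [hdA]; simp)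
  have dB : ∀ z ∈ T (-1), e.symm z ∉ WB := fun z hz h =>
    absurd (show e.symm z ∈ e.symm '' T (-1) ∩ WB from ⟨mem_image_of_mem _ hz, h⟩) (by rw [hdB]; simp)
  -- the two components agree off the curve
  set G : Set S := {z | z ∈ WA ↔ z ∈ WB} with hG
  have hlocconst : ∀ z ∈ (A ∪ B)ᶜ, z ∉ c → ∀ᶠ y in 𝓝 z, y ∈ G ↔ z ∈ G := by
    intro z hz hzc
    have h1 : ∀ᶠ y in 𝓝 z, y ∈ WA ↔ z ∈ WA := by
      by_cases h : z ∈ WA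
      · exact (oA.eventually_mem h).mono fun y hy => ⟨fun _ => h, fun _ => hy⟩
      · exact (oA'.eventually_mem ⟨fun hh => hh.elim (fun hh => hz (Or.inl hh)) hzc, h⟩).mono
          fun y hy => ⟨fun hh => absurd hh hy.2, fun hh => absurd hh h⟩
    have h2 : ∀ᶠ y in 𝓝 z, y ∈ WB ↔ z ∈ WB := by
      by_cases h : z ∈ WB
      · exact (oB.eventually_mem h).mono fun y hy => ⟨fun _ => h, fun _ => hy⟩
      · exact (oB'.eventually_mem ⟨fun hh => hh.elim (fun hh => hz (Or.inr hh)) hzc, h⟩).mono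
          fun y hy => ⟨fun hh => absurd hh hy.2, fun hh => absurd hh h⟩
    filter_upwards [h1, h2] with y hy1 hy2
    change (y ∈ WA ↔ y ∈ WB) ↔ (z ∈ WA ↔ z ∈ WB)
    rw [hy1, hy2]
  have hcG : ∀ z ∈ c, z ∈ G := fun z hz =>
    ⟨fun h => absurd (Or.inr hz) (sA h), fun h => absurd (Or.inr hz) (sB h)⟩
  have hnear : ∀ z ∈ (A ∪ B)ᶜ, z ∈ c → ∀ᶠ y in 𝓝 z, y ∈ G := by
    intro z hz hzc
    rw [hc] at hzc
    obtain ⟨x, hx, rfl⟩ := id hzc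
    have hxI : x ∈ Ioo (0 : ℝ) 1 := by
      refine ⟨lt_of_le_of_ne hx.1 ?_, lt_of_le_of_ne hx.2 ?_⟩
      · rintro rfl
        exact hz h0A
      · rintro rfl
        exact hz h1A
    have h1 : ∀ᶠ w in 𝓝 (!₂[x, 0] : Plane), e.symm w ∈ G := by
      have hx1 : ∀ᶠ w in 𝓝 (!₂[x, 0] : Plane), w 0 ∈ Icc (0 : ℝ) 1 :=
        (Plane.contDiff_coord 0).continuous.continuousAt.eventually_mem
          (Icc_mem_nhds hxI.1 hxI.2)
      filter_upwards [hpn x hxI, hmn x hxI, hx1] with w hw1 hw2 hw3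
      rcases lt_trichotomy (w 1) 0 with h | h | h
      · have := hw2 (by linarith)
        exact ⟨fun hh => absurd hh (dA w this), fun hh => absurd hh (dB w this)⟩
      · apply hcG
        rw [hc]
        refine ⟨w 0, hw3, congrArg e.symm ?_⟩
        apply Plane.ext'
        · simp
        · simp [h]
      · have := mem_image_of_mem e.symm (hw1 (by linarith))
        exact ⟨fun _ => cB this, fun _ => cA this⟩
    have h2 : ContinuousAt e (e.symm !₂[x, 0]) := e.continuousAt (e.map_target (ht x hx))
    have h3 : Tendsto e (𝓝 (e.symm !₂[x, 0])) (𝓝 !₂[x, 0]) := by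
      have := h2.tendsto
      rwa [e.right_inv (ht x hx)] at this
    filter_upwards [h3.eventually h1, e.open_source.mem_nhds (e.map_target (ht x hx))] with y hy1 hy2
    rwa [e.left_inv hy2] at hy1
  have hmid : (1 / 2 : ℝ) ∈ Icc (0 : ℝ) 1 := by norm_num
  have hABG : (A ∪ B)ᶜ ⊆ G := by
    have hsub := hAB.subset_left_of_subset_union (u := {z | ∀ᶠ y in 𝓝 z, y ∈ G})
      (v := {z | ∀ᶠ y in 𝓝 z, y ∉ G})
      (isOpen_iff_mem_nhds.2 fun z hz => eventually_eventually_nhds.2 hz)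
      (isOpen_iff_mem_nhds.2 fun z hz => eventually_eventually_nhds.2 hz)
      (disjoint_left.2 fun z h1 h2 => h2.self_of_nhds h1.self_of_nhds)
      (fun z hz => by
        by_cases hzc : z ∈ c
        · exact Or.inl (hnear z hz hzc)
        · by_cases hzG : z ∈ G
          · exact Or.inl ((hlocconst z hz hzc).mono fun y hy => hy.2 hzG)
          · exact Or.inr ((hlocconst z hz hzc).mono fun y hy hyG => hzG (hy.1 hyG)))
      ⟨e.symm !₂[1 / 2, 0], hoff _ hhalf, hnear _ (hoff _ hhalf) (hc ▸ ⟨1 / 2, hmid, rfl⟩)⟩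
    exact fun z hz => (hsub hz).self_of_nhds
  -- Away from `c` a boundary point of `WA` lies on `A`, hence not on `B`. Nearby points of `WA` are
  -- then off both arcs, so they belong to `WB`, whose membership is locally constant there. The
  -- roles of `A` and `B` are symmetric.
  have hout : ∀ z ∉ c, z ∉ WA ∪ WB → ∀ᶠ y in 𝓝 z, y ∉ WA ∪ WB := by
    intro z hzc hz
    rw [mem_union, not_or] at hz
    by_cases hzA : z ∈ A
    · have hzB : z ∉ B := fun h => hzc (hABc ⟨hzA, h⟩)
      filter_upwards [oB'.mem_nhds ⟨fun h => h.elim hzB hzc, hz.2⟩] with y hy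
      rintro (h | h)
      · have h1 : y ∈ (A ∪ B)ᶜ := fun hh => hh.elim (fun hh => sA h (Or.inl hh))
          fun hh => hy.1 (Or.inl hh)
        exact hy.2 ((hABG h1).1 h)
      · exact hy.2 h
    · filter_upwards [oA'.mem_nhds ⟨fun h => h.elim hzA hzc, hz.1⟩] with y hy
      rintro (h | h)
      · exact hy.2 h
      · have h1 : y ∈ (A ∪ B)ᶜ := fun hh => hh.elim (fun hh => hy.1 (Or.inl hh))
          fun hh => sB h (Or.inl hh)
        exact hy.2 ((hABG h1).2 h)
  -- so their union has both collars on the same side near the end of the chord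
  obtain ⟨r, hr, hrt⟩ := Metric.isOpen_iff.1 e.open_target _ (ht 1 (by norm_num))
  set D : Set Plane := {z ∈ Metric.ball (!₂[1, 0] : Plane) r |
    ¬(z 1 = (!₂[1, 0] : Plane) 1 ∧ z 0 ≤ (!₂[1, 0] : Plane) 0)} with hD
  have hDc : e.symm '' D ⊆ cᶜ := by
    rintro _ ⟨z, hz, rfl⟩ hzc
    obtain ⟨h1, h2⟩ := hmemc z (hrt hz.1) hzc
    exact hz.2 ⟨by simpa using h1, by simpa using h2⟩
  have hDpre : IsPreconnected (e.symm '' D) :=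
    isPreconnected_image_symm (Plane.isPreconnected_slit_ball _ hr) fun z hz => hrt hz.1
  have hDT : ∀ σ : ℝ, |σ| = 1 → (T σ ∩ D).Nonempty := by
    intro σ hσ
    set x := 1 - min r 1 / 2 with hx
    have hm := lt_min hr one_pos
    have hxI : x ∈ Ioo (0 : ℝ) 1 := ⟨by linarith [min_le_right r 1], by linarith⟩
    have hxb : (!₂[x, 0] : Plane) ∈ Metric.ball (!₂[1, 0] : Plane) r := by
      rw [mem_ball_iff_norm]
      have : (!₂[x, 0] : Plane) - !₂[1, 0] = !₂[x - 1, 0] := by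
        apply Plane.ext' <;> simp
      rw [this, Plane.norm_mk_zero, abs_lt]
      constructor <;> linarith [min_le_left r 1]
    obtain ⟨z, hzT, hzb⟩ := hpts σ hσ x hxI _ (Metric.isOpen_ball.mem_nhds hxb)
    refine ⟨z, hzT, hzb, fun h => ?_⟩
    have h1 := (hT σ hσ).2.1 z hzT
    have h2 : z 1 = 0 := by simpa using h.1
    rw [h2, mul_zero] at h1
    exact lt_irrefl _ h1
  obtain ⟨z₁, hz₁T, hz₁D⟩ := hDT 1 (by simp)
  obtain ⟨z₂, hz₂T, hz₂D⟩ := hDT (-1) (by simp)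
  have hsub := hDpre.subset_left_of_subset_union (u := WA ∪ WB)
    (v := {z | ∀ᶠ y in 𝓝 z, y ∉ WA ∪ WB}) (oA.union oB)
    (isOpen_iff_mem_nhds.2 fun z hz => eventually_eventually_nhds.2 hz)
    (disjoint_left.2 fun z h1 h2 => h2.self_of_nhds h1)
    (fun z hz => by
      by_cases h : z ∈ WA ∪ WB
      · exact Or.inl h
      · exact Or.inr (hout z (hDc hz) h))
    ⟨e.symm z₁, mem_image_of_mem _ hz₁D, Or.inl (cA (mem_image_of_mem _ hz₁T))⟩
  exact (hsub (mem_image_of_mem _ hz₂D)).elim (dA z₂ hz₂T) (dB z₂ hz₂T)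

end Surface

/-! ### Closing up an arc that returns near its start. -/

/-- A smooth arc running in along the ray spanned by `u` and out along the positive first axis. -/
noncomputable def bentRay (η : ℝ) (u : Plane) (t : ℝ) : Plane :=
  cornerRamp η t • !₂[1, 0] + cornerRamp η (-t) • u

section bentRay

variable {η : ℝ} {u : Plane}

theorem contDiff_bentRay : ContDiff ℝ ∞ (bentRay η u) :=
  (contDiff_cornerRamp.smul contDiff_const).add
    ((contDiff_cornerRamp.comp contDiff_neg).smul contDiff_const)

theorem bentRay_of_ge (hη : 0 < η) {t : ℝ} (ht : η ≤ t) : bentRay η u t = !₂[t + η, 0] := by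
  rw [bentRay, cornerRamp_of_ge hη ht, cornerRamp_of_le hη (by linarith), zero_smul, add_zero]
  apply Plane.ext' <;> simp

theorem bentRay_of_le (hη : 0 < η) {t : ℝ} (ht : t ≤ -η) : bentRay η u t = (η - t) • u := by
  rw [bentRay, cornerRamp_of_le hη ht, cornerRamp_of_ge hη (by linarith), zero_smul, zero_add]
  congr 1; ring

theorem norm_bentRay_le (hη : 0 < η) (hu : ‖u‖ = 1) {t : ℝ} (ht : |t| < 2 * η) :
    ‖bentRay η u t‖ ≤ 6 * η := by
  have h1 := cornerRamp_le hη ht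
  have h2 := cornerRamp_le hη (t := -t) (by rwa [abs_neg])
  have h3 : ‖bentRay η u t‖ ≤ _ := norm_add_le _ _
  rw [norm_smul, norm_smul, hu, Plane.norm_mk_zero, Real.norm_of_nonneg (cornerRamp_nonneg hη _),
    Real.norm_of_nonneg (cornerRamp_nonneg hη _), abs_one] at h3
  linarith

/-- Equality would give `p = q` on taking norms, and then equal unit vectors. Since one coefficient
of `bentRay` increases while the other decreases, this yields both its injectivity and its nonzero
velocity. -/
theorem Plane.smul_ne_smul_of_ne (hu : ‖u‖ = 1) (hu1 : u ≠ !₂[1, 0]) {p q : ℝ} (hp : 0 ≤ p)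
    (hq : 0 ≤ q) (hpq : 0 < p + q) : p • (!₂[1, 0] : Plane) - q • u ≠ 0 := by
  intro h
  rw [sub_eq_zero] at h
  have h1 := congrArg norm h
  rw [norm_smul, norm_smul, hu, Plane.norm_mk_zero, Real.norm_of_nonneg hp, Real.norm_of_nonneg hq,
    abs_one, mul_one, mul_one] at h1
  rw [h1] at h
  exact hu1 (smul_right_injective Plane (show q ≠ 0 by linarith) h).symm

theorem deriv_bentRay_ne_zero (hη : 0 < η) (hu : ‖u‖ = 1) (hu1 : u ≠ !₂[1, 0]) (t : ℝ) :
    deriv (bentRay η u) t ≠ 0 := by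
  have hr : Differentiable ℝ (cornerRamp η) := contDiff_cornerRamp.differentiable (by simp)
  have h1 := (hr t).hasDerivAt.smul_const (!₂[1, 0] : Plane)
  have h2 := ((hr (-t)).hasDerivAt.scomp t (hasDerivAt_neg t)).smul_const u
  have h3 : HasDerivAt (bentRay η u) _ t := h1.add h2
  have hn := fun s => (monotone_cornerRamp hη).deriv_nonneg (x := s)
  rw [h3.deriv, smul_eq_mul, neg_one_mul, neg_smul, ← sub_eq_add_neg]
  apply Plane.smul_ne_smul_of_ne hu hu1 (hn _) (hn _)
  rcases lt_or_ge (-η) t with h | h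
  · linarith [deriv_cornerRamp_pos hη h, hn (-t)]
  · linarith [deriv_cornerRamp_pos hη (t := -t) (by linarith), hn t]

theorem bentRay_injective (hη : 0 < η) (hu : ‖u‖ = 1) (hu1 : u ≠ !₂[1, 0]) :
    Function.Injective (bentRay η u) := by
  have key : ∀ s t, s < t → bentRay η u s ≠ bentRay η u t := by
    intro s t hst h
    have h1 := monotone_cornerRamp hη hst.le
    have h2 := monotone_cornerRamp hη (neg_le_neg hst.le)
    have h3 : 0 < (cornerRamp η t - cornerRamp η s) + (cornerRamp η (-s) - cornerRamp η (-t)) := by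
      rcases lt_or_ge (-η) s with h' | h'
      · linarith [cornerRamp_lt hη h' hst]
      · rcases lt_or_ge t η with h'' | h''
        · linarith [cornerRamp_lt hη (s := -t) (t := -s) (by linarith) (by linarith)]
        · linarith [cornerRamp_of_le hη h', cornerRamp_of_ge hη h'']
    apply Plane.smul_ne_smul_of_ne hu hu1 (sub_nonneg.2 h1) (sub_nonneg.2 h2) h3
    rw [← sub_eq_zero] at h
    rw [← neg_eq_zero, ← h, bentRay, bentRay]
    module
  intro s t hst
  rcases lt_trichotomy s t with h | h | h
  · exact absurd hst (key s t h)
  · exact h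
  · exact absurd hst.symm (key t s h)

end bentRay

section Surface

variable {S : Type*} [TopologicalSpace S] [ChartedSpace Plane S] [IsManifold (𝓡 2) ∞ S] [T2Space S]

/-- An embedded arc that starts along a coordinate axis and comes back near its starting point
can be closed up near that point. -/
theorem exists_smoothParam_of_returning_arc {e : OpenPartialHomeomorph S Plane}
    (he : e ∈ smoothCharts S) {E : ℝ → S} {R s T : ℝ} (hR : 0 < R) (hRs : R < s)
    (hRt : Metric.closedBall (0 : Plane) R ⊆ e.target)
    (hsm : ∀ t ∈ Ioc 0 T, ContMDiffAt 𝓘(ℝ, ℝ) (𝓡 2) ∞ E t)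
    (himm : ∀ t ∈ Ioc 0 T, Function.Injective (mfderiv 𝓘(ℝ, ℝ) (𝓡 2) E t))
    (hinj : InjOn E (Icc 0 T))
    (hlin : ∀ x ∈ Icc 0 s, (!₂[x, 0] : Plane) ∈ e.target ∧ E x = e.symm !₂[x, 0])
    {t₀ : ℝ} (ht₀ : t₀ ∈ Icc s T) (hE₀ : E t₀ ∈ e.symm '' Metric.ball 0 R)
    (hET : E T ∉ e.symm '' Metric.closedBall 0 R) :
    ∃ (γ : ℝ → S) (y : Set S), IsSmoothParam γ y ∧ ∃ t ∈ Ioo s T,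
      y \ e.symm '' Metric.ball 0 R = E '' Icc 0 t \ e.symm '' Metric.ball 0 R := by
  have hs0 : 0 < s := hR.trans hRs
  have hsT : s ≤ T := ht₀.1.trans ht₀.2
  have hBt : Metric.ball (0 : Plane) R ⊆ e.target := Metric.ball_subset_closedBall.trans hRt
  have hVo : IsOpen (e.symm '' Metric.ball (0 : Plane) R) := isOpen_image_symm Metric.isOpen_ball hBt
  have hcont : ContinuousOn E (Icc s T) := fun t ht =>
    (hsm t ⟨by linarith [ht.1], ht.2⟩).continuousAt.continuousWithinAt
  have hKc : IsClosed (e.symm '' Metric.closedBall (0 : Plane) R) :=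
    ((isCompact_closedBall _ _).image_of_continuousOn (e.continuousOn_symm.mono hRt)).isClosed
  set M : Set ℝ := Icc s T ∩ E ⁻¹' (e.symm '' Metric.closedBall 0 R) with hM
  have hMc : IsCompact M :=
    isCompact_Icc.of_isClosed_subset (hcont.preimage_isClosed_of_isClosed isClosed_Icc hKc)
      inter_subset_left
  have hMs : ∀ t ∈ M, E t ∈ e.source := by
    rintro t ⟨-, z, hz, hzt⟩
    rw [← hzt]; exact e.map_target (hRt hz)
  have hfc : ContinuousOn (fun t => ‖e (E t)‖) M :=
    (e.continuousOn.comp (hcont.mono inter_subset_left) hMs).norm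
  -- The time of closest return to the origin. It is interior to `[s, T]`, since at both ends the
  -- arc is outside the open disc, so the distance is critical there.
  obtain ⟨t₁, ht₁, hmin⟩ := hMc.exists_isMinOn
    ⟨t₀, ht₀, image_mono Metric.ball_subset_closedBall hE₀⟩ hfc
  have hmin' : ∀ t ∈ M, ‖e (E t₁)‖ ≤ ‖e (E t)‖ := fun t ht => hmin ht
  set z := e (E t₁) with hz
  set r := ‖z‖ with hr
  have hEz : e.symm z = E t₁ := e.left_inv (hMs _ ht₁)
  have hrR : r < R := by
    obtain ⟨w, hw, hw'⟩ := hE₀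
    have h := hmin' t₀ ⟨ht₀, w, Metric.ball_subset_closedBall hw, hw'⟩
    rw [← hw', e.right_inv (hBt hw)] at h
    exact h.trans_lt (mem_ball_zero_iff.1 hw)
  have hzR : z ∈ Metric.ball (0 : Plane) R := mem_ball_zero_iff.2 hrR
  have ht₁s : s < t₁ := by
    refine lt_of_le_of_ne ht₁.1.1 fun h => ?_
    have h1 := (hlin s ⟨hs0.le, le_rfl⟩)
    rw [h] at h1
    have h2 : z = !₂[t₁, 0] := by rw [hz, h1.2, e.right_inv h1.1]
    rw [hr, h2, Plane.norm_mk_zero, abs_of_pos (by linarith)] at hrR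
    linarith
  have ht₁T : t₁ < T := lt_of_le_of_ne ht₁.1.2 fun h => hET (h ▸ ht₁.2)
  have hne : ∀ x ∈ Ico 0 t₁, E x ≠ E t₁ := fun x hx h => hx.2.ne
    (hinj ⟨hx.1, by linarith [hx.2]⟩ ⟨by linarith, ht₁T.le⟩ h)
  have hr0 : 0 < r := by
    refine norm_pos_iff.2 fun h => hne 0 ⟨le_rfl, by linarith⟩ ?_
    rw [← hEz, h, (hlin 0 ⟨le_rfl, hs0.le⟩).2]
    congr 1; apply Plane.ext' <;> simp
  -- the velocity at the closest return is orthogonal to the position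
  have hE1 := hsm t₁ ⟨by linarith, ht₁T.le⟩
  have hD := contDiffAt_chart_comp he hE1 (hMs _ ht₁)
  have hd := (hD.differentiableAt (by simp)).hasDerivAt
  set d := deriv (fun t => e (E t)) t₁ with hd'
  have hd0 : d ≠ 0 := (mfderiv_injective_iff he hE1 (hMs _ ht₁)).1 (himm t₁ ⟨by linarith, ht₁T.le⟩)
  have horth : z 0 * d 0 + z 1 * d 1 = 0 := by
    have hc : ∀ i, HasDerivAt (fun t => e (E t) i) (d i) t₁ := fun i =>
      ((EuclideanSpace.proj (𝕜 := ℝ) i : Plane →L[ℝ] ℝ).hasFDerivAt).comp_hasDerivAt t₁ hd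
    have hq : HasDerivAt (fun t => e (E t) 0 ^ 2 + e (E t) 1 ^ 2) _ t₁ :=
      ((hc 0).pow 2).add ((hc 1).pow 2)
    have hlm : IsLocalMin (fun t => e (E t) 0 ^ 2 + e (E t) 1 ^ 2) t₁ := by
      have h1 : ∀ᶠ t in 𝓝 t₁, E t ∈ e.symm '' Metric.ball 0 R :=
        hE1.continuousAt.eventually_mem (hVo.mem_nhds ⟨z, hzR, hEz⟩)
      filter_upwards [h1, Icc_mem_nhds ht₁s ht₁T] with t h2 h3
      rw [← Plane.norm_sq, ← Plane.norm_sq]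
      have := hmin' t ⟨h3, image_mono Metric.ball_subset_closedBall h2⟩
      gcongr
    have := hlm.hasDerivAt_eq_zero hq
    simp only [Nat.cast_ofNat, Nat.add_one_sub_one, pow_one] at this
    simp only [hz]
    linarith
  -- The loop starts at the closest return point `z`, runs straight towards the origin, bends onto
  -- the axis and follows `E` back to `z`. With `h = r / 10` the bend, of norm at most `6 * h`,
  -- stays in the disc of radius `r`, which `E` does not enter after time `s`.
  set h := r / 10 with hh
  have hh0 : 0 < h := by positivity
  set u : Plane := r⁻¹ • z with hu'
  have hru : r • u = z := smul_inv_smul₀ hr0.ne' z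
  have hu : ‖u‖ = 1 := by
    rw [hu', norm_smul, norm_inv, Real.norm_of_nonneg hr0.le]
    exact inv_mul_cancel₀ hr0.ne'
  have hu1 : u ≠ !₂[1, 0] := by
    intro h1
    apply hne r ⟨hr0.le, by linarith⟩
    rw [(hlin r ⟨hr0.le, by linarith⟩).2, ← hEz, ← hru, h1]
    congr 1; apply Plane.ext' <;> simp
  have hdu : Plane.det d (-u) ≠ 0 := by
    intro h1
    have h2 : d 0 * z 1 - d 1 * z 0 = 0 := by
      rw [← hru]
      simp only [Plane.det, PiLp.neg_apply] at h1
      simp only [PiLp.smul_apply, smul_eq_mul]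
      linear_combination (-r) * h1
    -- Lagrange's identity: this product is the sum of the squares of the determinant and of the
    -- inner product of `d` and `z`.
    have h3 : ‖d‖ ^ 2 * r ^ 2 = 0 := by
      rw [hr, Plane.norm_sq, Plane.norm_sq]
      linear_combination (d 0 * z 1 - d 1 * z 0) * h2 + (z 0 * d 0 + z 1 * d 1) * horth
    have h4 : 0 < ‖d‖ := norm_pos_iff.2 hd0
    have : 0 < ‖d‖ ^ 2 * r ^ 2 := by positivity
    linarith
  set β := bentRay h u with hβ
  have hβc : Continuous β := contDiff_bentRay.continuous
  -- the bent start of the arc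
  have hβr : ∀ x, -(r - h) ≤ x → x < h → ‖β x‖ ≤ r := by
    intro x h1 h2
    rcases lt_or_ge (-h) x with h3 | h3
    · have := norm_bentRay_le hh0 hu (t := x) (by rw [abs_lt]; constructor <;> linarith)
      linarith
    · rw [hβ, bentRay_of_le hh0 h3, norm_smul, hu, Real.norm_of_nonneg (by linarith)]
      linarith
  have hβt : ∀ x, -(r - h) ≤ x → x < s - h → β x ∈ e.target := by
    intro x h1 h2
    rcases lt_or_ge x h with h3 | h3
    · exact hBt (mem_ball_zero_iff.2 ((hβr x h1 h3).trans_lt hrR))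
    · rw [hβ, bentRay_of_ge hh0 h3]
      exact (hlin _ ⟨by linarith, by linarith⟩).1
  set g : ℝ → S := fun x => if x < s - h then e.symm (β x) else E (h + x) with hg
  have hgβ : ∀ x, x < s - h → g x = e.symm (β x) := fun x hx => if_pos hx
  have hgE : ∀ x, h ≤ x → g x = E (h + x) := by
    intro x hx
    by_cases h1 : x < s - h
    · rw [hgβ x h1, hβ, bentRay_of_ge hh0 hx, add_comm x]
      exact (hlin _ ⟨by linarith, by linarith⟩).2.symm
    · exact if_neg h1
  -- `bentRay` lags by `h` on the axis, hence the shift in `b`; at `a` its value is `(h - a) • u = r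
  -- • u = z`.
  set a := -(r - h) with ha
  set b := t₁ - h with hb
  have hga : g a = E t₁ := by
    rw [hgβ a (by linarith), hβ, bentRay_of_le hh0 (by linarith), ← hEz, ← hru]
    congr 2; rw [ha]; ring
  have hgb : g b = E t₁ := by
    rw [hgE b (by linarith)]
    congr 1; rw [hb]; ring
  have hsmβ : ∀ x, x < s - h → β x ∈ e.target → ContMDiffAt 𝓘(ℝ, ℝ) (𝓡 2) ∞ g x := by
    intro x h1 h2
    refine (contMDiffAt_symm_comp he contDiff_bentRay.contDiffAt h2).congr_of_eventuallyEq ?_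
    exact (eventually_lt_nhds h1).mono fun y hy => hgβ y hy
  have hevE : ∀ x, h < x → g =ᶠ[𝓝 x] fun y => E (h + y) := fun x hx =>
    (eventually_gt_nhds hx).mono fun y hy => hgE y hy.le
  have hsmE : ∀ x, h < x → x < T - h → ContMDiffAt 𝓘(ℝ, ℝ) (𝓡 2) ∞ g x := fun x h1 h2 =>
    (contMDiffAt_comp_const_add (hsm _ ⟨by linarith, by linarith⟩)).congr_of_eventuallyEq
      (hevE x h1)
  have heg : ∀ x, x < s - h → β x ∈ e.target → (fun y => e (g y)) =ᶠ[𝓝 x] β := by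
    intro x h1 h2
    filter_upwards [eventually_lt_nhds h1, hβc.continuousAt.eventually_mem (e.open_target.mem_nhds h2)]
      with y h3 h4
    rw [hgβ y h3, e.right_inv h4]
  obtain ⟨γ, y, hγ, hy⟩ := exists_smoothParam_rounding (g := g) (a := a) (b := b) (by linarith) he
    (hMs _ ht₁)
    (by
      intro x hx
      rcases lt_or_ge x (s - h) with h1 | h1
      · filter_upwards [eventually_lt_nhds h1, hβc.continuousAt.eventually_mem
          (e.open_target.mem_nhds (hβt x hx.1 h1))] with y h3 h4
        exact hsmβ y h3 h4
      · filter_upwards [Ioo_mem_nhds (show h < x by linarith) (show x < T - h by linarith [hx.2])]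
          with y h3
        exact hsmE y h3.1 h3.2)
    (by
      intro x hx
      rcases lt_or_ge x (s - h) with h1 | h1
      · have h2 := hβt x hx.1.le h1
        rw [mfderiv_injective_iff he (hsmβ x h1 h2) (by rw [hgβ x h1]; exact e.map_target h2),
          (heg x h1 h2).deriv_eq]
        exact deriv_bentRay_ne_zero hh0 hu hu1 x
      · have h2 : h + x ∈ Ioc 0 T := ⟨by linarith, by linarith [hx.2]⟩
        rw [(hevE x (by linarith)).mfderiv_eq]
        exact mfderiv_injective_comp_const_add (hsm _ h2) (himm _ h2))
    hga hgb
    (by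
      have key : ∀ x ∈ Ico a b, ∀ w ∈ Ico a b, x < s - h → s - h ≤ w → g x ≠ g w := by
        intro x hx w hw h1 h2 hxw
        rw [hgE w (by linarith)] at hxw
        rcases le_or_gt h x with h3 | h3
        · rw [hgE x h3] at hxw
          have := hinj ⟨by linarith, by linarith⟩ ⟨by linarith, by linarith [hw.2]⟩ hxw
          linarith
        · have h4 := hβr x hx.1 h3
          rw [hgβ x h1] at hxw
          -- If the initial bent part met the later arc, this would be a return at distance at most
          -- `r`, so by minimality the meeting point could only be `z` itself, which the arc reaches
          -- only at `t₁`.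
          have h5 := hmin' (h + w) ⟨⟨by linarith, by linarith [hw.2]⟩, β x,
            mem_closedBall_zero_iff.2 (h4.trans hrR.le), hxw⟩
          rw [← hxw, e.right_inv (hβt x hx.1 h1)] at h5
          rcases lt_or_ge (-h) x with h6 | h6
          · have := norm_bentRay_le hh0 hu (t := x) (by rw [abs_lt]; constructor <;> linarith)
            linarith
          · rw [hβ, bentRay_of_le hh0 h6, norm_smul, hu, Real.norm_of_nonneg (by linarith)] at h5
            have hxa : x = a := le_antisymm (by linarith) hx.1
            rw [← hgβ x h1, hxa, hga] at hxw
            exact hne (h + w) ⟨by linarith, by linarith [hw.2]⟩ hxw.symm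
      intro x hx w hw hxw
      rcases lt_or_ge x (s - h) with h1 | h1 <;> rcases lt_or_ge w (s - h) with h2 | h2
      · rw [hgβ x h1, hgβ w h2] at hxw
        exact bentRay_injective hh0 hu hu1
          (e.symm.injOn (hβt x hx.1 h1) (hβt w hw.1 h2) hxw)
      · exact absurd hxw (key x hx w hw h1 h2)
      · exact absurd hxw.symm (key w hw x hx h2 h1)
      · rw [hgE x (by linarith), hgE w (by linarith)] at hxw
        have := hinj ⟨by linarith, by linarith [hx.2]⟩ ⟨by linarith, by linarith [hw.2]⟩ hxw
        linarith)
    (by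
      have h1 : deriv (fun x => e (g x)) b = d := by
        have h2 : (fun x => e (g x)) =ᶠ[𝓝 b] fun x => e (E (h + x)) :=
          (hevE b (by linarith)).fun_comp e
        rw [h2.deriv_eq, deriv_comp_const_add (f := fun x => e (E x)), hd']
        congr 1; rw [hb]; ring
      have h2 : deriv (fun x => e (g x)) a = -u := by
        have h3 : β =ᶠ[𝓝 a] fun x => (h - x) • u :=
          (eventually_lt_nhds (show a < -h by linarith)).mono fun x hx =>
            bentRay_of_le hh0 hx.le
        rw [((heg a (by linarith) (hβt a le_rfl (by linarith))).trans h3).deriv_eq]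
        have h4 := ((hasDerivAt_id a).const_sub h).smul_const u
        rw [neg_one_smul] at h4
        exact h4.deriv
      rw [h1, h2]
      exact hdu)
    (hVo.mem_nhds ⟨z, hzR, hEz⟩)
  refine ⟨γ, y, hγ, t₁, ⟨ht₁s, ht₁T⟩, hy.trans ?_⟩
  ext p
  constructor
  · rintro ⟨⟨x, hx, rfl⟩, hp⟩
    refine ⟨?_, hp⟩
    rcases le_or_gt h x with h1 | h1
    · rw [hgE x h1]
      exact ⟨h + x, ⟨by linarith, by linarith [hx.2]⟩, rfl⟩
    · refine absurd ⟨β x, mem_ball_zero_iff.2 ((hβr x hx.1 h1).trans_lt hrR), ?_⟩ hp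
      exact (hgβ x (by linarith)).symm
  · rintro ⟨⟨x, hx, rfl⟩, hp⟩
    refine ⟨?_, hp⟩
    rcases lt_or_ge x R with h1 | h1
    · refine absurd ⟨!₂[x, 0], ?_, (hlin x ⟨hx.1, by linarith⟩).2.symm⟩ hp
      rwa [mem_ball_zero_iff, Plane.norm_mk_zero, abs_of_nonneg hx.1]
    · refine ⟨x - h, ⟨by linarith, by linarith [hx.2]⟩, ?_⟩
      rw [hgE _ (by linarith)]
      congr 1; ring

end Surface

/-! ### From a chord to a smooth nonseparating curve. -/

section Surface

variable {S : Type*} [TopologicalSpace S] [ChartedSpace Plane S] [IsManifold (𝓡 2) ∞ S] [T2Space S]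

theorem isPreconnected_half_closedBall (k : Plane) (r σ : ℝ) :
    IsPreconnected (Metric.closedBall k r ∩ {z : Plane | 0 < σ * z 1}) := by
  apply Convex.isPreconnected
  apply (convex_closedBall k r).inter
  have h : IsLinearMap ℝ fun z : Plane => σ * z 1 :=
    ⟨fun x y => by simp [mul_add], fun c x => by simp [mul_left_comm]⟩
  exact convex_halfSpace_gt h 0

/-- A chord whose two sides are joined off the chord and off a set `A` linking its endpoints gives
rise to a smooth nonseparating curve. -/
theorem exists_smoothNonsepCurve_of_chord [ConnectedSpace S] {e : OpenPartialHomeomorph S Plane}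
    (he : e ∈ smoothCharts S) (ht : ∀ x ∈ Icc (0 : ℝ) 1, (!₂[x, 0] : Plane) ∈ e.target) {A : Set S}
    (hAv : IsPreconnected (A \ {e.symm !₂[0, 0]}))
    (hv : e.symm !₂[0, 0] ∈ closure (A \ {e.symm !₂[0, 0]})) (hu : e.symm !₂[1, 0] ∈ A)
    (hoff : ∀ x ∈ Ioo (0 : ℝ) 1, e.symm !₂[x, 0] ∉ A) {W : Set S} (hWo : IsOpen W)
    (hWc : IsPreconnected W)
    (hW : W ⊆ (A ∪ (fun x : ℝ => e.symm !₂[x, 0]) '' Icc 0 1)ᶜ)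
    (hWk : ∀ᶠ z in 𝓝 (!₂[1 / 2, 0] : Plane), z 1 ≠ 0 → e.symm z ∈ W) :
    ∃ a : Set S, IsSmoothNonsepCurve a := by
  have : LocallyPathConnectedSpace S := ChartedSpace.locallyPathConnectedSpace Plane S
  have : LocallyConnectedSpace S := ChartedSpace.locallyConnectedSpace Plane S
  have hmks : ContDiff ℝ ∞ fun x : ℝ => (!₂[x, 0] : Plane) :=
    Plane.contDiff_mk contDiff_id contDiff_const
  have hmk := hmks.continuous
  have hmki : ∀ x y : ℝ, (!₂[x, 0] : Plane) = !₂[y, 0] → x = y := fun x y h => by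
    simpa using congrArg (fun z : Plane => z 0) h
  have hzero : (!₂[0, 0] : Plane) = 0 := by apply Plane.ext' <;> simp
  have hdist : ∀ x y : ℝ, dist (!₂[x, 0] : Plane) !₂[y, 0] = |x - y| := by
    intro x y
    rw [dist_eq_norm, ← Plane.norm_mk_zero]
    congr 1
    apply Plane.ext' <;> simp
  set k : Plane := !₂[1 / 2, 0] with hk
  set P : ℝ → S := fun x => e.symm !₂[x, 0] with hP
  have hkt : k ∈ e.target := ht _ (by norm_num)
  -- a small disc about the midpoint of the chord
  obtain ⟨r₁, hr₁, hr₁'⟩ := Metric.eventually_nhds_iff.1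
    (hWk.and (e.open_target.eventually_mem hkt))
  set r := min (r₁ / 2) (1 / 8) with hr
  have hr0 : 0 < r := lt_min (by positivity) (by norm_num)
  have hr8 : r ≤ 1 / 8 := min_le_right _ _
  have hrt : ∀ z ∈ Metric.closedBall k r, z ∈ e.target := fun z hz =>
    (hr₁' (by linarith [Metric.mem_closedBall.1 hz, min_le_left (r₁ / 2) (1 / 8)])).2
  have hrW : ∀ z ∈ Metric.closedBall k r, z 1 ≠ 0 → e.symm z ∈ W := fun z hz =>
    (hr₁' (by linarith [Metric.mem_closedBall.1 hz, min_le_left (r₁ / 2) (1 / 8)])).1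
  set Δ : Set S := e.symm '' Metric.closedBall k r with hΔ
  have hΔc : IsClosed Δ :=
    ((isCompact_closedBall k r).image_of_continuousOn (e.continuousOn_symm.mono hrt)).isClosed
  have hΔn : Δ ∈ 𝓝 (e.symm k) :=
    mem_of_superset ((isOpen_image_symm Metric.isOpen_ball
      (Metric.ball_subset_closedBall.trans hrt)).mem_nhds
      (mem_image_of_mem _ (Metric.mem_ball_self hr0))) (image_mono Metric.ball_subset_closedBall)
  have hside : ∀ σ : ℝ, |σ| = 1 → (!₂[1 / 2, σ * (r / 2)] : Plane) ∈ Metric.closedBall k r := by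
    intro σ hσ
    rw [mem_closedBall_iff_norm]
    have : (!₂[1 / 2, σ * (r / 2)] : Plane) - k = !₂[0, σ * (r / 2)] := by
      apply Plane.ext' <;> simp [hk]
    rw [this, Plane.norm_zero_mk, abs_mul, hσ, abs_of_pos (by positivity)]
    linarith
  have hsideW : ∀ σ : ℝ, |σ| = 1 → e.symm !₂[1 / 2, σ * (r / 2)] ∈ W := by
    intro σ hσ
    refine hrW _ (hside σ hσ) ?_
    have h1 : σ ≠ 0 := by rintro rfl; simp at hσ
    have h2 : σ * (r / 2) ≠ 0 := mul_ne_zero h1 (by positivity)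
    simpa using h2
  -- A path off `A` and off the chord, joining its two sides. It will join the two sides of the
  -- final curve.
  obtain ⟨l, hl⟩ : JoinedIn W (e.symm !₂[1 / 2, 1 * (r / 2)]) (e.symm !₂[1 / 2, -1 * (r / 2)]) :=
    ((hWo.isConnected_iff_isPathConnected).1 ⟨⟨_, hsideW 1 (by simp)⟩, hWc⟩).joinedIn _
      (hsideW 1 (by simp)) _ (hsideW (-1) (by simp))
  set Λ := range l with hΛ
  have hΛc : IsClosed Λ := (isCompact_range l.continuous).isClosed
  have hΛW : Λ ⊆ W := by rintro _ ⟨t, rfl⟩; exact hl t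
  have hΛA : ∀ x ∈ A, x ∉ Λ := fun x hx h => hW (hΛW h) (Or.inl hx)
  have hΛP : ∀ x ∈ Icc (0 : ℝ) 1, P x ∉ Λ := fun x hx h => hW (hΛW h) (Or.inr ⟨x, hx, rfl⟩)
  set C := P '' Icc 0 (1 / 2) with hC
  have hCc : IsClosed C :=
    (isCompact_Icc.image_of_continuousOn (e.continuousOn_symm.comp hmk.continuousOn
      fun x hx => ht x ⟨hx.1, by linarith [hx.2]⟩)).isClosed
  have hPΔ : ∀ x, (!₂[x, 0] : Plane) ∈ e.target → (P x ∈ Δ ↔ |x - 1 / 2| ≤ r) := by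
    intro x hx
    rw [← hdist x (1 / 2), ← hk, ← Metric.mem_closedBall]
    constructor
    · rintro ⟨z, hz, hzx⟩
      rwa [← e.symm.injOn (hrt z hz) hx hzx]
    · exact fun h => ⟨_, h, rfl⟩
  have hPC : ∀ x, 1 / 2 < x → (!₂[x, 0] : Plane) ∈ e.target → P x ∉ C := by
    rintro x hx hxt ⟨y, hy, hyx⟩
    have := hmki _ _ (e.symm.injOn (ht y ⟨hy.1, by linarith [hy.2]⟩) hxt hyx)
    linarith [hy.2]
  -- The complement of what has to stay fixed: the path, the disc about the midpoint and the first
  -- half of the chord. As `A` without the initial point is connected, it lies in one component `Q`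
  -- of `N`.
  set N := (Λ ∪ Δ ∪ C)ᶜ with hN
  have hNo : IsOpen N := ((hΛc.union hΔc).union hCc).isOpen_compl
  have h1t := ht 1 (by simp)
  have huN : P 1 ∈ N := by
    rintro ((h | h) | h)
    · exact hΛA _ hu h
    · rw [hPΔ 1 h1t, abs_of_pos (by norm_num)] at h
      linarith
    · exact hPC 1 (by norm_num) h1t h
  have hAN : A \ {P 0} ⊆ N := by
    rintro x ⟨hxA, hx0⟩ ((h | ⟨z, hz, rfl⟩) | ⟨y, hy, rfl⟩)
    · exact hΛA _ hxA h
    · by_cases h1 : z 1 = 0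
      · have h2 : z = !₂[z 0, 0] := by apply Plane.ext' <;> simp [h1]
        rw [h2] at hxA hz
        have h3 := abs_le.1 ((hdist _ _).ge.trans hz)
        exact hoff (z 0) ⟨by linarith [h3.1], by linarith [h3.2]⟩ hxA
      · exact hW (hrW z hz h1) (Or.inl hxA)
    · rcases hy.1.eq_or_lt with rfl | h1
      · exact hx0 rfl
      · exact hoff y ⟨h1, by linarith [hy.2]⟩ hxA
  set Q := connectedComponentIn N (P 1) with hQ
  have hQo : IsOpen Q := hNo.connectedComponentIn
  have hQN : Q ⊆ N := connectedComponentIn_subset _ _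
  have hP01 : P 1 ≠ P 0 := fun h => by
    have := hmki _ _ (e.symm.injOn h1t (ht 0 (by simp)) h)
    norm_num at this
  have hAQ : A \ {P 0} ⊆ Q := hAv.subset_connectedComponentIn ⟨hu, hP01⟩ hAN
  have huQ : P 1 ∈ Q := hAQ ⟨hu, hP01⟩
  have h0t := ht 0 (by simp)
  -- a small disc about the initial point of the chord
  obtain ⟨R₁, hR₁, hR₁t, hR₁Λ⟩ := exists_closedBall_subset (e.map_target h0t)
    (hΛc.isOpen_compl.mem_nhds (hΛP 0 (by simp)))
  rw [e.right_inv h0t, hzero] at hR₁t hR₁Λ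
  set R := min R₁ (1 / 8) with hR
  have hR0 : 0 < R := lt_min hR₁ (by norm_num)
  have hR8 : R ≤ 1 / 8 := min_le_right _ _
  have hRR : Metric.closedBall (0 : Plane) R ⊆ Metric.closedBall 0 R₁ :=
    Metric.closedBall_subset_closedBall (min_le_left _ _)
  have hRt := hRR.trans hR₁t
  have hBt : Metric.ball (0 : Plane) R ⊆ e.target := Metric.ball_subset_closedBall.trans hRt
  set V := e.symm '' Metric.ball (0 : Plane) R with hV
  have hVΛ : ∀ x ∈ V, x ∉ Λ := by
    rintro _ ⟨z, hz, rfl⟩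
    exact hR₁Λ z (hRR (Metric.ball_subset_closedBall hz))
  have hVΔ : ∀ x ∈ V, x ∉ Δ := by
    rintro _ ⟨z, hz, rfl⟩ ⟨z', hz', hzz⟩
    rw [e.symm.injOn (hrt z' hz') (hBt hz) hzz] at hz'
    have h1 := dist_triangle_left (0 : Plane) k z
    rw [← hzero, hk, hdist, abs_of_neg (by norm_num), ← hk, hzero] at h1
    linarith [Metric.mem_ball.1 hz, Metric.mem_closedBall.1 hz']
  have hRP : ∀ x, R < x → (!₂[x, 0] : Plane) ∈ e.target →
      P x ∉ e.symm '' Metric.closedBall (0 : Plane) R := by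
    rintro x hx hxt ⟨z, hz, hzx⟩
    rw [e.symm.injOn (hRt hz) hxt hzx, mem_closedBall_zero_iff, Plane.norm_mk_zero] at hz
    linarith [le_abs_self x]
  obtain ⟨w, hwV, hwA⟩ := mem_closure_iff_nhds.1 hv V
    ((isOpen_image_symm Metric.isOpen_ball hBt).mem_nhds
      ⟨_, by rw [hzero]; exact Metric.mem_ball_self hR0, rfl⟩)
  -- extend the chord slightly
  have hPcont : ContinuousAt P 1 :=
    (e.continuousAt_symm h1t).comp (f := fun x : ℝ => (!₂[x, 0] : Plane)) hmk.continuousAt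
  obtain ⟨η, hη, hη'⟩ := Metric.eventually_nhds_iff.1
    ((hmk.continuousAt.eventually_mem (e.open_target.mem_nhds h1t)).and
      (hPcont.eventually_mem (hQo.mem_nhds huQ)))
  set T := 1 + η / 2 with hT
  have hηT : ∀ x ∈ Icc 1 T, (!₂[x, 0] : Plane) ∈ e.target ∧ P x ∈ Q := fun x hx =>
    hη' (by rw [Real.dist_eq, abs_of_nonneg (by linarith [hx.1])]; linarith [hx.2])
  have hT1 : 1 < T := by linarith
  have hTt : ∀ x ∈ Icc 0 T, (!₂[x, 0] : Plane) ∈ e.target := fun x hx => by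
    rcases le_total x 1 with h | h
    · exact ht x ⟨hx.1, h⟩
    · exact (hηT x ⟨h, hx.2⟩).1
  have hTΛ : ∀ x ∈ Icc 0 T, P x ∉ Λ := fun x hx h1 => by
    rcases le_total x 1 with h | h
    · exact hΛP x ⟨hx.1, h⟩ h1
    · exact hQN (hηT x ⟨h, hx.2⟩).2 (Or.inl (Or.inl h1))
  have hTT := hηT T ⟨hT1.le, le_rfl⟩
  have hPi : InjOn P (Icc 0 T) := fun x hx y hy h =>
    hmki _ _ (e.symm.injOn (hTt x hx) (hTt y hy) h)
  have hPTR := hRP T (by linarith) hTT.1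
  -- Drags the end of the chord, inside `Q`, to a point `w` of `A` close to the start. The end `P T`
  -- of the extension is kept in place outside the disc, which forces the closest return to happen
  -- at an interior time.
  obtain ⟨Φ, hΦ, hΦoff⟩ := exists_diffeo_map_eq (Q := Q \ {P T}) (p := P 1) (q := w)
    (isPreconnected_connectedComponentIn.diff_point hQo (P T)) (hQo.sdiff isClosed_singleton)
    ⟨huQ, fun h => by
      have := hPi ⟨by norm_num, hT1.le⟩ ⟨by linarith, le_rfl⟩ h
      linarith⟩
    ⟨hAQ hwA, by
      rintro rfl
      exact hPTR (image_mono Metric.ball_subset_closedBall hwV)⟩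
  have hΦN : ∀ x ∈ Λ ∪ Δ ∪ C, Φ x = x := fun x hx => hΦoff x fun h => hQN h.1 hx
  have hPsm : ∀ x ∈ Icc 0 T, ContMDiffAt 𝓘(ℝ, ℝ) (𝓡 2) ∞ P x := fun x hx =>
    contMDiffAt_symm_comp he hmks.contDiffAt (hTt x hx)
  have hPimm : ∀ x ∈ Icc 0 T, Function.Injective (mfderiv 𝓘(ℝ, ℝ) (𝓡 2) P x) := by
    intro x hx
    rw [mfderiv_injective_iff he (hPsm x hx) (e.map_target (hTt x hx))]
    have h1 : (fun y => e (P y)) =ᶠ[𝓝 x] fun y => !₂[y, 0] :=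
      (hmk.continuousAt.eventually_mem (e.open_target.mem_nhds (hTt x hx))).mono
        fun y hy => e.right_inv hy
    rw [h1.deriv_eq]
    intro h2
    have h3 := (hmks.differentiable (by simp) x).hasDerivAt
    rw [h2] at h3
    have h4 : HasDerivAt (fun y : ℝ => y) ((EuclideanSpace.proj (𝕜 := ℝ) 0 : Plane →L[ℝ] ℝ) 0) x :=
      ((EuclideanSpace.proj (𝕜 := ℝ) 0 : Plane →L[ℝ] ℝ).hasFDerivAt).comp_hasDerivAt x h3
    have := h4.unique (hasDerivAt_id x)
    simp at this
  have hΦP : ∀ x ∈ Icc 0 (1 / 2 + r), Φ (P x) = P x := by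
    intro x hx
    apply hΦN
    rcases le_total x (1 / 2) with h | h
    · exact Or.inr ⟨x, ⟨hx.1, h⟩, rfl⟩
    · refine Or.inl (Or.inr ?_)
      rw [hPΔ x (hTt x ⟨hx.1, by linarith [hx.2]⟩), abs_of_nonneg (by linarith)]
      linarith [hx.2]
  obtain ⟨γ, y, hγ, t, htT, hy⟩ := exists_smoothParam_of_returning_arc he (E := fun x => Φ (P x))
    (s := 1 / 2 + r) (T := T) (t₀ := 1) hR0 (by linarith) hRt
    (fun x hx => Φ.contMDiff.contMDiffAt.comp x (hPsm x (Ioc_subset_Icc_self hx)))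
    (fun x hx => by
      have hc : mfderiv 𝓘(ℝ, ℝ) (𝓡 2) (fun x => Φ (P x)) x = _ :=
        mfderiv_comp x (Φ.contMDiff.contMDiffAt.mdifferentiableAt (by simp))
          ((hPsm x (Ioc_subset_Icc_self hx)).mdifferentiableAt (by simp))
      rw [hc]
      exact (SelfDiffeo.mfderiv_injective Φ _).comp (hPimm x (Ioc_subset_Icc_self hx)))
    (fun x hx y hy hxy => hPi hx hy (EquivLike.injective Φ hxy))
    (fun x hx => ⟨hTt x ⟨hx.1, by linarith [hx.2]⟩, hΦP x hx⟩)
    ⟨by linarith, hT1.le⟩ (hΦ ▸ hwV)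
    (by
      have : Φ (P T) = P T := hΦoff _ fun h => h.2 rfl
      simpa only [this] using hPTR)
  have hyE : ∀ x, x ∉ V → (x ∈ y ↔ ∃ τ ∈ Icc 0 t, Φ (P τ) = x) := fun x hx =>
    ⟨fun h => (hy.subset ⟨h, hx⟩).1, fun h => (hy.superset ⟨h, hx⟩).1⟩
  have hyΛ : ∀ x ∈ Λ, x ∉ y := by
    intro x hx hxy
    obtain ⟨τ, hτ, rfl⟩ := (hyE x fun h => hVΛ x h hx).1 hxy
    have h1 := EquivLike.injective Φ (hΦN _ (Or.inl (Or.inl hx)))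
    rw [h1] at hx
    exact hTΛ τ ⟨hτ.1, by linarith [hτ.2, htT.2]⟩ hx
  have hyΔ : ∀ z ∈ Metric.closedBall k r, (e.symm z ∈ y ↔ z 1 = 0) := by
    intro z hz
    have hzΔ : e.symm z ∈ Δ := mem_image_of_mem _ hz
    rw [hyE _ fun h => hVΔ _ h hzΔ]
    constructor
    · rintro ⟨τ, hτ, h⟩
      have h1 := EquivLike.injective Φ (h.trans (hΦN _ (Or.inl (Or.inr hzΔ))).symm)
      rw [← e.symm.injOn (hTt τ ⟨hτ.1, by linarith [hτ.2, htT.2]⟩) (hrt z hz) h1]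
      simp
    · intro h1
      have h2 : z = !₂[z 0, 0] := by apply Plane.ext' <;> simp [h1]
      rw [h2] at hz ⊢
      have h3 := abs_le.1 ((hdist _ _).ge.trans hz)
      exact ⟨z 0, ⟨by linarith [h3.1], by linarith [h3.2, htT.1]⟩,
        hΦP _ ⟨by linarith [h3.1], by linarith [h3.2]⟩⟩
  set H : ℝ → Set S := fun σ => e.symm '' (Metric.closedBall k r ∩ {z : Plane | 0 < σ * z 1})
    with hH
  have hHc : ∀ σ, IsPreconnected (H σ) := fun σ =>
    isPreconnected_image_symm (isPreconnected_half_closedBall k r σ) fun z hz => hrt z hz.1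
  have hHy : ∀ σ, ∀ x ∈ H σ, x ∉ y := by
    rintro σ _ ⟨z, ⟨hz, hz1⟩, rfl⟩ hzy
    have h1 := (hyΔ z hz).1 hzy
    simp only [mem_ofPred_eq, h1, mul_zero, lt_self_iff_false] at hz1
  have hHm : ∀ σ, |σ| = 1 → e.symm !₂[1 / 2, σ * (r / 2)] ∈ H σ := by
    intro σ hσ
    refine ⟨_, ⟨hside σ hσ, ?_⟩, rfl⟩
    have h1 : σ * σ = 1 := by rw [← abs_mul_abs_self, hσ, one_mul]
    change 0 < σ * (σ * (r / 2))
    rw [← mul_assoc, h1]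
    positivity
  -- The path together with the two half-discs at the midpoint is connected, misses `y` and contains
  -- both of its sides there.
  refine ⟨y, ⟨γ, hγ⟩, hγ.isNonseparating (p := e.symm k) ?_ hΔn (K := Λ ∪ H 1 ∪ H (-1)) ?_ ?_ ?_⟩
  · rw [hyΔ k (Metric.mem_closedBall_self hr0.le)]
    simp [hk]
  · refine IsPreconnected.union _ (Or.inl ⟨1, l.target⟩) (hHm (-1) (by simp))
      (IsPreconnected.union _ ⟨0, l.source⟩ (hHm 1 (by simp))
        (isPreconnected_range l.continuous) (hHc 1)) (hHc (-1))
  · rintro x ((h | h) | h)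
    · exact hyΛ x h
    · exact hHy _ x h
    · exact hHy _ x h
  · rintro _ ⟨⟨z, hz, rfl⟩, hzy⟩
    rw [hyΔ z hz] at hzy
    rcases lt_or_gt_of_ne hzy with h | h
    · exact Or.inr ⟨z, ⟨hz, by simpa using h⟩, rfl⟩
    · exact Or.inl (Or.inr ⟨z, ⟨hz, by simpa using h⟩, rfl⟩)

/-- A nonspherical smooth surface contains a smooth nonseparating curve. -/
theorem IsNonspherical.exists_smoothNonsepCurve [ConnectedSpace S] (h : IsNonspherical S) :
    ∃ a : Set S, IsSmoothNonsepCurve a := by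
  obtain ⟨a₀, ha₀, hn₀⟩ := h
  obtain ⟨a, ⟨γ, hγc, hγp, hγi, rfl⟩, hn, e, he, ht, h0, h1, hoff⟩ := exists_chord ha₀ hn₀
  have h01 : e.symm !₂[0, 0] ≠ e.symm !₂[1, 0] := fun h => by
    have := congrArg (fun z : Plane => z 0)
      (e.symm.injOn (ht 0 (by simp)) (ht 1 (by simp)) h)
    norm_num at this
  obtain ⟨s, hs⟩ := h0
  obtain ⟨t, hst, htu⟩ : ∃ t ∈ Ico s (s + 1), γ t = e.symm !₂[1, 0] := by
    obtain ⟨t, ht⟩ := h1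
    obtain ⟨t', ht', htt⟩ := hγp.exists_mem_Ico one_pos t s
    exact ⟨t', ht', htt.symm.trans ht⟩
  have hst' : s < t := hst.1.lt_of_ne fun h => h01 (by rw [← hs, ← htu, h])
  have hs1 : γ (s + 1) = e.symm !₂[0, 0] := (hγp s).trans hs
  have hinj : ∀ x y, x ∈ Icc s (s + 1) → y ∈ Icc s (s + 1) → γ x = γ y → x < y →
      x = s ∧ y = s + 1 := by
    intro x y hx hy hxy hlt
    obtain ⟨n, hn⟩ := Function.Periodic.eq_add_int_of_eq hγp hγi hxy.symm
    have h1 : (0 : ℝ) < n := by linarith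
    have h2 : (1 : ℝ) ≤ n := by exact_mod_cast (Int.cast_pos.1 h1 : (0 : ℤ) < n)
    constructor <;> linarith [hx.1, hy.2]
  have hAB : γ '' Icc s t ∪ γ '' Icc t (s + 1) = range γ := by
    rw [← image_union, Icc_union_Icc_eq_Icc hst'.le hst.2.le, hγp.image_Icc one_pos]
  have hmem : ∀ x ∈ Ioo (0 : ℝ) 1, e.symm !₂[x, 0] ∉ γ '' Icc s t ∪ γ '' Icc t (s + 1) :=
    fun x hx => hAB ▸ hoff x hx
  have hsA : γ s ∈ γ '' Icc s t := ⟨s, ⟨le_rfl, hst'.le⟩, rfl⟩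
  have htA : γ t ∈ γ '' Icc s t := ⟨t, ⟨hst'.le, le_rfl⟩, rfl⟩
  have htB : γ t ∈ γ '' Icc t (s + 1) := ⟨t, ⟨le_rfl, hst.2.le⟩, rfl⟩
  -- The ends of the chord cut the curve into two arcs which, with the chord, form a theta curve.
  obtain ⟨X, hX, W, hWo, hWc, hW, hWk⟩ := exists_connected_sides
    (A := γ '' Icc s t) (B := γ '' Icc t (s + 1))
    (isCompact_Icc.image hγc).isClosed (isCompact_Icc.image hγc).isClosed
    (by rw [hAB]; exact hn.isPreconnected) ht hmem (hs ▸ Or.inl hsA) (htu ▸ Or.inl htA) rfl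
    (by
      rintro _ ⟨⟨x, hx, rfl⟩, y, hy, hxy⟩
      rcases (hx.2.trans hy.1).eq_or_lt with h | h
      · rw [le_antisymm hx.2 (h ▸ hy.1), htu]
        exact ⟨1, by simp, rfl⟩
      · have := (hinj x y ⟨hx.1, by linarith [hx.2, hst.2]⟩ ⟨by linarith [hy.1], hy.2⟩ hxy.symm h).1
        rw [this, hs]
        exact ⟨0, by simp, rfl⟩)
  -- Removing the common endpoint leaves the image of a half-open interval, which is connected and
  -- accumulates at that endpoint.
  have key : IsPreconnected (X \ {e.symm !₂[0, 0]}) ∧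
      e.symm !₂[0, 0] ∈ closure (X \ {e.symm !₂[0, 0]}) ∧ e.symm !₂[1, 0] ∈ X := by
    rcases hX with rfl | rfl
    · have h1 : γ '' Icc s t \ {e.symm !₂[0, 0]} = γ '' Ioc s t := by
        ext p
        constructor
        · rintro ⟨⟨x, hx, rfl⟩, hp⟩
          exact ⟨x, ⟨hx.1.lt_of_ne fun h => hp (by rw [← h, hs]; rfl), hx.2⟩, rfl⟩
        · rintro ⟨x, hx, rfl⟩
          refine ⟨⟨x, Ioc_subset_Icc_self hx, rfl⟩, fun hp => ?_⟩
          have := (hinj s x ⟨le_rfl, by linarith⟩ ⟨hx.1.le, by linarith [hx.2, hst.2]⟩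
            (hs.trans hp.symm) hx.1).2
          linarith [hx.2, hst.2]
      rw [h1, ← hs, ← htu]
      refine ⟨isPreconnected_Ioc.image _ hγc.continuousOn, ?_, htA⟩
      exact image_closure_subset_closure_image hγc
        ⟨s, by rw [closure_Ioc hst'.ne]; exact ⟨le_rfl, hst'.le⟩, rfl⟩
    · have h1 : γ '' Icc t (s + 1) \ {e.symm !₂[0, 0]} = γ '' Ico t (s + 1) := by
        ext p
        constructor
        · rintro ⟨⟨x, hx, rfl⟩, hp⟩
          exact ⟨x, ⟨hx.1, hx.2.lt_of_ne fun h => hp (by rw [h, hs1]; rfl)⟩, rfl⟩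
        · rintro ⟨x, hx, rfl⟩
          refine ⟨⟨x, Ico_subset_Icc_self hx, rfl⟩, fun hp => ?_⟩
          have := (hinj x (s + 1) ⟨by linarith [hx.1], hx.2.le⟩ ⟨by linarith, le_rfl⟩
            (Eq.trans hp hs1.symm) hx.2).1
          linarith [hx.1]
      rw [h1, ← hs1, ← htu]
      refine ⟨isPreconnected_Ico.image _ hγc.continuousOn, ?_, htB⟩
      exact image_closure_subset_closure_image hγc
        ⟨s + 1, by rw [closure_Ico hst.2.ne]; exact ⟨hst.2.le, le_rfl⟩, rfl⟩
  refine exists_smoothNonsepCurve_of_chord he ht key.1 key.2.1 key.2.2 (fun x hx h => ?_) hWo hWc hW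
    hWk
  rcases hX with rfl | rfl
  · exact hmem x hx (Or.inl h)
  · exact hmem x hx (Or.inr h)

end Surface

theorem proposition5p1 (S : Type*) [TopologicalSpace S] [T2Space S]
    [SecondCountableTopology S] [ConnectedSpace S]
    [ChartedSpace (EuclideanSpace ℝ (Fin 2)) S] [IsManifold (𝓡 2) ∞ S]
    (hor : IsOrientableSurface S) (hns : IsNonspherical S) :
    homeoSmoothTransverse S ≤ homeoGroup S :=
  homeoSmoothTransverse_le_homeoGroup hns.exists_smoothNonsepCurve
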